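/- **Model.** Let $N$ be either Gaussian white noise or a rate-one Poisson process on $\mathbb R^2$, $K\ge 0$ a smooth radial kernel supported in the closed unit disc, $\psi$ smooth and non-decreasing with values in $(d_1,d_2)$, $0<d_1<d_2<\infty$. For a noise $N$ put $\Psi(x)=\psi\big(\int K(x-y)\,N(dy)\big)$ (continuous version). The length of a path $\gamma$ (of finite length) in $\Psi$ is $\int\Psi(\gamma)\,|d\gamma|$, and $X_n$ is the infimum of the lengths of the paths from $(0,0)$ to $(n,0)$. Let $Q$ be a fluctuation scale for $X_n$, i.e. $Q$ is non-decreasing and, for some $a,\theta>0$: $\mathbb P(|X_n-n|\ge xQ_n)\le e^{1-x^\theta}$ for $n\ge1$, $x>0$; $Q_n=\Theta(\mathrm{SD}(X_n))$; $n^{a}\le Q_n=O(\sqrt n)$ for large $n$; for every $\delta>0$, $(n'/n)^{a}Q_n\le Q_{n'}\le(n'/n)^{1/2+\delta}Q_n$ for $n'>n\ge n_0(\delta)$; $0\le\mathbb E X_n-n$ for $n\ge 1$, and $\mathbb E X_n-n=\Theta(Q_n)$. Put $W_x=\sqrt{xQ_x}$. **Columns and resampling.** For $k\in\mathbb Z$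 let $\Lambda_k=[(k-1)n,kn]\times\mathbb R$. The $k$-th noise equals $N$ inside $\Lambda_k$ and an independent copy of $N$ (one for each $k$) outside; this gives the field $\Psi^{k}$ used in $\Lambda_k$. Take an independent copy of all these noises and independent uniform $T_{kj}\in[0,1]$; the resampled $k$-th noise is obtained by replacing, for each $j$ with $T_{kj}>1-\kappa$, the $k$-th noise on $\mathbb R\times[(j-1)W_n,jW_n)$ by its copy ($\kappa^{-1}\ge2$ an integer). A prime denotes the environment after resampling. **Conforming paths.** A conforming path from $u$ to $v$ (not both on one line $x=kn$) passes through successive columns $\Lambda_a,\dots,\Lambda_b$; there are times $0=t_{a-1}\le t_a\le\dots\le t_b=1$ such that $\gamma([t_{k-1},t_k])\subset\Lambda_k$ and $\gamma(t_k)=(kn,y_k)$ with $|y_k|\le H:=n^\beta W_n$ for $a\le k<b$. Here $a=b$ if $u,v\in\Lambda_a$; otherwise a starting point on a column boundary belongs to the right column and an end point to the left one. The weight $\mathcal X_\gamma$ is the infimum, over such times, of the sum over $k$ of the length of $\gamma|_{[t_{k-1},t_k]}$ in $\Psi^k$ ($\mathcal X_\gamma=\infty$ if $\gamma$ is not conforming).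 $\mathcal X_{uv}$ is the infimum of $\mathcal X_\gamma$ over paths $\gamma$ from $u$ to $v$; $\widehat{\mathcal X}_\gamma=\mathcal X_\gamma-(v_1-u_1)-\frac{(v_2-u_2)^2}{2(v_1-u_1)}$, and $\widehat{\mathcal X}_{uv}=\inf\widehat{\mathcal X}_\gamma$. A geodesic is a conforming path from $(0,0)$ to $(Mn,0)$ of least weight, with crossing times attaining it. **Scales.** $M=2^{2^m}$, $m\in\mathbb N$; $\Phi=2^{m^5}$; $0\le\ell\le\frac1{100}\lfloor 2^m/m^5\rfloor$; $r=\Phi^\ell n$. In the following "height $h$" means second coordinate $hW_r$, $R_i[s,t]=[(i-1)r,ir]\times[sW_r,tW_r]$, and $S_i(s,t;s',t')$ is the infimum of $\widehat{\mathcal X}_\gamma$ over the paths $\gamma\subset R_i[s',t']$ from the line $x=(i-1)r$ to the line $x=ir$ with both end heights in $[s,t]$. **Elementary events** (for one environment). - $\mathcal K_{i,j,z}$: for all $x\in[(i-1)r,ir]$, $|y|\le H$, all paths $\gamma$ from $((i-1)r,y)$ to $(x,jW_r)$ satisfy $\mathcal X_\gamma-(x-(i-1)r)-\frac12(|y-jW_r|/W_r-1)^2Q_r\ge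 -zQ_r$, and all paths from $(x,jW_r)$ to $(ir,y)$ satisfy the same with $ir-x$ for $x-(i-1)r$. $\mathcal K^*_{i,j,z,w}=\mathcal K_{i,j-w,z}\cap\mathcal K_{i,j,z}\cap\mathcal K_{i,j+w,z}$. - $\mathcal I^{+}_{i,s,t,z}$: $S_i(s,t;s,t)\ge zQ_r$; $\mathcal I^-_{i,s,t,z}$: $S_i(s,t;s,t)\le zQ_r$. - $\mathcal J_{i,s,t,z,w}$: every path $\gamma\subset R_i[s,t]$ from some $u$ to some $v$ with $|u_2-v_2|\ge wW_r$ has $\mathcal X_\gamma-|u_1-v_1|\ge zQ_r$. - $\mathcal A^-_{i,j,z}$: $\widehat{\mathcal X}_{((i-1)r,y),(ir,y')}\le(|y-jW_r|+|y'-jW_r|)Q_r/W_r+zQ_r$ for $|y|,|y'|\le MW_n$. $\mathcal A^+_{i,j,z}$: $\widehat{\mathcal X}_{((i-1)r,y),(ir,y')}\ge-(|y-jW_r|+|y'-jW_r|)Q_r/W_r-zQ_r$ for $|y|,|y'|\le H$. - $\mathcal M_{i,s,t,z,w}$: $S_i(s,t;s,t)\le S_i(s,t;s-w,t+w)+zQ_r$.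 - Barrier $\mathrm{Bar}_i(s,t;z)=\mathcal I^+_{i,s',t',z}\cap\mathcal J_{i,s',t',z,w/3}$ with $s'=s+2/W_r$, $t'=t-2/W_r$. **Composite events** (parameters $L_0$, $L_1\in\mathbb N$, $L_2=L_1^{100}$, $w,\alpha,h,\delta_A,\theta_2$). Every condition is required both before and after resampling, except in $\mathcal B^{(4)}$. - $\mathcal B_{i,j}=\bigcap_{q\le7}\mathcal B^{(q)}_{i,j}$, where $\mathcal B^{(1)}=\mathcal I^-_{i,j-L_0/40,j+L_0/40,L_0}$. $\mathcal B^{(2)}$: every crossing of $R_i[j-\frac32L_0,j+\frac32L_0]$ from left to right with end heights in $[j-\frac14L_0,j+\frac14L_0]$ which is not contained in $R_i[j-\frac12L_0,j+\frac12L_0]$ has weight at least $r+\frac1{40}L_0^2Q_r$; and $\mathcal I^+_{i,j-\frac32L_0,j+\frac32L_0,-L_0}$. $\mathcal B^{(3)}=\mathcal I^+_{i,j-L_1-1,j-L_1+1,-L_0}\cap\mathcal I^+_{i,j+L_1-1,j+L_1+1,-L_0}$. $\mathcal B^{(4)}$: $\mathcal I^+_{i,j-\sqrt\alpha,j-\sqrt\alpha+h,-(\alpha-\alpha^{9/10})}$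 before resampling and $\mathcal I^-_{i,j-\sqrt\alpha,j-\sqrt\alpha+h,-(\alpha+\alpha^{9/10})}$ after. $\mathcal B^{(5)}=\mathcal M_{i,j-\sqrt\alpha,j-\sqrt\alpha+h,1,w}$. $\mathcal B^{(6)}$: $\mathcal K^*_{i,j+s,L_1,w}$ for $s\in\{\pm L_1,\pm(L_1-w),\pm\frac32L_0,-\sqrt\alpha-\frac23w,-\sqrt\alpha+h+\frac23w\}$. $\mathcal B^{(7)}$: $\mathrm{Bar}_i(j-L_1,j-\sqrt\alpha;L_2^2)$, $\mathrm{Bar}_i(j-\sqrt\alpha+h,j-L_0;L_2^2)$, $\mathrm{Bar}_i(j+L_0,j+L_1;L_2^2)$. - $\mathcal C_{i,j}=\mathcal A^-_{i,j,L_0}\cap\mathcal A^+_{i,j,L_0}$. - $\mathcal D_{i,j}=\bigcap_{q\le5}\mathcal D^{(q)}_{i,j}$: $\mathcal D^{(1)}=\mathcal I^-_{i,j-L_0/40,j+L_0/40,L_0}$; $\mathcal D^{(2)}=\mathcal I^+_{i,j-4L_0,j+4L_0,-L_0}$; $\mathcal D^{(3)}=\mathcal A^+_{i,j,L_0}$;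 $\mathcal D^{(4)}$: $\mathcal K_{i,j+s,L_1}$ for $s\in\{\pm(L_2-w),\pm\frac{L_0}{20},\pm(\frac{L_0}{20}-1)\}$; $\mathcal D^{(5)}$: $\mathrm{Bar}_i(j-L_2,j-\frac{L_0}{40};L_2^3)$ and $\mathrm{Bar}_i(j+\frac{L_0}{40},j+L_2;L_2^3)$. - $\mathcal Z_{i,j,k}$: for $|y|,|y'|\le MW_n$, $|\widehat{\mathcal X}_{(ir,y),((i+2^kL_2)r,y')}|\le\big(|\frac y{W_r}-j|^{1/100}+|\frac{y'}{W_r}-j|^{1/100}\big)\frac{Q_r}{2^kL_2^2}+(2^kL_2)^{3/5}Q_r$. $\mathcal Z^\bullet_{i,j,k}$ is the intersection of $\mathcal Z_{i',j,k}$ over $i'\in\{i-2^{k+1}L_2-3,\ i-2^kL_2-3,\ i+2,\ i+2^kL_2+2\}$. $\mathcal W^{loc}_{i,j}=\bigcap_{1\le k\le m^2}\mathcal Z^\bullet_{i,j,k}$. - $\mathcal W^*_i$: for all integers $0\le i'<i''\le i-3$ and all $i+2\le i'<i''\le M\Phi^{-\ell}$, with $q=(\log M)^{100/\theta_2}Q_{(i''-i')r}$,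 one has $|\widehat{\mathcal X}_{(i'r,y),(i''r,y')}|\le q$ for $|y|,|y'|\le MW_n$ and $\widehat{\mathcal X}_{(i'r,y),(i''r,y')}\ge-\max\{1,\frac{|y|+|y'|}{M^2W_n}\}q$ for $|y|,|y'|\le H$. $\mathcal W^{glo}_{i,j}=\mathcal W^*_i\cap\bigcap_k\mathcal Z^\bullet_{i,j,k}$ over $k\ge m^2$ with $2^kL_2\Phi^\ell\le\frac12M^{99/100}$. - Let $\hat V_j=((j-L_1)W_r,(j-L_0)W_r)\cup((j+L_0)W_r,(j+L_1)W_r)$ and $\hat V'_j=((j-L_2)W_r+2,(j-\frac{L_0}{40})W_r-2)\cup((j+\frac{L_0}{40})W_r+2,(j+L_2)W_r-2)$. For $F\subset\mathbb R$ let $\mathcal G_i(F)$ be the $\sigma$-algebra generated by the $k$-th noises of the original family and of the copy on $[(k-1)n-1,kn+1]\times F$, $(i-1)\Phi^\ell<k\le i\Phi^\ell$. Then $\mathcal P^-_{i,j}$ is the intersection of $\mathcal B^{(1)}_{i,j}$, $\{\mathbb P(\mathcal B^{(2)}_{i,j}\cap\mathcal B^{(3)}_{i,j}\mid\mathcal G_i(\hat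 V_j^c))\ge\frac12\}$, $\{\mathbb P(\mathcal B^{(6)}_{i,j}\mid\mathcal G_i(\hat V_j^c))\ge1-\frac{\delta_A}{100}\}$, $\mathcal D^{(1)}_{i',j}$ and $\{\mathbb P(\mathcal D^{(2)}_{i',j}\cap\mathcal D^{(3)}_{i',j}\cap\mathcal D^{(4)}_{i',j}\mid\mathcal G_{i'}(\hat V'^c_j))\ge\frac12\}$ for $i'=i\pm2$, $\mathcal C_{i-1,j}$, $\mathcal C_{i+1,j}$ and $\mathcal W^{loc}_{i,j}$. Finally $$\mathcal P_{i,j}=\mathcal P^-_{i,j}\cap\mathcal D_{i-2,j}\cap\mathcal D_{i+2,j}\cap\mathcal B_{i,j}\cap\mathcal W^{glo}_{i,j}.$$ **Types and blocks.** Let $\gamma^*$ be the part of a conforming path between its crossings of $x=(i-1)r$ and $x=ir$. Relative to $(i,j)$ the path is of Type 1 if $\gamma^*\subset R_i[j-\frac12L_0,j+\frac12L_0]$; of Type 2 if it is not of Type 1 and $\gamma^*\subset R_i[j-\frac32L_0,j+\frac32L_0]$; of Type 3 if $\gamma^*\subset R_i[j-\sqrt\alpha-\frac53w,j-\sqrt\alpha+h+\frac53w]$;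 of Type 4 if it is of none of the Types 1–3 and $\gamma^*$ meets $R_i[j-L_1+w,j+L_1-w]$; of Type 5 if it is of none of the Types 1–4 and $\gamma^*$ meets $R_i[j-L_1-\frac2{W_r},j+L_1+\frac2{W_r}]$; and of Type 6 otherwise. $\mathcal U_{kj}$ (resp. $\mathcal U'_{kj}$) is the event that the part of the geodesic $\gamma$ before (resp. $\gamma'$ after) resampling between its crossings of $x=(k-1)n$ and $x=kn$ comes within distance $1$ of the block $\Lambda_{kj}=[(k-1)n,kn]\times[(j-1)W_n,jW_n]$. If $\gamma$ crosses $x=ir$ at $(ir,y)$, put $J_i=\lfloor y/W_r\rfloor$. **Statement.** Let $\kappa^{-1}\geq 2$ be an integer and $\theta_2>0$. For all sufficiently small $\beta>0$, all $L_0$ sufficiently large, all $\delta_A>0$ and $0<w\le\frac14$, all integers $L_1$ sufficiently large (depending on all of the above), all $m$ with $M=2^{2^m}\ge M_0$, all $n$ sufficiently large (each threshold depending only on the quantities already fixed), all $0\le\ell\le\frac1{100}\lfloor2^m/m^5\rfloor$, all $\alpha\in[L_0^{100},2\kappa^{-1}L_0^{100}]$ and $h\in[1,\frac32]$, and all $i$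 with $2M^{99/100}n\le ir\le(M-2M^{99/100})n$, the following holds deterministically. On the event $\mathcal P_{i,J_i}\cap\{|J_i|W_r\le M^{4/5}W_n\}$, the geodesic $\gamma$ before resampling is of Type 1 and the geodesic $\gamma'$ after resampling is of Type 3 or of Type 6, relative to $(i,J_i)$; and for every integer $i'\in[(i-1)\Phi^\ell+1,i\Phi^\ell]$ and every $j\in\mathbb Z$ the events $\mathcal U_{i'j}$ and $\mathcal U'_{i'j}$ do not both occur. -/

import Mathlib

open Set Filter Topology MeasureTheory ProbabilityTheory
open scoped NNReal ENNReal

noncomputable section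

namespace FPP

/-! ### Noise, random fields and passage times -/

/-- The Euclidean plane. -/
abbrev Plane : Type := EuclideanSpace ℝ (Fin 2)

/-- The point with coordinates `(x, y)`. -/
def pt (x y : ℝ) : Plane := !₂[x, y]

/-- The two possible driving noises: Gaussian white noise and the rate one Poisson process. -/
inductive NoiseKind
  | white
  | poisson

/-- The law of the noise of a set of area `v`. -/
def NoiseKind.law : NoiseKind → ℝ≥0 → Measure ℝ
  | .white, v => gaussianReal 0 v
  | .poisson, v => (poissonMeasure v).map (fun k : ℕ => (k : ℝ))

/-- An independently scattered random set function on the plane (with Lebesgue control measure)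
with the given one-set laws: white noise, or the counting process of a Poisson process. -/
structure IsNoise {Ω : Type*} [MeasurableSpace Ω] (P : Measure Ω) (law : ℝ≥0 → Measure ℝ)
    (N : Set Plane → Ω → ℝ) : Prop where
  measurable : ∀ A, MeasurableSet A → volume A ≠ ∞ → Measurable (N A)
  map_eq : ∀ A, MeasurableSet A → volume A ≠ ∞ → P.map (N A) = law (volume A).toNNReal
  additive : ∀ A B, MeasurableSet A → MeasurableSet B → volume A ≠ ∞ → volume B ≠ ∞ →
    Disjoint A B → N (A ∪ B) =ᵐ[P] fun ω => N A ω + N B ω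
  indep : ∀ A : ℕ → Set Plane, (∀ k, MeasurableSet (A k)) → (∀ k, volume (A k) ≠ ∞) →
    Pairwise (fun k l => Disjoint (A k) (A l)) → iIndepFun (fun k => N (A k)) P

/-- The half-open dyadic square of side `2 ^ (-s)` with lower left corner `2 ^ (-s) q`. -/
def dyadicSquare (s : ℕ) (q : ℤ × ℤ) : Set Plane :=
  {y | (q.1 : ℝ) / 2 ^ s ≤ y 0 ∧ y 0 < (q.1 + 1 : ℝ) / 2 ^ s ∧
       (q.2 : ℝ) / 2 ^ s ≤ y 1 ∧ y 1 < (q.2 + 1 : ℝ) / 2 ^ s}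

/-- `Ξ` is a version, continuous in the space variable, of the field
`Ξ(x) = ∫ K(x - y) N(dy)`; the stochastic integral is the limit in probability of its dyadic
Riemann sums (finite sums, since `K` has compact support). -/
structure IsFieldOf {Ω : Type*} [MeasurableSpace Ω] (P : Measure Ω) (K : Plane → ℝ)
    (N : Set Plane → Ω → ℝ) (Ξ : Plane → Ω → ℝ) : Prop where
  measurable : ∀ x, Measurable (Ξ x)
  continuous : ∀ ω, Continuous fun x => Ξ x ω
  integral : ∀ x, TendstoInMeasure P
    (fun (s : ℕ) ω => ∑ᶠ q : ℤ × ℤ,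
      K (x - pt ((q.1 : ℝ) / 2 ^ s) ((q.2 : ℝ) / 2 ^ s)) * N (dyadicSquare s q) ω)
    atTop (Ξ x)

/-- The data of the model on a probability space `(Ω, P)`. `noise false` are the noises used for
`ω_⋆` and `noise true` those used for the independent copy `ω_∘`; `noise b none` is the noise of
the plane and `noise b (some i)` is the independent copy used outside the `i`-th column. `T i j`
are the uniform clocks of the blocks. -/
structure Model {Ω : Type*} [MeasurableSpace Ω] (P : Measure Ω) where
  kind : NoiseKind
  K : Plane → ℝ
  ψ : ℝ → ℝ
  d₁ : ℝ
  d₂ : ℝ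
  noise : Bool → Option ℤ → Set Plane → Ω → ℝ
  T : ℤ → ℤ → Ω → ℝ
  K_smooth : ContDiff ℝ ((⊤ : ℕ∞) : WithTop ℕ∞) K
  K_nonneg : ∀ x, 0 ≤ K x
  K_radial : ∀ x y : Plane, ‖x‖ = ‖y‖ → K x = K y
  K_support : ∀ x : Plane, 1 < ‖x‖ → K x = 0
  ψ_smooth : ContDiff ℝ ((⊤ : ℕ∞) : WithTop ℕ∞) ψ
  ψ_mono : Monotone ψ
  d₁_pos : 0 < d₁
  d₁_lt_d₂ : d₁ < d₂
  ψ_mem : ∀ s, ψ s ∈ Ioo d₁ d₂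
  noise_isNoise : ∀ b c, IsNoise P kind.law (noise b c)
  T_measurable : ∀ i j, Measurable (T i j)
  T_law : ∀ i j, P.map (T i j) = volume.restrict (Icc (0 : ℝ) 1)
  indep : iIndep (fun z : (Bool × Option ℤ) ⊕ (ℤ × ℤ) =>
    Sum.elim
      (fun bc => ⨆ (A : Set Plane) (_ : MeasurableSet A) (_ : volume A ≠ ∞),
        MeasurableSpace.comap (noise bc.1 bc.2 A) inferInstance)
      (fun ij => MeasurableSpace.comap (T ij.1 ij.2) inferInstance) z) P

/-- A path on `[0,1]` of finite length (parametrised in a Lipschitz way). -/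
def IsPath (γ : ℝ → Plane) : Prop := ∃ C : ℝ≥0, LipschitzOnWith C γ (Icc 0 1)

/-- The length of `γ` on the time interval `[s, t]` in the environment `Ψ`. -/
def pathLength (Ψ : Plane → ℝ) (γ : ℝ → Plane) (s t : ℝ) : ℝ :=
  ∫ τ in s..t, Ψ (γ τ) * ‖deriv γ τ‖

/-- The (unrestricted) first passage time `X_{uv}`. -/
def passageTime (Ψ : Plane → ℝ) (u v : Plane) : ℝ :=
  sInf {x | ∃ γ, IsPath γ ∧ γ 0 = u ∧ γ 1 = v ∧ x = pathLength Ψ γ 0 1}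

/-- `Q` is a scale sequence for the fluctuations of the passage time `X_n` from `0` to `(n,0)`:
`Q` is increasing, `|X_n - n| / Q_n` has stretched exponential tails, `Q_n` is of the order of the
standard deviation of `X_n`, `n ^ α ≤ Q_n = O(√n)`, `Q` has the regular growth displayed, and
`0 ≤ 𝔼 X_n - n = Θ(Q_n)` (so the field is normalised to have time constant `1`). -/
def Model.IsFluctuationScale {Ω : Type*} [MeasurableSpace Ω] {P : Measure Ω} (S : Model P)
    (Q : ℝ → ℝ) : Prop :=
  ∃ (Ξ : Plane → Ω → ℝ) (X : ℝ → Ω → ℝ) (a θ : ℝ),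
    IsFieldOf P S.K (S.noise false none) Ξ ∧
    (∀ n ω, X n ω = passageTime (fun x => S.ψ (Ξ x ω)) (pt 0 0) (pt n 0)) ∧
    0 < a ∧ 0 < θ ∧
    MonotoneOn Q (Ioi 0) ∧
    (∀ n, 1 ≤ n → ∀ x, 0 < x →
      P {ω | x ≤ |X n ω - n| / Q n} ≤ ENNReal.ofReal (Real.exp (1 - x ^ θ))) ∧
    (Q =Θ[atTop] fun n => √(variance (X n) P)) ∧
    (∀ᶠ n in atTop, n ^ a ≤ Q n) ∧
    (Q =O[atTop] fun n => √n) ∧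
    (∀ δ : ℝ, 0 < δ → ∃ n₀ : ℝ, 0 < n₀ ∧ ∀ n n' : ℝ, n₀ ≤ n → n < n' →
      (n' / n) ^ a * Q n ≤ Q n' ∧ Q n' ≤ (n' / n) ^ (1 / 2 + δ) * Q n) ∧
    (∀ n, 1 ≤ n → 0 ≤ (∫ ω, X n ω ∂P) - n) ∧
    ((fun n => (∫ ω, X n ω ∂P) - n) =Θ[atTop] Q)

/-! ### Columns, scales and the resampled noise -/

/-- The column `Λ_k = [(k-1)n, kn] × ℝ`. -/
def column (n : ℝ) (k : ℤ) : Set Plane := {x | ((k : ℝ) - 1) * n ≤ x 0 ∧ x 0 ≤ k * n}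

/-- The scales: `M = 2 ^ 2 ^ m`, so `log₂ log₂ M = m`, and `Φ ^ ℓ`, `r = Φ ^ ℓ n` with
`Φ = 2 ^ (m ^ 5)`. -/
structure Grid where
  Q : ℝ → ℝ
  β : ℝ
  n : ℝ
  m : ℕ
  ℓ : ℕ

namespace Grid

variable (g : Grid)

def M : ℕ := 2 ^ 2 ^ g.m

/-- `Φ ^ ℓ`, the number of columns `Λ_k` in a column at scale `r`. -/
def p : ℕ := (2 ^ g.m ^ 5) ^ g.ℓ

def r : ℝ := g.p * g.n

/-- The transversal fluctuation scale `W_x = √(x Q_x)`. -/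
def W (x : ℝ) : ℝ := √(x * g.Q x)

def Wn : ℝ := g.W g.n

def Wr : ℝ := g.W g.r

def Qr : ℝ := g.Q g.r

/-- The maximal height `n ^ β W_n` at which conforming paths may cross column boundaries. -/
def H : ℝ := g.n ^ g.β * g.Wn

end Grid

/-- The noise `ω^{Λ_i}`: the noise of the plane inside `Λ_i` and an independent copy outside. -/
def columnNoise {Ω : Type*} (n : ℝ) (N : Option ℤ → Set Plane → Ω → ℝ) (i : ℤ)
    (A : Set Plane) (ω : Ω) : ℝ :=
  N none (A ∩ column n i) ω + N (some i) (A \ column n i) ω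

/-- The horizontal strip of height `W` which contains the blocks `Λ_{ij}`, for fixed `j`. -/
def strip (W : ℝ) (j : ℤ) : Set Plane := {x | ((j : ℝ) - 1) * W ≤ x 1 ∧ x 1 < j * W}

section Noise

variable {Ω : Type*} [MeasurableSpace Ω] {P : Measure Ω} (S : Model P) (g : Grid)

/-- The `i`-th noise of `ω_⋆` (`b = false`) or `ω_∘` (`b = true`). -/
def Model.colNoise (b : Bool) (i : ℤ) : Set Plane → Ω → ℝ := columnNoise g.n (S.noise b) i

/-- The `i`-th noise of `ω_κ`: the part of `ω_⋆` in the block `{i} × ℝ × [(j-1)W_n, jW_n]` is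
replaced by that of `ω_∘` when `T_{ij} > 1 - κ`. -/
def Model.resampledNoise (κ : ℝ) (i : ℤ) (A : Set Plane) (ω : Ω) : ℝ := by
  classical
  exact ∑ᶠ j : ℤ,
    if S.T i j ω ≤ 1 - κ then S.colNoise g false i (A ∩ strip g.Wn j) ω
    else S.colNoise g true i (A ∩ strip g.Wn j) ω

/-- The σ-algebra generated by `(ω_⋆, ω_∘)` on the union over the columns
`(i-1)Φ^ℓ < k ≤ iΦ^ℓ` of `{k} × [(k-1)n - 1, kn + 1] × F`. -/
@[reducible] def Model.sigmaOn (i : ℤ) (F : Set ℝ) : MeasurableSpace Ω :=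
  ⨆ (b : Bool) (k : ℤ) (_ : (i - 1) * g.p + 1 ≤ k ∧ k ≤ i * g.p) (A : Set Plane)
    (_ : MeasurableSet A) (_ : volume A ≠ ∞)
    (_ : A ⊆ {x | ((k : ℝ) - 1) * g.n - 1 ≤ x 0 ∧ x 0 ≤ k * g.n + 1 ∧ x 1 ∈ F}),
    MeasurableSpace.comap (S.colNoise g b k A) inferInstance

end Noise

/-! ### Conforming paths and restricted distances -/

/-- An environment: the field `Ψ^{Λ_k}` used in the column `Λ_k`, for every `k`. -/
abbrev Env : Type := ℤ → Plane → ℝ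

/-- `u` and `v` lie on a common column boundary. -/
def VerticalBoundaryPair (n : ℝ) (u v : Plane) : Prop := ∃ k : ℤ, u 0 = k * n ∧ v 0 = k * n

/-- The paths from `u` to `v` use the columns `Λ_a, …, Λ_b`. A starting point on a column boundary
belongs to the column on its right and an end point to the column on its left, unless both points
lie in one column; there are no such `a, b` for a vertical boundary pair. -/
def ColumnRange (n : ℝ) (u v : Plane) (a b : ℤ) : Prop :=
  (a = b ∧ u ∈ column n a ∧ v ∈ column n a ∧ ¬ VerticalBoundaryPair n u v) ∨
  (a < b ∧ ((a : ℝ) - 1) * n ≤ u 0 ∧ u 0 < a * n ∧ ((b : ℝ) - 1) * n < v 0 ∧ v 0 ≤ b * n)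

/-- `γ` is a conforming path through the columns `Λ_a, …, Λ_b`, with `t k` the time at which it
passes from `Λ_k` to `Λ_{k+1}`, at height at most `H` in absolute value. -/
structure IsConforming (n H : ℝ) (a b : ℤ) (γ : ℝ → Plane) (t : ℤ → ℝ) : Prop where
  isPath : IsPath γ
  start : t (a - 1) = 0
  finish : t b = 1
  mono : ∀ k, a ≤ k → k ≤ b → t (k - 1) ≤ t k
  crossing : ∀ k, a ≤ k → k < b → γ (t k) 0 = k * n ∧ |γ (t k) 1| ≤ H
  inside : ∀ k, a ≤ k → k ≤ b → γ '' Icc (t (k - 1)) (t k) ⊆ column n k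

/-- The weight of a conforming path for a given choice of the crossing times. -/
def timedWeight (Ψ : Env) (a b : ℤ) (γ : ℝ → Plane) (t : ℤ → ℝ) : ℝ :=
  ∑ k ∈ Finset.Icc a b, pathLength (Ψ k) γ (t (k - 1)) (t k)

section Distances

variable (g : Grid) (Ψ : Env)

/-- The weight `𝒳_γ` of a conforming path (`⊤` if `γ` is not conforming). -/
def weight (γ : ℝ → Plane) : EReal :=
  ⨅ (a : ℤ) (b : ℤ) (t : ℤ → ℝ) (_ : ColumnRange g.n (γ 0) (γ 1) a b)
    (_ : IsConforming g.n g.H a b γ t), ((timedWeight Ψ a b γ t : ℝ) : EReal)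

/-- The centring `(v₁ - u₁) + (v₂ - u₂)² / (2 (v₁ - u₁))`. -/
def centring (u v : Plane) : ℝ := (v 0 - u 0) + (v 1 - u 1) ^ 2 / (2 * (v 0 - u 0))

/-- The centred weight of a path between two column boundaries. -/
def hatWeight (γ : ℝ → Plane) : EReal := weight g Ψ γ - ((centring (γ 0) (γ 1) : ℝ) : EReal)

/-- The centred restricted distance. -/
def hatDist (u v : Plane) : EReal := ⨅ (γ : ℝ → Plane) (_ : γ 0 = u) (_ : γ 1 = v), hatWeight g Ψ γ

/-- The rectangle `[(i-1)r, ir] × [lo W_r, hi W_r]`. -/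
def rect (i : ℤ) (lo hi : ℝ) : Set Plane :=
  {x | ((i : ℝ) - 1) * g.r ≤ x 0 ∧ x 0 ≤ i * g.r ∧ lo * g.Wr ≤ x 1 ∧ x 1 ≤ hi * g.Wr}

/-- The range of a path. -/
def trace (γ : ℝ → Plane) : Set Plane := γ '' Icc 0 1

/-- `γ` leads from `((i-1)r, y)` to `(ir, y')` with `y, y' ∈ [lo W_r, hi W_r]`. -/
def CrossesColumn (i : ℤ) (lo hi : ℝ) (γ : ℝ → Plane) : Prop :=
  ∃ y ∈ Icc (lo * g.Wr) (hi * g.Wr), ∃ y' ∈ Icc (lo * g.Wr) (hi * g.Wr),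
    γ 0 = pt (((i : ℝ) - 1) * g.r) y ∧ γ 1 = pt (i * g.r) y'

/-- The least centred weight of a crossing, with end heights in `[lo W_r, hi W_r]`, inside the
rectangle of heights `[lo' W_r, hi' W_r]`. -/
def sideToSide (i : ℤ) (lo hi lo' hi' : ℝ) : EReal :=
  ⨅ (γ : ℝ → Plane) (_ : CrossesColumn g i lo hi γ) (_ : trace γ ⊆ rect g i lo' hi'),
    hatWeight g Ψ γ

/-! ### Elementary events -/

/-- `𝒦_{i,j,z}` -/
def evK (i : ℤ) (j z : ℝ) : Prop :=
  (∀ (x y : ℝ) (γ : ℝ → Plane), ((i : ℝ) - 1) * g.r ≤ x → x ≤ i * g.r → |y| ≤ g.H →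
    γ 0 = pt (((i : ℝ) - 1) * g.r) y → γ 1 = pt x (j * g.Wr) →
    ((-z * g.Qr : ℝ) : EReal) ≤ weight g Ψ γ -
      (((x - ((i : ℝ) - 1) * g.r) +
        1 / 2 * (|y - j * g.Wr| / g.Wr - 1) ^ 2 * g.Qr : ℝ) : EReal)) ∧
  (∀ (x y : ℝ) (γ : ℝ → Plane), ((i : ℝ) - 1) * g.r ≤ x → x ≤ i * g.r → |y| ≤ g.H →
    γ 0 = pt x (j * g.Wr) → γ 1 = pt (i * g.r) y →
    ((-z * g.Qr : ℝ) : EReal) ≤ weight g Ψ γ -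
      (((i * g.r - x) + 1 / 2 * (|y - j * g.Wr| / g.Wr - 1) ^ 2 * g.Qr : ℝ) : EReal))

/-- `𝒦^*_{i,j,z,w}` -/
def evKstar (i : ℤ) (j z w : ℝ) : Prop :=
  evK g Ψ i (j - w) z ∧ evK g Ψ i j z ∧ evK g Ψ i (j + w) z

/-- `ℐ^+_{i,lo,hi,z}` -/
def evIplus (i : ℤ) (lo hi z : ℝ) : Prop :=
  ((z * g.Qr : ℝ) : EReal) ≤ sideToSide g Ψ i lo hi lo hi

/-- `ℐ^-_{i,lo,hi,z}` -/
def evIminus (i : ℤ) (lo hi z : ℝ) : Prop :=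
  sideToSide g Ψ i lo hi lo hi ≤ ((z * g.Qr : ℝ) : EReal)

/-- `𝒥_{i,lo,hi,z,w}` (vertical boundary pairs do not count, their paths having weight `⊤`) -/
def evJ (i : ℤ) (lo hi z w : ℝ) : Prop :=
  ∀ γ : ℝ → Plane, trace γ ⊆ rect g i lo hi → w * g.Wr ≤ |γ 0 1 - γ 1 1| →
    ((z * g.Qr : ℝ) : EReal) ≤ weight g Ψ γ - ((|γ 0 0 - γ 1 0| : ℝ) : EReal)

/-- `𝒜^-_{i,j,z}` -/
def evAminus (i : ℤ) (j z : ℝ) : Prop :=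
  ∀ y y' : ℝ, |y| ≤ g.M * g.Wn → |y'| ≤ g.M * g.Wn →
    hatDist g Ψ (pt (((i : ℝ) - 1) * g.r) y) (pt (i * g.r) y') ≤
      (((|y - j * g.Wr| + |y' - j * g.Wr|) / g.Wr * g.Qr + z * g.Qr : ℝ) : EReal)

/-- `𝒜^+_{i,j,z}` -/
def evAplus (i : ℤ) (j z : ℝ) : Prop :=
  ∀ y y' : ℝ, |y| ≤ g.H → |y'| ≤ g.H →
    ((-z * g.Qr - (|y - j * g.Wr| + |y' - j * g.Wr|) / g.Wr * g.Qr : ℝ) : EReal) ≤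
      hatDist g Ψ (pt (((i : ℝ) - 1) * g.r) y) (pt (i * g.r) y')

/-- `ℳ_{i,lo,hi,z,w}` -/
def evM (i : ℤ) (lo hi z w : ℝ) : Prop :=
  sideToSide g Ψ i lo hi lo hi ≤
    sideToSide g Ψ i lo hi (lo - w) (hi + w) + ((z * g.Qr : ℝ) : EReal)

/-- The first part of `ℬ^{(2)}`, for one environment. -/
def evExit (i : ℤ) (j L₀ : ℝ) : Prop :=
  ∀ γ : ℝ → Plane, CrossesColumn g i (j - L₀ / 4) (j + L₀ / 4) γ →
    trace γ ⊆ rect g i (j - 3 / 2 * L₀) (j + 3 / 2 * L₀) →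
    ¬ trace γ ⊆ rect g i (j - L₀ / 2) (j + L₀ / 2) →
    ((g.r + 1 / 40 * L₀ ^ 2 * g.Qr : ℝ) : EReal) ≤ weight g Ψ γ

end Distances

/-- The parameters of the construction. -/
structure Consts where
  L₀ : ℝ
  L₁ : ℕ
  w : ℝ
  α : ℝ
  h : ℝ
  δA : ℝ
  θ₂ : ℝ

/-- `L₂ = L₁ ^ 100` -/
def Consts.L₂ (c : Consts) : ℕ := c.L₁ ^ 100

/-- An event holds both before and after resampling. -/
def Both (E : Env → Prop) (Ψ Ψ' : Env) : Prop := E Ψ ∧ E Ψ'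

section Events

variable (g : Grid) (c : Consts) (Ψ Ψ' : Env) (i : ℤ) (j : ℝ)

/-! ### The central column -/

def evB1 : Prop :=
  Both (fun E => evIminus g E i (j - c.L₀ / 40) (j + c.L₀ / 40) c.L₀) Ψ Ψ'

def evB2 : Prop :=
  Both (fun E => evExit g E i j c.L₀ ∧
    evIplus g E i (j - 3 / 2 * c.L₀) (j + 3 / 2 * c.L₀) (-c.L₀)) Ψ Ψ'

def evB3 : Prop :=
  Both (fun E => evIplus g E i (j - c.L₁ - 1) (j - c.L₁ + 1) (-c.L₀) ∧
    evIplus g E i (j + c.L₁ - 1) (j + c.L₁ + 1) (-c.L₀)) Ψ Ψ'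

def evB4 : Prop :=
  evIplus g Ψ i (j - √c.α) (j - √c.α + c.h) (-(c.α - c.α ^ (9 / 10 : ℝ))) ∧
  evIminus g Ψ' i (j - √c.α) (j - √c.α + c.h) (-(c.α + c.α ^ (9 / 10 : ℝ)))

def evB5 : Prop :=
  Both (fun E => evM g E i (j - √c.α) (j - √c.α + c.h) 1 c.w) Ψ Ψ'

def evB6 : Prop :=
  Both (fun E => ∀ s ∈ ({-(c.L₁ : ℝ), -(c.L₁ : ℝ) + c.w, -√c.α - 2 * c.w / 3,
      -√c.α + c.h + 2 * c.w / 3, -(3 / 2 * c.L₀), 3 / 2 * c.L₀, (c.L₁ : ℝ) - c.w,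
      (c.L₁ : ℝ)} : Set ℝ), evKstar g E i (j + s) c.L₁ c.w) Ψ Ψ'

/-- A rectangle of heights `[lo W_r, hi W_r]` is a barrier of strength `z`. -/
def evBarrier (E : Env) (lo hi z : ℝ) : Prop :=
  evIplus g E i lo hi z ∧ evJ g E i lo hi z (c.w / 3)

def evB7 : Prop :=
  Both (fun E =>
    evBarrier g c i E (j - c.L₁ + 2 / g.Wr) (j - √c.α - 2 / g.Wr) ((c.L₂ : ℝ) ^ 2) ∧
    evBarrier g c i E (j - √c.α + c.h + 2 / g.Wr) (j - c.L₀ - 2 / g.Wr) ((c.L₂ : ℝ) ^ 2) ∧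
    evBarrier g c i E (j + c.L₀ + 2 / g.Wr) (j + c.L₁ - 2 / g.Wr) ((c.L₂ : ℝ) ^ 2)) Ψ Ψ'

def evB : Prop :=
  evB1 g c Ψ Ψ' i j ∧ evB2 g c Ψ Ψ' i j ∧ evB3 g c Ψ Ψ' i j ∧ evB4 g c Ψ Ψ' i j ∧
  evB5 g c Ψ Ψ' i j ∧ evB6 g c Ψ Ψ' i j ∧ evB7 g c Ψ Ψ' i j

/-! ### Intermediate and outer columns -/

def evC : Prop := Both (fun E => evAminus g E i j c.L₀ ∧ evAplus g E i j c.L₀) Ψ Ψ'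

def evD1 : Prop :=
  Both (fun E => evIminus g E i (j - c.L₀ / 40) (j + c.L₀ / 40) c.L₀) Ψ Ψ'

def evD2 : Prop :=
  Both (fun E => evIplus g E i (j - 4 * c.L₀) (j + 4 * c.L₀) (-c.L₀)) Ψ Ψ'

def evD3 : Prop := Both (fun E => evAplus g E i j c.L₀) Ψ Ψ'

def evD4 : Prop :=
  Both (fun E => ∀ s ∈ ({-(c.L₂ : ℝ) + c.w, -(c.L₀ / 20), -(c.L₀ / 20) + 1, c.L₀ / 20 - 1,
      c.L₀ / 20, (c.L₂ : ℝ) - c.w} : Set ℝ), evK g E i (j + s) c.L₁) Ψ Ψ'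

def evD5 : Prop :=
  Both (fun E =>
    evBarrier g c i E (j - c.L₂ + 2 / g.Wr) (j - c.L₀ / 40 - 2 / g.Wr) ((c.L₂ : ℝ) ^ 3) ∧
    evBarrier g c i E (j + c.L₀ / 40 + 2 / g.Wr) (j + c.L₂ - 2 / g.Wr) ((c.L₂ : ℝ) ^ 3)) Ψ Ψ'

def evD : Prop :=
  evD1 g c Ψ Ψ' i j ∧ evD2 g c Ψ Ψ' i j ∧ evD3 g c Ψ Ψ' i j ∧ evD4 g c Ψ Ψ' i j ∧
  evD5 g c Ψ Ψ' i j

/-! ### Wings -/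

/-- The conditions in `𝒲^*_i` on the passage times between the lines `x = i'r` and `x = i''r`. -/
def evLines (E : Env) (i' i'' : ℤ) : Prop :=
  (∀ y y' : ℝ, |y| ≤ g.M * g.Wn → |y'| ≤ g.M * g.Wn →
    ((-(Real.log g.M ^ (100 / c.θ₂) * g.Q (((i'' : ℝ) - i') * g.r)) : ℝ) : EReal) ≤
      hatDist g E (pt (i' * g.r) y) (pt (i'' * g.r) y') ∧
    hatDist g E (pt (i' * g.r) y) (pt (i'' * g.r) y') ≤
      ((Real.log g.M ^ (100 / c.θ₂) * g.Q (((i'' : ℝ) - i') * g.r) : ℝ) : EReal)) ∧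
  (∀ y y' : ℝ, |y| ≤ g.H → |y'| ≤ g.H →
    ((-(max 1 ((|y| + |y'|) / ((g.M : ℝ) ^ 2 * g.Wn)) *
        Real.log g.M ^ (100 / c.θ₂) * g.Q (((i'' : ℝ) - i') * g.r)) : ℝ) : EReal) ≤
      hatDist g E (pt (i' * g.r) y) (pt (i'' * g.r) y'))

/-- `𝒲^*_i` -/
def evWstar : Prop :=
  Both (fun E =>
    (∀ i' i'' : ℤ, 0 ≤ i' → i' < i'' → i'' ≤ i - 3 → evLines g c E i' i'') ∧
    (∀ i' i'' : ℤ, i + 2 ≤ i' → i' < i'' → i'' * g.p ≤ g.M → evLines g c E i' i'')) Ψ Ψ'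

/-- `𝒵_{i,j,k}` -/
def evZ (k : ℕ) : Prop :=
  Both (fun E => ∀ y y' : ℝ, |y| ≤ g.M * g.Wn → |y'| ≤ g.M * g.Wn →
    let b : ℝ := (|y / g.Wr - j| ^ (1 / 100 : ℝ) + |y' / g.Wr - j| ^ (1 / 100 : ℝ)) *
      (g.Qr / (2 ^ k * (c.L₂ : ℝ) ^ 2)) + (2 ^ k * (c.L₂ : ℝ)) ^ (3 / 5 : ℝ) * g.Qr
    ((-b : ℝ) : EReal) ≤
      hatDist g E (pt (i * g.r) y) (pt (((i : ℝ) + 2 ^ k * c.L₂) * g.r) y') ∧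
    hatDist g E (pt (i * g.r) y) (pt (((i : ℝ) + 2 ^ k * c.L₂) * g.r) y') ≤ (b : EReal)) Ψ Ψ'

/-- The four `𝒵` events at distance `2 ^ k L₂` around the columns `i - 2, …, i + 2`. -/
def evZs (k : ℕ) : Prop :=
  evZ g c Ψ Ψ' (i - 2 ^ (k + 1) * c.L₂ - 3) j k ∧ evZ g c Ψ Ψ' (i - 2 ^ k * c.L₂ - 3) j k ∧
  evZ g c Ψ Ψ' (i + 2) j k ∧ evZ g c Ψ Ψ' (i + 2 ^ k * c.L₂ + 2) j k

def evWloc : Prop := ∀ k : ℕ, 1 ≤ k → k ≤ g.m ^ 2 → evZs g c Ψ Ψ' i j k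

def evWglo : Prop :=
  evWstar g c Ψ Ψ' i ∧
  ∀ k : ℕ, g.m ^ 2 ≤ k → (2 : ℝ) ^ k * c.L₂ * g.p ≤ (g.M : ℝ) ^ (99 / 100 : ℝ) / 2 →
    evZs g c Ψ Ψ' i j k

/-! ### The event `𝒫_{i,j}` -/

/-- `V̂_j` -/
def Vhat : Set ℝ :=
  Ioo ((j - c.L₁) * g.Wr) ((j - c.L₀) * g.Wr) ∪ Ioo ((j + c.L₀) * g.Wr) ((j + c.L₁) * g.Wr)

/-- `V̂'_j` -/
def Vhat' : Set ℝ :=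
  Ioo ((j - c.L₂) * g.Wr + 2) ((j - c.L₀ / 40) * g.Wr - 2) ∪
  Ioo ((j + c.L₀ / 40) * g.Wr + 2) ((j + c.L₂) * g.Wr - 2)

end Events

section EventP

variable {Ω : Type*} [MeasurableSpace Ω] {P : Measure Ω} (S : Model P) (g : Grid) (c : Consts)
  (Ψ Ψ' : Ω → Env) (i : ℤ) (j : ℝ)

/-- `𝒫^-_{i,j}` -/
def eventPminus : Set Ω :=
  {ω | evB1 g c (Ψ ω) (Ψ' ω) i j ∧
    1 / 2 ≤ (P⟦{ω' | evB2 g c (Ψ ω') (Ψ' ω') i j ∧ evB3 g c (Ψ ω') (Ψ' ω') i j} |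
      S.sigmaOn g i (Vhat g c j)ᶜ⟧) ω ∧
    1 - c.δA / 100 ≤ (P⟦{ω' | evB6 g c (Ψ ω') (Ψ' ω') i j} |
      S.sigmaOn g i (Vhat g c j)ᶜ⟧) ω ∧
    (∀ i' ∈ ({i - 2, i + 2} : Set ℤ), evD1 g c (Ψ ω) (Ψ' ω) i' j ∧
      1 / 2 ≤ (P⟦{ω' | evD2 g c (Ψ ω') (Ψ' ω') i' j ∧ evD3 g c (Ψ ω') (Ψ' ω') i' j ∧
        evD4 g c (Ψ ω') (Ψ' ω') i' j} | S.sigmaOn g i' (Vhat' g c j)ᶜ⟧) ω) ∧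
    evC g c (Ψ ω) (Ψ' ω) (i - 1) j ∧ evC g c (Ψ ω) (Ψ' ω) (i + 1) j ∧
    evWloc g c (Ψ ω) (Ψ' ω) i j}

/-- `𝒫_{i,j}` -/
def eventP : Set Ω :=
  eventPminus S g c Ψ Ψ' i j ∩
  {ω | evD g c (Ψ ω) (Ψ' ω) (i - 2) j ∧ evD g c (Ψ ω) (Ψ' ω) (i + 2) j ∧
    evB g c (Ψ ω) (Ψ' ω) i j ∧ evWglo g c (Ψ ω) (Ψ' ω) i j}

end EventP

/-! ### Geodesics, their types and the blocks they visit -/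

section Geodesics

variable (g : Grid) (c : Consts)

/-- `γ` is a weight minimising conforming path from `0` to `(Mn, 0)`, and `t` is a choice of
crossing times which attains its weight. -/
def IsGeodesic (Ψ : Env) (γ : ℝ → Plane) (t : ℤ → ℝ) : Prop :=
  γ 0 = pt 0 0 ∧ γ 1 = pt (g.M * g.n) 0 ∧ IsConforming g.n g.H 1 g.M γ t ∧
  ∀ (γ₁ : ℝ → Plane) (t₁ : ℤ → ℝ), γ₁ 0 = pt 0 0 → γ₁ 1 = pt (g.M * g.n) 0 →
    IsConforming g.n g.H 1 g.M γ₁ t₁ → timedWeight Ψ 1 g.M γ t ≤ timedWeight Ψ 1 g.M γ₁ t₁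

/-- The part of a path in the `i`-th column at scale `r`. -/
def segment (i : ℤ) (γ : ℝ → Plane) (t : ℤ → ℝ) : Set Plane :=
  γ '' Icc (t ((i - 1) * g.p)) (t (i * g.p))

/-- `J_i = ⌊y_{iΦ^ℓ} / W_r⌋`, with `y_k` the height at which the path crosses `x = kn`. -/
def exitIndex (i : ℤ) (γ : ℝ → Plane) (t : ℤ → ℝ) : ℤ := ⌊γ (t (i * g.p)) 1 / g.Wr⌋

/-- The six types of paths, according to their part `Z` in the central column. -/
def IsType1 (i : ℤ) (j : ℝ) (Z : Set Plane) : Prop :=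
  Z ⊆ rect g i (j - c.L₀ / 2) (j + c.L₀ / 2)

def IsType2 (i : ℤ) (j : ℝ) (Z : Set Plane) : Prop :=
  ¬ IsType1 g c i j Z ∧ Z ⊆ rect g i (j - 3 / 2 * c.L₀) (j + 3 / 2 * c.L₀)

def IsType3 (i : ℤ) (j : ℝ) (Z : Set Plane) : Prop :=
  Z ⊆ rect g i (j - √c.α - 5 / 3 * c.w) (j - √c.α + c.h + 5 / 3 * c.w)

def IsType4 (i : ℤ) (j : ℝ) (Z : Set Plane) : Prop :=
  ¬ IsType1 g c i j Z ∧ ¬ IsType2 g c i j Z ∧ ¬ IsType3 g c i j Z ∧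
  (Z ∩ rect g i (j - c.L₁ + c.w) (j + c.L₁ - c.w)).Nonempty

def IsType5 (i : ℤ) (j : ℝ) (Z : Set Plane) : Prop :=
  ¬ IsType1 g c i j Z ∧ ¬ IsType2 g c i j Z ∧ ¬ IsType3 g c i j Z ∧ ¬ IsType4 g c i j Z ∧
  (Z ∩ rect g i (j - c.L₁ - 2 / g.Wr) (j + c.L₁ + 2 / g.Wr)).Nonempty

def IsType6 (i : ℤ) (j : ℝ) (Z : Set Plane) : Prop :=
  ¬ IsType1 g c i j Z ∧ ¬ IsType2 g c i j Z ∧ ¬ IsType3 g c i j Z ∧ ¬ IsType4 g c i j Z ∧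
  ¬ IsType5 g c i j Z

/-- The block `Λ_{ij} = [(i-1)n, in] × [(j-1)W_n, jW_n]`. -/
def block (i j : ℤ) : Set Plane :=
  {x | ((i : ℝ) - 1) * g.n ≤ x 0 ∧ x 0 ≤ i * g.n ∧
       ((j : ℝ) - 1) * g.Wn ≤ x 1 ∧ x 1 ≤ j * g.Wn}

/-- `𝒰_{ij}`: the part of the path in the column `Λ_i` comes within distance `1` of `Λ_{ij}`. -/
def Visits (i j : ℤ) (γ : ℝ → Plane) (t : ℤ → ℝ) : Prop :=
  ∃ x ∈ γ '' Icc (t (i - 1)) (t i), ∃ y ∈ block g i j, dist x y ≤ 1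

end Geodesics

end FPP

end

noncomputable section

namespace FPP

/-! ### Path lengths -/

/-! Heights are measured in units of `W_r` relative to `j`, and weights in units of `Q_r` after
subtracting the horizontal distance. Since `W_r ^ 2 = r Q_r`, a passage over `D` columns with
vertical displacement `x` then costs `x ^ 2 / (2 * D)`, up to errors which the events control. On
the event everything is deterministic: lower bounds for what the geodesic pays are compared with the
cost of competitors, because between two column boundaries the geodesic is at least as cheap as any
conforming path with the same ends (`IsGeodesic.geoCost_le`).

Call a geodesic relevant if it is neither of Type 3 nor of Type 6. The core is that a relevant
geodesic crosses `x = (i-2)r` and `x = (i+1)r` at relative heights at most `L₀/20`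
(`Scales.abs_eta_le_of_relevant`). This descends through the scales. Globally, `𝒲*` keeps the path
at heights of order at most `M ^ (4/5)` on the wings, so its slope over the largest wing is tiny
(`Scales.abs_eta_le`, `Scales.wingPath`). In the wings, a difference `δ` between the slopes over
distances `D` and `2D` costs `D δ ^ 2` by convexity of the parabola, and only errors of order `D ^
(3/5)` can pay for it. Hence `δ` is of order `D ^ (-1/5)`; this sums geometrically, and the slope
over the shortest wing is small too (`slope_bound`). Locally, redirecting a short wing from its end
height `a` to the opening in the middle therefore costs at most `a ^ 2 / 100 + O(L₁ ^ 60)`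
(`detour_cost`), while a relevant geodesic at heights `a`, `b` pays at least `(a ^ 2 + b ^ 2) / 24 -
O(L₁ ^ 2)` in the five central columns (`ColumnsOK.five_lower`). So `a = O(L₁ ^ 30)`, far below `L₂
= L₁ ^ 100`, and the barriers of strength `L₂ ^ 3` in the outer columns squeeze the path to within
`L₀/20` (`OuterOK.abs_relHeight_le`).

In the three inner columns such a path is of Type 1 and its excess is at least `-4 L₀`
(`ColumnsOK.inner_type`): leaving the middle, crossing a barrier or staying near `±L₁` all cost more
than the route through the central opening. After resampling, the slot at `-√α` has value about `-(α
+ α ^ (9/10))`, while the two diagonal steps to and from it cost about `α/2` each, so the detour has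
excess below `-4 L₀` (`ColumnsOK.excess_lt_of_cheap`). Thus `γ'` cannot be relevant. In contrast `γ`
is relevant, because `J` is the integer part of its exit height, and so it is of Type 1. The region
of Type 1 is more than `2 W_r` away from those of Types 3 and 6, which rules out common blocks. -/

/-- The fields of the environment are continuous, positive and bounded by `d`. -/
structure Env.Regular (E : Env) (d : ℝ) : Prop where
  continuous : ∀ k, Continuous (E k)
  pos : ∀ k x, 0 < E k x
  lt : ∀ k x, E k x < d

@[simp] lemma pt_zero (x y : ℝ) : pt x y 0 = x := rfl

@[simp] lemma pt_one (x y : ℝ) : pt x y 1 = y := rfl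

lemma plane_ext {u v : Plane} (h0 : u 0 = v 0) (h1 : u 1 = v 1) : u = v := by
  ext k
  fin_cases k
  · exact h0
  · exact h1

lemma eq_pt (u : Plane) : u = pt (u 0) (u 1) := plane_ext rfl rfl

lemma continuous_coord (k : Fin 2) : Continuous fun x : Plane => x k := by fun_prop

/-- On an open interval agreement is local, so it passes to derivatives, and the end points are
negligible. Thus the derivative of a glued path at the junction never matters. -/
lemma pathLength_congr {Ψ : Plane → ℝ} {γ γ₁ : ℝ → Plane} {s t : ℝ} (hst : s ≤ t)
    (h : EqOn γ γ₁ (Ioo s t)) : pathLength Ψ γ s t = pathLength Ψ γ₁ s t := by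
  refine intervalIntegral.integral_congr_Ioo_of_le hst fun τ hτ => ?_
  have h1 : γ =ᶠ[𝓝 τ] γ₁ := by
    filter_upwards [Ioo_mem_nhds hτ.1 hτ.2] with x hx using h hx
  simp only [h hτ, h1.deriv_eq]

/-- Multiplying by `e - s`, rather than dividing by it, makes the change of variables valid for `e =
s` as well. -/
lemma pathLength_comp_affine (Ψ : Plane → ℝ) (γ : ℝ → Plane) (s e x y : ℝ) (hse : s ≤ e) :
    pathLength Ψ (fun τ => γ (s + (e - s) * τ)) x y =
      pathLength Ψ γ (s + (e - s) * x) (s + (e - s) * y) := by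
  unfold pathLength
  rw [← intervalIntegral.smul_integral_comp_add_mul (fun τ => Ψ (γ τ) * ‖deriv γ τ‖) (e - s) s,
    smul_eq_mul, ← intervalIntegral.integral_const_mul]
  congr 1
  funext τ
  have h : deriv (fun τ => γ (s + (e - s) * τ)) τ = (e - s) • deriv γ (s + (e - s) * τ) := by
    have h1 := deriv_comp_mul_left (e - s) (fun z => γ (s + z)) τ
    simp only [deriv_comp_const_add] at h1
    exact h1
  rw [h, norm_smul, Real.norm_of_nonneg (sub_nonneg.2 hse)]
  ring

lemma intervalIntegrable_length {Ψ : Plane → ℝ} (hΨ : Continuous Ψ) {γ : ℝ → Plane} {C : ℝ≥0}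
    {s t : ℝ} (hst : s ≤ t) (hγ : LipschitzOnWith C γ (Icc s t)) :
    IntervalIntegrable (fun τ => Ψ (γ τ) * ‖deriv γ τ‖) volume s t := by
  rw [intervalIntegrable_iff_integrableOn_Ioo_of_le hst]
  have hc : ContinuousOn (fun τ => Ψ (γ τ)) (Icc s t) := hΨ.comp_continuousOn hγ.continuousOn
  obtain ⟨B, hB⟩ := isCompact_Icc.exists_bound_of_continuousOn hc
  have hm : AEStronglyMeasurable (fun τ => Ψ (γ τ) * ‖deriv γ τ‖)
      (volume.restrict (Ioo s t)) := by
    refine AEStronglyMeasurable.mul ?_ ?_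
    · exact (hc.mono Ioo_subset_Icc_self).aestronglyMeasurable measurableSet_Ioo
    · exact (measurable_deriv γ).norm.aestronglyMeasurable
  refine Integrable.of_bound hm (B * C) ?_
  refine (ae_restrict_iff' measurableSet_Ioo).2 (Eventually.of_forall fun τ hτ => ?_)
  have h1 := hB τ (Ioo_subset_Icc_self hτ)
  have h2 := norm_deriv_le_of_lipschitzOn (Icc_mem_nhds hτ.1 hτ.2) hγ
  rw [norm_mul, norm_norm]
  exact mul_le_mul h1 h2 (norm_nonneg _) ((norm_nonneg _).trans h1)

lemma pathLength_add {Ψ : Plane → ℝ} (hΨ : Continuous Ψ) {γ : ℝ → Plane} {C : ℝ≥0}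
    {s t u : ℝ} (hst : s ≤ t) (htu : t ≤ u) (hγ : LipschitzOnWith C γ (Icc s u)) :
    pathLength Ψ γ s t + pathLength Ψ γ t u = pathLength Ψ γ s u :=
  intervalIntegral.integral_add_adjacent_intervals
    (intervalIntegrable_length hΨ hst (hγ.mono (Icc_subset_Icc_right htu)))
    (intervalIntegrable_length hΨ htu (hγ.mono (Icc_subset_Icc_left hst)))

/-- Follow `f` up to the time `c` and `f₁` afterwards. -/
def glue (c : ℝ) (f f₁ : ℝ → Plane) (τ : ℝ) : Plane := if τ ≤ c then f τ else f₁ τ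

lemma glue_of_le {c τ : ℝ} (f f₁ : ℝ → Plane) (h : τ ≤ c) : glue c f f₁ τ = f τ := if_pos h

lemma glue_of_ge {c τ : ℝ} {f f₁ : ℝ → Plane} (hc : f c = f₁ c) (h : c ≤ τ) :
    glue c f f₁ τ = f₁ τ := by
  rcases h.eq_or_lt with rfl | h
  · rw [glue_of_le _ _ le_rfl, hc]
  · exact if_neg (not_le.2 h)

/-- For `x ≤ c ≤ y` the distances of the parameters to `c` add up to that of `x` and `y`, so the
triangle inequality through the junction costs no more than the larger constant. -/
lemma lipschitzOnWith_glue {a b c : ℝ} {f f₁ : ℝ → Plane} {C C₁ : ℝ≥0}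
    (hf : LipschitzOnWith C f (Icc a c)) (hf₁ : LipschitzOnWith C₁ f₁ (Icc c b))
    (hc : f c = f₁ c) (hac : a ≤ c) (hcb : c ≤ b) :
    LipschitzOnWith (max C C₁) (glue c f f₁) (Icc a b) := by
  have hf' := hf.weaken (le_max_left C C₁)
  have hf₁' := hf₁.weaken (le_max_right C C₁)
  have key : ∀ x ∈ Icc a b, ∀ y ∈ Icc a b, x ≤ y →
      dist (glue c f f₁ x) (glue c f f₁ y) ≤ (max C C₁ : ℝ≥0) * dist x y := by
    intro x hx y hy hxy
    rcases le_total y c with hyc | hyc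
    · rw [glue_of_le _ _ hyc, glue_of_le _ _ (hxy.trans hyc)]
      exact hf'.dist_le_mul x ⟨hx.1, hxy.trans hyc⟩ y ⟨hy.1, hyc⟩
    rcases le_total x c with hxc | hxc
    · rw [glue_of_le _ _ hxc, glue_of_ge hc hyc]
      have h1 := hf'.dist_le_mul x ⟨hx.1, hxc⟩ c ⟨hac, le_rfl⟩
      have h2 := hf₁'.dist_le_mul c ⟨le_rfl, hcb⟩ y ⟨hyc, hy.2⟩
      rw [Real.dist_eq, abs_sub_comm, abs_of_nonneg (sub_nonneg.2 ‹_›)] at h1 h2 ⊢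
      have h3 := dist_triangle (f x) (f c) (f₁ y)
      rw [hc] at h3 h1
      nlinarith
    · rw [glue_of_ge hc hxc, glue_of_ge hc hyc]
      exact hf₁'.dist_le_mul x ⟨hxc, hx.2⟩ y ⟨hyc, hy.2⟩
  refine LipschitzOnWith.of_dist_le_mul fun x hx y hy => ?_
  rcases le_total x y with h | h
  · exact key x hx y hy h
  · rw [dist_comm, dist_comm x y]
    exact key y hy x hx h

/-- The horizontal path of unit speed which is at `v` at time `c`. -/
def hline (c : ℝ) (v : Plane) (τ : ℝ) : Plane := v + (τ - c) • pt 1 0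

@[simp] lemma hline_self (c : ℝ) (v : Plane) : hline c v c = v := by simp [hline]

@[simp] lemma hline_zero (c τ : ℝ) (v : Plane) : hline c v τ 0 = v 0 + (τ - c) := by
  simp [hline]

@[simp] lemma hline_one (c τ : ℝ) (v : Plane) : hline c v τ 1 = v 1 := by
  simp [hline]

lemma norm_pt_one_zero : ‖pt 1 0‖ = 1 := by
  simp [EuclideanSpace.norm_eq]

lemma lipschitzWith_hline (c : ℝ) (v : Plane) : LipschitzWith 1 (hline c v) := by
  refine LipschitzWith.of_dist_le_mul fun x y => ?_
  simp only [hline, dist_eq_norm, NNReal.coe_one, one_mul]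
  rw [add_sub_add_left_eq_sub, ← sub_smul, norm_smul, norm_pt_one_zero]
  simp

lemma pathLength_hline_le {Ψ : Plane → ℝ} (hΨ : Continuous Ψ) {d : ℝ} (hd : ∀ x, Ψ x < d)
    (c : ℝ) (v : Plane) {s t : ℝ} (hst : s ≤ t) :
    pathLength Ψ (hline c v) s t ≤ d * (t - s) := by
  have hder : ∀ τ, ‖deriv (hline c v) τ‖ = 1 := fun τ => by
    have : HasDerivAt (hline c v) ((1 : ℝ) • pt 1 0) τ :=
      (((hasDerivAt_id τ).sub_const c).smul_const (pt 1 0)).const_add v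
    rw [this.deriv, one_smul, norm_pt_one_zero]
  have h := intervalIntegral.integral_mono_on hst
    (intervalIntegrable_length hΨ hst ((lipschitzWith_hline c v).lipschitzOnWith (s := Icc s t)))
    (intervalIntegrable_const (c := d)) (fun τ _ => by
      rw [hder, mul_one]
      exact (hd _).le)
  simpa [pathLength, mul_comm] using h

/-! ### Conforming paths on arbitrary time intervals -/

/-- A conforming path through `Λ_a, …, Λ_b` parametrised by `[t (a - 1), t b]`. -/
structure ConfOn (n H : ℝ) (a b : ℤ) (γ : ℝ → Plane) (t : ℤ → ℝ) : Prop where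
  lip : ∃ C : ℝ≥0, LipschitzOnWith C γ (Icc (t (a - 1)) (t b))
  mono : ∀ k, a ≤ k → k ≤ b → t (k - 1) ≤ t k
  crossing : ∀ k, a ≤ k → k < b → γ (t k) 0 = k * n ∧ |γ (t k) 1| ≤ H
  inside : ∀ k, a ≤ k → k ≤ b → γ '' Icc (t (k - 1)) (t k) ⊆ column n k

lemma IsConforming.confOn {n H : ℝ} {a b : ℤ} {γ : ℝ → Plane} {t : ℤ → ℝ}
    (h : IsConforming n H a b γ t) : ConfOn n H a b γ t :=
  ⟨by rw [h.start, h.finish]; exact h.isPath, h.mono, h.crossing, h.inside⟩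

section ConfOn

variable {n H : ℝ} {a b : ℤ} {γ : ℝ → Plane} {t : ℤ → ℝ}

lemma times_mono (h : ∀ k, a ≤ k → k ≤ b → t (k - 1) ≤ t k) {k l : ℤ} (hk : a - 1 ≤ k)
    (hkl : k ≤ l) (hl : l ≤ b) : t k ≤ t l := by
  induction l, hkl using Int.leInduction with
  | base => exact le_rfl
  | succ l hkl ih =>
    have := h (l + 1) (by lia) hl
    rw [add_sub_cancel_right] at this
    exact (ih (by lia)).trans this

lemma exists_time_mem {s : ℝ} {A B : ℤ} (hAB : A < B) (h1 : t A ≤ s) (h2 : s ≤ t B) :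
    ∃ k, A < k ∧ k ≤ B ∧ t (k - 1) ≤ s ∧ s ≤ t k := by
  obtain ⟨B', rfl⟩ : ∃ B', B = B' + 1 := ⟨B - 1, by ring⟩
  replace hAB : A ≤ B' := by lia
  induction B', hAB using Int.leInduction with
  | base => exact ⟨A + 1, by lia, le_rfl, by simpa using h1, h2⟩
  | succ B' hAB ih =>
    rcases le_total s (t (B' + 1)) with h | h
    · obtain ⟨k, hk⟩ := ih h
      exact ⟨k, hk.1, by lia, hk.2.2⟩
    · exact ⟨B' + 1 + 1, by lia, le_rfl, by simpa using h, h2⟩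

lemma ConfOn.le (h : ConfOn n H a b γ t) (hab : a ≤ b) : t (a - 1) ≤ t b :=
  times_mono h.mono le_rfl (by lia) le_rfl

/-- Every conforming path can be parametrised by `[0,1]`. -/
lemma ConfOn.reparam (h : ConfOn n H a b γ t) (hab : a ≤ b) :
    ∃ γ₁ t₁, IsConforming n H a b γ₁ t₁ ∧ γ₁ 0 = γ (t (a - 1)) ∧ γ₁ 1 = γ (t b) ∧
      trace γ₁ = γ '' Icc (t (a - 1)) (t b) ∧
      ∀ E : Env, timedWeight E a b γ₁ t₁ = timedWeight E a b γ t := by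
  set s := t (a - 1) with hs
  set e := t b with he
  have hse : s ≤ e := h.le hab
  have hbd : ∀ k, a - 1 ≤ k → k ≤ b → s ≤ t k ∧ t k ≤ e := fun k h1 h2 =>
    ⟨times_mono h.mono le_rfl h1 h2, times_mono h.mono h1 h2 le_rfl⟩
  obtain ⟨t₁, ht0, ht1, htm, htφ⟩ : ∃ t₁ : ℤ → ℝ, t₁ (a - 1) = 0 ∧ t₁ b = 1 ∧
      (∀ k, a ≤ k → k ≤ b → t₁ (k - 1) ≤ t₁ k) ∧
      (∀ k, a - 1 ≤ k → k ≤ b → s + (e - s) * t₁ k = t k) := by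
    rcases hse.eq_or_lt with hse' | hse'
    -- A path of zero duration: all old times coincide, so any monotone sequence from `0` to `1`
    -- will do.
    · refine ⟨fun k => if k < b then 0 else 1, if_pos (by lia), if_neg (by lia), ?_, ?_⟩
      · intro k _ _
        dsimp only
        split_ifs <;> first | lia | norm_num
      · intro k h1 h2
        have := hbd k h1 h2
        rw [← hse'] at this ⊢
        linarith [this.1, this.2]
    · have hpos : 0 < e - s := sub_pos.2 hse'
      refine ⟨fun k => (t k - s) / (e - s), by simp [hs], ?_, ?_, ?_⟩
      · simp [← he, hpos.ne']
      · intro k h1 h2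
        have := h.mono k h1 h2
        dsimp only
        gcongr
      · intro k _ _
        field_simp
        ring
  have him : ∀ x y, (fun τ => γ (s + (e - s) * τ)) '' Icc x y ⊆
      γ '' Icc (s + (e - s) * x) (s + (e - s) * y) := by
    rintro x y _ ⟨τ, hτ, rfl⟩
    have hpos : 0 ≤ e - s := sub_nonneg.2 hse
    refine ⟨_, ⟨?_, ?_⟩, rfl⟩
    · have := mul_le_mul_of_nonneg_left hτ.1 hpos
      linarith
    · have := mul_le_mul_of_nonneg_left hτ.2 hpos
      linarith
  have h0 : s + (e - s) * 0 = s := by ring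
  have h1 : s + (e - s) * 1 = e := by ring
  refine ⟨fun τ => γ (s + (e - s) * τ), t₁, ⟨?_, ht0, ht1, htm, ?_, ?_⟩, ?_, ?_, ?_, ?_⟩
  · obtain ⟨C, hC⟩ := h.lip
    refine ⟨C * Real.toNNReal (e - s), LipschitzOnWith.of_dist_le_mul fun x hx y hy => ?_⟩
    have hpos : 0 ≤ e - s := sub_nonneg.2 hse
    have hmem : ∀ x ∈ Icc (0 : ℝ) 1, s + (e - s) * x ∈ Icc s e := fun x hx =>
      ⟨by nlinarith [hx.1], by nlinarith [hx.2]⟩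
    have := hC.dist_le_mul _ (hmem x hx) _ (hmem y hy)
    rw [Real.dist_eq, show s + (e - s) * x - (s + (e - s) * y) = (e - s) * (x - y) by ring,
      abs_mul, abs_of_nonneg hpos] at this
    rw [NNReal.coe_mul, Real.coe_toNNReal _ hpos, Real.dist_eq, mul_assoc]
    exact this
  · intro k h1 h2
    simp only [htφ k (by lia) h2.le]
    exact h.crossing k h1 h2
  · intro k h1 h2
    refine (him _ _).trans ?_
    rw [htφ k (by lia) h2, htφ (k - 1) (by lia) (by lia)]
    exact h.inside k h1 h2
  · simp only [h0, s]
  · simp only [h1, e]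
  · refine Subset.antisymm (by have := him 0 1; rwa [h0, h1] at this) ?_
    rintro _ ⟨σ, hσ, rfl⟩
    rcases hse.eq_or_lt with hse' | hse'
    · refine ⟨0, by simp, ?_⟩
      dsimp only
      rw [h0, le_antisymm (hσ.2.trans hse'.ge) hσ.1]
    · have hpos : 0 < e - s := sub_pos.2 hse'
      refine ⟨(σ - s) / (e - s), ⟨div_nonneg (by linarith [hσ.1]) hpos.le, ?_⟩, ?_⟩
      · rw [div_le_one hpos]
        linarith [hσ.2]
      · dsimp only
        congr 1
        field_simp
        ring
  · intro E
    refine Finset.sum_congr rfl fun k hk => ?_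
    rw [Finset.mem_Icc] at hk
    rw [pathLength_comp_affine _ _ _ _ _ _ hse, htφ k (by lia) hk.2,
      htφ (k - 1) (by lia) (by lia)]

end ConfOn

section ConfOn

variable {n H : ℝ} {a b : ℤ} {γ : ℝ → Plane} {t : ℤ → ℝ}

lemma ConfOn.image_subset (h : ConfOn n H a b γ t) (hab : a ≤ b) (hn : 0 ≤ n) {x : Plane}
    (hx : x ∈ γ '' Icc (t (a - 1)) (t b)) : ((a : ℝ) - 1) * n ≤ x 0 ∧ x 0 ≤ b * n := by
  obtain ⟨τ, hτ, rfl⟩ := hx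
  obtain ⟨k, h1, h2, h3, h4⟩ := exists_time_mem (by lia) hτ.1 hτ.2
  have := h.inside k (by lia) h2 ⟨τ, ⟨h3, h4⟩, rfl⟩
  have ha : (a : ℝ) ≤ k := by exact_mod_cast (by lia : a ≤ k)
  have hb : (k : ℝ) ≤ b := by exact_mod_cast h2
  exact ⟨(by gcongr : ((a : ℝ) - 1) * n ≤ (k - 1) * n).trans this.1,
    this.2.trans (by gcongr)⟩

/-- Lengthening a conforming path by a horizontal segment at its end. -/
lemma ConfOn.extend_right (h : ConfOn n H a b γ t) (hab : a ≤ b) {ε : ℝ} (hε : 0 ≤ ε)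
    (hb : γ (t b) 0 + ε ≤ b * n) :
    ∃ γ₁ t₁, ConfOn n H a b γ₁ t₁ ∧ γ₁ (t₁ (a - 1)) = γ (t (a - 1)) ∧
      γ₁ (t₁ b) = pt (γ (t b) 0 + ε) (γ (t b) 1) ∧
      (∀ x ∈ γ₁ '' Icc (t₁ (a - 1)) (t₁ b), ∃ τ ∈ Icc (t (a - 1)) (t b), x 1 = γ τ 1) ∧
      ∀ (E : Env) (d : ℝ), E.Regular d →
        timedWeight E a b γ₁ t₁ ≤ timedWeight E a b γ t + d * ε := by
  obtain ⟨C, hC⟩ := h.lip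
  have hle := h.le hab
  have hc : γ (t b) = hline (t b) (γ (t b)) (t b) := by simp
  set γ₁ := glue (t b) γ (hline (t b) (γ (t b))) with hγ₁
  have hl : ∀ τ, τ ≤ t b → γ₁ τ = γ τ := fun τ hτ => glue_of_le _ _ hτ
  have hr : ∀ τ, t b ≤ τ → γ₁ τ = hline (t b) (γ (t b)) τ := fun τ hτ => glue_of_ge hc hτ
  set t₁ : ℤ → ℝ := fun k => if k < b then t k else t b + ε with ht₁
  have htlt : ∀ k, k < b → t₁ k = t k := fun k hk => if_pos hk
  have htb : t₁ b = t b + ε := if_neg (lt_irrefl b)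
  have hlip : LipschitzOnWith (max C 1) γ₁ (Icc (t (a - 1)) (t b + ε)) :=
    lipschitzOnWith_glue hC ((lipschitzWith_hline _ _).lipschitzOnWith) hc hle (by linarith)
  have hkb : ∀ k, a - 1 ≤ k → k ≤ b → t k ≤ t b := fun k h1 h2 =>
    times_mono h.mono h1 h2 le_rfl
  refine ⟨γ₁, t₁, ⟨⟨max C 1, ?_⟩, ?_, ?_, ?_⟩, ?_, ?_, ?_, ?_⟩
  · rwa [htb, htlt _ (by lia)]
  · intro k h1 h2
    rcases h2.eq_or_lt with rfl | h2
    · rw [htb, htlt _ (by lia)]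
      linarith [h.mono k h1 le_rfl]
    · rw [htlt _ h2, htlt _ (by lia)]
      exact h.mono k h1 h2.le
  · intro k h1 h2
    rw [htlt k h2, hl _ (hkb k (by lia) h2.le)]
    exact h.crossing k h1 h2
  · intro k h1 h2
    rcases h2.eq_or_lt with rfl | h2
    · rw [htb, htlt _ (by lia)]
      rintro _ ⟨τ, hτ, rfl⟩
      rcases le_total τ (t k) with h3 | h3
      · rw [hl τ h3]
        exact h.inside k h1 le_rfl ⟨τ, ⟨hτ.1, h3⟩, rfl⟩
      · have h4 := h.inside k h1 le_rfl ⟨t k, ⟨h.mono k h1 le_rfl, le_rfl⟩, rfl⟩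
        rw [hr τ h3]
        constructor
        · rw [hline_zero]
          linarith [h4.1]
        · rw [hline_zero]
          linarith [hτ.2]
    · rw [htlt _ h2, htlt _ (by lia)]
      rintro _ ⟨τ, hτ, rfl⟩
      rw [hl τ (hτ.2.trans (hkb k (by lia) h2.le))]
      exact h.inside k h1 h2.le ⟨τ, hτ, rfl⟩
  · rw [htlt _ (by lia), hl _ hle]
  · rw [htb, hr _ (by linarith)]
    apply plane_ext <;> simp
  · rw [htb, htlt _ (by lia)]
    rintro _ ⟨τ, hτ, rfl⟩
    rcases le_total τ (t b) with h3 | h3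
    · exact ⟨τ, ⟨hτ.1, h3⟩, by rw [hl τ h3]⟩
    · exact ⟨t b, ⟨hle, le_rfl⟩, by rw [hr τ h3, hline_one]⟩
  · intro E d hE
    have hlast : pathLength (E b) γ₁ (t₁ (b - 1)) (t₁ b) ≤
        pathLength (E b) γ (t (b - 1)) (t b) + d * ε := by
      rw [htb, htlt _ (by lia), ← pathLength_add (hE.continuous b) (h.mono b hab le_rfl)
        (by linarith : t b ≤ t b + ε) (hlip.mono (Icc_subset_Icc_left
          (times_mono h.mono le_rfl (by lia) (by lia))))]
      have e1 : pathLength (E b) γ₁ (t (b - 1)) (t b) = pathLength (E b) γ (t (b - 1)) (t b) :=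
        pathLength_congr (h.mono b hab le_rfl) fun τ hτ => hl τ hτ.2.le
      have e2 : pathLength (E b) γ₁ (t b) (t b + ε) =
          pathLength (E b) (hline (t b) (γ (t b))) (t b) (t b + ε) :=
        pathLength_congr (by linarith) fun τ hτ => hr τ hτ.1.le
      have e3 := pathLength_hline_le (hE.continuous b) (hE.lt b) (t b) (γ (t b))
        (by linarith : t b ≤ t b + ε)
      rw [e1, e2]
      linarith
    have hrest : ∀ k ∈ Finset.Icc a b, k ≠ b → pathLength (E k) γ₁ (t₁ (k - 1)) (t₁ k) =
        pathLength (E k) γ (t (k - 1)) (t k) := by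
      intro k hk hkb'
      rw [Finset.mem_Icc] at hk
      have h2 : k < b := by lia
      rw [htlt _ h2, htlt _ (by lia)]
      exact pathLength_congr (h.mono k hk.1 hk.2) fun τ hτ =>
        hl τ (hτ.2.le.trans (hkb k (by lia) hk.2))
    have hb' : b ∈ Finset.Icc a b := Finset.mem_Icc.2 ⟨hab, le_rfl⟩
    unfold timedWeight
    rw [← Finset.add_sum_erase _ _ hb',
      ← Finset.add_sum_erase _ (fun k => pathLength (E k) γ (t (k - 1)) (t k)) hb',
      Finset.sum_congr rfl fun k hk => hrest k (Finset.mem_of_mem_erase hk)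
        (Finset.ne_of_mem_erase hk)]
    linarith

/-- Lengthening a conforming path by a horizontal segment at its start. -/
lemma ConfOn.extend_left (h : ConfOn n H a b γ t) (hab : a ≤ b) {ε : ℝ} (hε : 0 ≤ ε)
    (ha : ((a : ℝ) - 1) * n ≤ γ (t (a - 1)) 0 - ε) :
    ∃ γ₁ t₁, ConfOn n H a b γ₁ t₁ ∧ γ₁ (t₁ b) = γ (t b) ∧
      γ₁ (t₁ (a - 1)) = pt (γ (t (a - 1)) 0 - ε) (γ (t (a - 1)) 1) ∧
      (∀ x ∈ γ₁ '' Icc (t₁ (a - 1)) (t₁ b), ∃ τ ∈ Icc (t (a - 1)) (t b), x 1 = γ τ 1) ∧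
      ∀ (E : Env) (d : ℝ), E.Regular d →
        timedWeight E a b γ₁ t₁ ≤ timedWeight E a b γ t + d * ε := by
  obtain ⟨C, hC⟩ := h.lip
  have hle := h.le hab
  set s := t (a - 1) with hs
  have hc : hline s (γ s) s = γ s := by simp
  set γ₁ := glue s (hline s (γ s)) γ with hγ₁
  have hl : ∀ τ, τ ≤ s → γ₁ τ = hline s (γ s) τ := fun τ hτ => glue_of_le _ _ hτ
  have hr : ∀ τ, s ≤ τ → γ₁ τ = γ τ := fun τ hτ => glue_of_ge hc hτ
  set t₁ : ℤ → ℝ := fun k => if k < a then s - ε else t k with ht₁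
  have htge : ∀ k, a ≤ k → t₁ k = t k := fun k hk => if_neg (not_lt.2 hk)
  have hta : t₁ (a - 1) = s - ε := if_pos (by lia)
  have hlip : LipschitzOnWith (max 1 C) γ₁ (Icc (s - ε) (t b)) :=
    lipschitzOnWith_glue ((lipschitzWith_hline _ _).lipschitzOnWith) hC hc (by linarith) hle
  have hka : ∀ k, a - 1 ≤ k → k ≤ b → s ≤ t k := fun k h1 h2 =>
    times_mono h.mono le_rfl h1 h2
  refine ⟨γ₁, t₁, ⟨⟨max 1 C, ?_⟩, ?_, ?_, ?_⟩, ?_, ?_, ?_, ?_⟩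
  · rwa [hta, htge _ hab]
  · intro k h1 h2
    rcases h1.eq_or_lt with rfl | h1
    · rw [hta, htge _ le_rfl]
      linarith [hka a (by lia) h2]
    · rw [htge _ h1.le, htge _ (by lia)]
      exact h.mono k h1.le h2
  · intro k h1 h2
    rw [htge k h1, hr _ (hka k (by lia) h2.le)]
    exact h.crossing k h1 h2
  · intro k h1 h2
    rcases h1.eq_or_lt with rfl | h1
    · rw [hta, htge _ le_rfl]
      rintro _ ⟨τ, hτ, rfl⟩
      rcases le_total s τ with h3 | h3
      · rw [hr τ h3]
        exact h.inside a le_rfl h2 ⟨τ, ⟨h3, hτ.2⟩, rfl⟩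
      · have h4 := h.inside a le_rfl h2 ⟨s, ⟨le_rfl, hka a (by lia) h2⟩, rfl⟩
        rw [hl τ h3]
        constructor
        · rw [hline_zero]
          linarith [hτ.1]
        · rw [hline_zero]
          linarith [h4.2]
    · rw [htge _ h1.le, htge _ (by lia)]
      rintro _ ⟨τ, hτ, rfl⟩
      rw [hr τ ((hka (k - 1) (by lia) (by lia)).trans hτ.1)]
      exact h.inside k h1.le h2 ⟨τ, hτ, rfl⟩
  · rw [htge _ hab, hr _ hle]
  · rw [hta, hl _ (by linarith)]
    apply plane_ext
    · simp only [hline_zero, pt_zero]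
      ring
    · simp
  · rw [hta, htge _ hab]
    rintro _ ⟨τ, hτ, rfl⟩
    rcases le_total s τ with h3 | h3
    · exact ⟨τ, ⟨h3, hτ.2⟩, by rw [hr τ h3]⟩
    · exact ⟨s, ⟨le_rfl, hle⟩, by rw [hl τ h3, hline_one]⟩
  · intro E d hE
    have hsa := hka a (by lia) hab
    have hfirst : pathLength (E a) γ₁ (t₁ (a - 1)) (t₁ a) ≤
        pathLength (E a) γ s (t a) + d * ε := by
      rw [hta, htge _ le_rfl, ← pathLength_add (hE.continuous a) (by linarith : s - ε ≤ s)
        hsa (hlip.mono (Icc_subset_Icc_right (times_mono h.mono (by lia) hab le_rfl)))]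
      have e1 : pathLength (E a) γ₁ s (t a) = pathLength (E a) γ s (t a) :=
        pathLength_congr hsa fun τ hτ => hr τ hτ.1.le
      have e2 : pathLength (E a) γ₁ (s - ε) s = pathLength (E a) (hline s (γ s)) (s - ε) s :=
        pathLength_congr (by linarith) fun τ hτ => hl τ hτ.2.le
      have e3 := pathLength_hline_le (hE.continuous a) (hE.lt a) s (γ s)
        (by linarith : s - ε ≤ s)
      rw [e1, e2]
      linarith
    have hrest : ∀ k ∈ Finset.Icc a b, k ≠ a → pathLength (E k) γ₁ (t₁ (k - 1)) (t₁ k) =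
        pathLength (E k) γ (t (k - 1)) (t k) := by
      intro k hk hka'
      rw [Finset.mem_Icc] at hk
      rw [htge _ hk.1, htge _ (by lia)]
      exact pathLength_congr (h.mono k hk.1 hk.2) fun τ hτ =>
        hr τ ((hka (k - 1) (by lia) (by lia)).trans hτ.1.le)
    have ha' : a ∈ Finset.Icc a b := Finset.mem_Icc.2 ⟨le_rfl, hab⟩
    unfold timedWeight
    rw [← Finset.add_sum_erase _ _ ha',
      ← Finset.add_sum_erase _ (fun k => pathLength (E k) γ (t (k - 1)) (t k)) ha',
      Finset.sum_congr rfl fun k hk => hrest k (Finset.mem_of_mem_erase hk)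
        (Finset.ne_of_mem_erase hk)]
    linarith

/-- The weight of the part of a conforming path before the time `s`. -/
def cumWeight (E : Env) (a b : ℤ) (γ : ℝ → Plane) (t : ℤ → ℝ) (s : ℝ) : ℝ :=
  ∑ k ∈ Finset.Icc a b, pathLength (E k) γ (min s (t (k - 1))) (min s (t k))

/-- The part of a conforming path between two times. -/
lemma ConfOn.restrict (h : ConfOn n H a b γ t) {A B : ℤ} (haA : a ≤ A) (hAB : A ≤ B)
    (hBb : B ≤ b) {s₁ s₂ : ℝ} (hs : s₁ ≤ s₂) (h1 : t (A - 1) ≤ s₁) (h1' : s₁ ≤ t A)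
    (h2 : t (B - 1) ≤ s₂) (h2' : s₂ ≤ t B) :
    ∃ τ : ℤ → ℝ, τ (A - 1) = s₁ ∧ τ B = s₂ ∧ ConfOn n H A B γ τ ∧
      ∀ (E : Env) (d : ℝ), E.Regular d →
        timedWeight E A B γ τ = cumWeight E a b γ t s₂ - cumWeight E a b γ t s₁ := by
  obtain ⟨C, hC⟩ := h.lip
  have tm : ∀ {k l : ℤ}, a - 1 ≤ k → k ≤ l → l ≤ b → t k ≤ t l := fun h1 h2 h3 =>
    times_mono h.mono h1 h2 h3
  set τ : ℤ → ℝ := fun k => if k < A then s₁ else if k < B then t k else s₂ with hτ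
  have tA : τ (A - 1) = s₁ := if_pos (by lia)
  have tB : τ B = s₂ := by simp [hτ, not_lt.2 hAB]
  have tM : ∀ k, A ≤ k → k < B → τ k = t k := fun k h1 h2 => by
    simp [hτ, not_lt.2 h1, h2]
  have hsub : Icc s₁ s₂ ⊆ Icc (t (a - 1)) (t b) := Icc_subset_Icc
    ((tm le_rfl (by lia) (by lia)).trans h1) (h2'.trans (tm (by lia) hBb le_rfl))
  have hlow : ∀ k, A ≤ k → k ≤ B → t (k - 1) ≤ τ (k - 1) := by
    intro k hk hk'
    rcases hk.eq_or_lt with rfl | hk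
    · rwa [tA]
    · rw [tM _ (by lia) (by lia)]
  have hupp : ∀ k, A ≤ k → k ≤ B → τ k ≤ t k := by
    intro k hk hk'
    rcases hk'.eq_or_lt with rfl | hk'
    · rwa [tB]
    · rw [tM _ hk hk']
  refine ⟨τ, tA, tB, ⟨⟨C, ?_⟩, ?_, ?_, ?_⟩, ?_⟩
  · rw [tA, tB]
    exact hC.mono hsub
  · intro k hk hk'
    rcases hk.eq_or_lt with rfl | hk
    · rw [tA]
      rcases hk'.eq_or_lt with rfl | hk'
      · rwa [tB]
      · rwa [tM _ le_rfl hk']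
    · rw [tM (k - 1) (by lia) (by lia)]
      rcases hk'.eq_or_lt with rfl | hk'
      · rwa [tB]
      · rw [tM _ hk.le hk']
        exact h.mono k (by lia) (by lia)
  · intro k hk hk'
    rw [tM k hk hk']
    exact h.crossing k (by lia) (by lia)
  · intro k hk hk'
    exact (image_mono (Icc_subset_Icc (hlow k hk hk') (hupp k hk hk'))).trans
      (h.inside k (by lia) (by lia))
  · intro E d hE
    have hlen : ∀ k x y, x ∈ Icc (t (a - 1)) (t b) → y ∈ Icc (t (a - 1)) (t b) →
        pathLength (E k) γ x y =
          pathLength (E k) γ (t (a - 1)) y - pathLength (E k) γ (t (a - 1)) x := by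
      intro k x y hx hy
      exact (intervalIntegral.integral_interval_sub_left
        (intervalIntegrable_length (hE.continuous k) hy.1
          (hC.mono (Icc_subset_Icc_right hy.2)))
        (intervalIntegrable_length (hE.continuous k) hx.1
          (hC.mono (Icc_subset_Icc_right hx.2)))).symm
    have ms₁ : s₁ ∈ Icc (t (a - 1)) (t b) := hsub ⟨le_rfl, hs⟩
    have ms₂ : s₂ ∈ Icc (t (a - 1)) (t b) := hsub ⟨hs, le_rfl⟩
    have mt : ∀ k, a - 1 ≤ k → k ≤ b → t k ∈ Icc (t (a - 1)) (t b) := fun k h1 h2 =>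
      ⟨tm le_rfl h1 h2, tm h1 h2 le_rfl⟩
    have mmin : ∀ s ∈ Icc (t (a - 1)) (t b), ∀ k, a - 1 ≤ k → k ≤ b →
        min s (t k) ∈ Icc (t (a - 1)) (t b) := fun s hs k h1 h2 =>
      ⟨le_min hs.1 (mt k h1 h2).1, (min_le_left _ _).trans hs.2⟩
    unfold cumWeight timedWeight
    rw [← Finset.sum_sub_distrib]
    -- A column before `A` is completed by time `s₁`, and one after `B` has not been entered by time
    -- `s₂`; neither contributes to the difference.
    rw [← Finset.sum_subset (Finset.Icc_subset_Icc haA hBb)]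
    · refine Finset.sum_congr rfl fun k hk => ?_
      rw [Finset.mem_Icc] at hk
      have m1 : τ (k - 1) ∈ Icc (t (a - 1)) (t b) := by
        rcases hk.1.eq_or_lt with rfl | hk1
        · rwa [tA]
        · rw [tM _ (by lia) (by lia)]
          exact mt _ (by lia) (by lia)
      have m2 : τ k ∈ Icc (t (a - 1)) (t b) := by
        rcases hk.2.eq_or_lt with rfl | hk2
        · rwa [tB]
        · rw [tM _ hk.1 hk2]
          exact mt _ (by lia) (by lia)
      rw [hlen k _ _ m1 m2,
        hlen k _ _ (mmin _ ms₂ _ (by lia) (by lia)) (mmin _ ms₂ _ (by lia) (by lia)),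
        hlen k _ _ (mmin _ ms₁ _ (by lia) (by lia)) (mmin _ ms₁ _ (by lia) (by lia))]
      have c1 : min s₁ (t k) = s₁ := min_eq_left (h1'.trans (tm (by lia) hk.1 (by lia)))
      have c2 : min s₂ (t k) = τ k := by
        rcases hk.2.eq_or_lt with rfl | hk2
        · rw [tB, min_eq_left h2']
        · rw [tM _ hk.1 hk2]
          exact min_eq_right ((tm (by lia) (by lia) (by lia)).trans h2)
      have c3 : min s₂ (t (k - 1)) = t (k - 1) :=
        min_eq_right ((tm (by lia) (by lia) (by lia)).trans h2)
      rw [c1, c2, c3]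
      rcases hk.1.eq_or_lt with rfl | hk1
      · rw [tA, min_eq_right h1]
        ring
      · rw [tM (k - 1) (by lia) (by lia), min_eq_left (h1'.trans (tm (by lia) (by lia) (by lia)))]
        ring
    · intro k hk hk'
      rw [Finset.mem_Icc] at hk hk'
      rcases lt_or_ge k A with hkA | hkA
      · have e1 : t k ≤ s₁ := (tm (by lia) (by lia) (by lia)).trans h1
        have e2 : t (k - 1) ≤ s₁ := (tm (by lia) (by lia) (by lia)).trans h1
        rw [min_eq_right e1, min_eq_right e2, min_eq_right (e1.trans hs),
          min_eq_right (e2.trans hs), sub_self]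
      · have e1 : s₂ ≤ t k := h2'.trans (tm (by lia) (by lia) (by lia))
        have e2 : s₂ ≤ t (k - 1) := h2'.trans (tm (by lia) (by lia) (by lia))
        rw [min_eq_left e1, min_eq_left e2, min_eq_left (hs.trans e1), min_eq_left (hs.trans e2)]
        simp [pathLength]

end ConfOn

/-! ### Weights of parts of conforming paths -/

lemma weight_le_timedWeight {g : Grid} {E : Env} {γ : ℝ → Plane} {a b : ℤ} {t : ℤ → ℝ}
    (hr : ColumnRange g.n (γ 0) (γ 1) a b) (hc : IsConforming g.n g.H a b γ t) :
    weight g E γ ≤ ((timedWeight E a b γ t : ℝ) : EReal) :=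
  iInf_le_of_le a (iInf_le_of_le b (iInf_le_of_le t (iInf_le_of_le hr (iInf_le_of_le hc le_rfl))))

/-- The part of a conforming path between two times, after an arbitrarily small horizontal
displacement of its end points, is conforming and has about the weight it should have. -/
lemma ConfOn.exists_weight_le {g : Grid} (hn : 0 < g.n) {a b : ℤ} {γ : ℝ → Plane} {t : ℤ → ℝ}
    (h : ConfOn g.n g.H a b γ t) {A₀ B₀ : ℤ} (hA₀ : a - 1 ≤ A₀) (hAB₀ : A₀ < B₀) (hB₀ : B₀ ≤ b)
    {s₁ s₂ : ℝ} (hs : s₁ ≤ s₂) (hs₁ : t A₀ ≤ s₁) (hs₂ : s₂ ≤ t B₀) {ε : ℝ} (hε : 0 < ε)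
    (hεn : ε < g.n) :
    ∃ (γ₁ : ℝ → Plane) (x₁ x₂ : ℝ), γ₁ 0 = pt x₁ (γ s₁ 1) ∧ γ₁ 1 = pt x₂ (γ s₂ 1) ∧
      |x₁ - γ s₁ 0| ≤ ε ∧ |x₂ - γ s₂ 0| ≤ ε ∧
      (γ s₁ 0 = A₀ * g.n → x₁ = A₀ * g.n) ∧ (γ s₂ 0 = B₀ * g.n → x₂ = B₀ * g.n) ∧
      (∀ x ∈ trace γ₁, A₀ * g.n ≤ x 0 ∧ x 0 ≤ B₀ * g.n ∧ ∃ τ ∈ Icc s₁ s₂, x 1 = γ τ 1) ∧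
      ∀ (E : Env) (d : ℝ), E.Regular d → weight g E γ₁ ≤
        ((cumWeight E a b γ t s₂ - cumWeight E a b γ t s₁ + 2 * d * ε : ℝ) : EReal) := by
  have tm : ∀ {k l : ℤ}, a - 1 ≤ k → k ≤ l → l ≤ b → t k ≤ t l := fun h1 h2 h3 =>
    times_mono h.mono h1 h2 h3
  obtain ⟨A, hA1, hA2, hA3, hA4⟩ := exists_time_mem hAB₀ hs₁ (hs.trans hs₂)
  obtain ⟨B, hAB, hB2, hB3, hB4⟩ : ∃ B, A ≤ B ∧ B ≤ B₀ ∧ t (B - 1) ≤ s₂ ∧ s₂ ≤ t B := by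
    obtain ⟨B, hB1, hB2, hB3, hB4⟩ := exists_time_mem hAB₀ (hs₁.trans hs) hs₂
    by_cases hAB : A ≤ B
    · exact ⟨B, hAB, hB2, hB3, hB4⟩
    -- Here `s₁`, `s₂` and the crossing times between them coincide, so `A` serves for `s₂` too.
    · have h1 : t B ≤ t (A - 1) := tm (by lia) (by lia) (by lia)
      exact ⟨A, le_rfl, hA2, by linarith, by linarith⟩
  obtain ⟨τ, hτ1, hτ2, hτ, hτw⟩ := h.restrict (by lia) hAB (by lia) hs hA3 hA4 hB3 hB4
  have hu : γ s₁ ∈ column g.n A := h.inside A (by lia) (by lia) ⟨s₁, ⟨hA3, hA4⟩, rfl⟩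
  have hv : γ s₂ ∈ column g.n B := h.inside B (by lia) (by lia) ⟨s₂, ⟨hB3, hB4⟩, rfl⟩
  -- The start is moved strictly left of the right boundary of `Λ_A`, and below the end strictly
  -- right of the left boundary of `Λ_B`. This gives both cases of `ColumnRange` and excludes
  -- vertical boundary pairs. An end on the outer line `A₀` or `B₀` is never moved.
  obtain ⟨ε₁, hε₁, hε₁', hx₁, hx₁', hx₁''⟩ : ∃ ε₁, 0 ≤ ε₁ ∧ ε₁ ≤ ε ∧
      ((A : ℝ) - 1) * g.n ≤ γ s₁ 0 - ε₁ ∧ γ s₁ 0 - ε₁ < A * g.n ∧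
      (γ s₁ 0 = A₀ * g.n → ε₁ = 0) := by
    by_cases hA : γ s₁ 0 = A * g.n
    · refine ⟨ε, hε.le, le_rfl, by rw [hA]; linarith, by rw [hA]; linarith, fun h' => ?_⟩
      have : (A : ℝ) = A₀ := mul_right_cancel₀ hn.ne' (hA.symm.trans h')
      have : A = A₀ := by exact_mod_cast this
      lia
    · refine ⟨0, le_rfl, hε.le, by simpa using hu.1, ?_, fun _ => rfl⟩
      rw [sub_zero]
      exact lt_of_le_of_ne hu.2 hA
  obtain ⟨ε₂, hε₂, hεb, hx₂, hx₂', hx₂''⟩ : ∃ ε₂, 0 ≤ ε₂ ∧ ε₂ ≤ ε ∧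
      γ s₂ 0 + ε₂ ≤ B * g.n ∧ ((B : ℝ) - 1) * g.n < γ s₂ 0 + ε₂ ∧
      (γ s₂ 0 = B₀ * g.n → ε₂ = 0) := by
    by_cases hB : γ s₂ 0 = ((B : ℝ) - 1) * g.n
    · refine ⟨ε, hε.le, le_rfl, by rw [hB]; linarith, by rw [hB]; linarith, fun h' => ?_⟩
      have : (B : ℝ) - 1 = B₀ := mul_right_cancel₀ hn.ne' (hB.symm.trans h')
      have : B - 1 = B₀ := by exact_mod_cast this
      lia
    · refine ⟨0, le_rfl, hε.le, by simpa using hv.2, ?_, fun _ => rfl⟩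
      rw [add_zero]
      exact lt_of_le_of_ne hv.1 (Ne.symm hB)
  obtain ⟨γ₂, t₂, hc₂, hl₂, hr₂, htr₂, hw₂⟩ :=
    hτ.extend_right hAB hε₂ (by rw [hτ2]; exact hx₂)
  obtain ⟨γ₃, t₃, hc₃, hr₃, hl₃, htr₃, hw₃⟩ :=
    hc₂.extend_left hAB hε₁ (by rw [hl₂, hτ1]; exact hx₁)
  rw [hl₂, hτ1] at hl₃
  rw [hr₂, hτ2] at hr₃
  rw [hτ1, hτ2] at htr₂
  obtain ⟨γ₁, t₁, hc₁, hl₁, hr₁, htr₁, hw₁⟩ := hc₃.reparam hAB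
  rw [hl₃] at hl₁
  rw [hr₃] at hr₁
  refine ⟨γ₁, γ s₁ 0 - ε₁, γ s₂ 0 + ε₂, hl₁, hr₁, ?_, ?_, fun h' => ?_, fun h' => ?_, ?_, ?_⟩
  · rw [abs_le]
    constructor <;> linarith
  · rw [abs_le]
    constructor <;> linarith
  · rw [hx₁'' h', h', sub_zero]
  · rw [hx₂'' h', h', add_zero]
  · intro x hx
    have hx3 := htr₁ ▸ hx
    have hcol := hc₃.image_subset hAB hn.le hx3
    obtain ⟨σ, hσ, e1⟩ := htr₃ x hx3
    obtain ⟨σ', hσ', e2⟩ := htr₂ (γ₂ σ) ⟨σ, hσ, rfl⟩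
    have c1 : (A₀ : ℝ) ≤ A - 1 := by exact_mod_cast (by lia : A₀ ≤ A - 1)
    have c2 : (B : ℝ) ≤ B₀ := by exact_mod_cast hB2
    exact ⟨(mul_le_mul_of_nonneg_right c1 hn.le).trans hcol.1,
      hcol.2.trans (mul_le_mul_of_nonneg_right c2 hn.le), σ', hσ', e1.trans e2⟩
  · intro E d hE
    have hrange : ColumnRange g.n (γ₁ 0) (γ₁ 1) A B := by
      rw [hl₁, hr₁]
      rcases hAB.eq_or_lt with rfl | hAB
      · refine Or.inl ⟨rfl, ⟨hx₁, hx₁'.le⟩, ⟨hx₂'.le, hx₂⟩, ?_⟩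
        rintro ⟨k, hk1, hk2⟩
        simp only [pt_zero] at hk1 hk2
        rw [hk1] at hx₁'
        rw [hk2] at hx₂'
        have k1 : (k : ℝ) < A := lt_of_mul_lt_mul_right hx₁' hn.le
        have k2 : (A : ℝ) - 1 < k := lt_of_mul_lt_mul_right hx₂' hn.le
        have k1' : k < A := by exact_mod_cast k1
        have k2' : A - 1 < k := by exact_mod_cast k2
        lia
      · exact Or.inr ⟨hAB, hx₁, hx₁', hx₂', hx₂⟩
    refine (weight_le_timedWeight hrange hc₁).trans (EReal.coe_le_coe_iff.2 ?_)
    have w3 := hw₃ E d hE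
    have w2 := hw₂ E d hE
    have w1 := hτw E d hE
    have hd : 0 ≤ d := ((hE.pos 0 0).trans (hE.lt 0 0)).le
    rw [hw₁ E]
    nlinarith [mul_le_mul_of_nonneg_left hε₁' hd, mul_le_mul_of_nonneg_left hεb hd]

/-- There is a conforming path from `u` to `v` through `Λ_{A+1}, …, Λ_B` of weight at most `x`. -/
def Joins (g : Grid) (E : Env) (A B : ℤ) (u v : Plane) (x : ℝ) : Prop :=
  ∃ γ t, IsConforming g.n g.H (A + 1) B γ t ∧ γ 0 = u ∧ γ 1 = v ∧
    timedWeight E (A + 1) B γ t ≤ x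

lemma ColumnRange.eq_of_boundary {n : ℝ} (hn : 0 < n) {u v : Plane} {A B a b : ℤ} (hAB : A < B)
    (hu : u 0 = A * n) (hv : v 0 = B * n) (h : ColumnRange n u v a b) : a = A + 1 ∧ b = B := by
  rcases h with ⟨rfl, h1, h2, -⟩ | ⟨-, h1, h2, h3, h4⟩
  · have e1 := h1.1
    have e2 := h2.2
    rw [hu] at e1
    rw [hv] at e2
    have e1' : (a : ℝ) - 1 ≤ A := le_of_mul_le_mul_right e1 hn
    have e2' : (B : ℝ) ≤ a := le_of_mul_le_mul_right e2 hn
    have e1'' : a - 1 ≤ A := by exact_mod_cast e1'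
    have e2'' : B ≤ a := by exact_mod_cast e2'
    lia
  · rw [hu] at h1 h2
    rw [hv] at h3 h4
    have e1 : (a : ℝ) - 1 ≤ A := le_of_mul_le_mul_right h1 hn
    have e2 : (A : ℝ) < a := lt_of_mul_lt_mul_right h2 hn.le
    have e3 : (b : ℝ) - 1 < B := lt_of_mul_lt_mul_right h3 hn.le
    have e4 : (B : ℝ) ≤ b := le_of_mul_le_mul_right h4 hn
    have e1' : a - 1 ≤ A := by exact_mod_cast e1
    have e2' : A < a := by exact_mod_cast e2
    have e3' : b - 1 < B := by exact_mod_cast e3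
    have e4' : B ≤ b := by exact_mod_cast e4
    lia

lemma columnRange_boundary {n : ℝ} (hn : 0 < n) {u v : Plane} {A B : ℤ} (hAB : A < B)
    (hu : u 0 = A * n) (hv : v 0 = B * n) : ColumnRange n u v (A + 1) B := by
  have hAB' : (A : ℝ) + 1 ≤ B := by exact_mod_cast (by lia : A + 1 ≤ B)
  have hAB'' : ((A : ℝ) + 1) * n ≤ B * n := by gcongr
  rcases (by lia : A + 1 = B ∨ A + 1 < B) with rfl | h
  · push_cast at hv
    refine Or.inl ⟨rfl, ⟨?_, ?_⟩, ⟨?_, ?_⟩, ?_⟩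
    · rw [hu]; push_cast; linarith
    · rw [hu]; push_cast; linarith
    · rw [hv]; push_cast; linarith
    · rw [hv]; push_cast; linarith
    · rintro ⟨k, h1, h2⟩
      rw [hu] at h1
      rw [hv] at h2
      linarith
  · refine Or.inr ⟨h, ?_, ?_, ?_, ?_⟩
    · rw [hu]; push_cast; linarith
    · rw [hu]; push_cast; linarith
    · rw [hv]; linarith
    · rw [hv]

/-- The infimum in `weight` need not be attained, hence the strict inequality. The columns used are
forced by the two boundary lines. -/
lemma joins_of_weight_lt {g : Grid} (hn : 0 < g.n) {E : Env} {γ : ℝ → Plane} {A B : ℤ}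
    (hAB : A < B) (hu : γ 0 0 = A * g.n) (hv : γ 1 0 = B * g.n) {x : ℝ}
    (h : weight g E γ < (x : EReal)) : Joins g E A B (γ 0) (γ 1) x := by
  unfold weight at h
  simp only [iInf_lt_iff] at h
  obtain ⟨a, b, t, hr, hc, hx⟩ := h
  obtain ⟨rfl, rfl⟩ := hr.eq_of_boundary hn hAB hu hv
  exact ⟨γ, t, hc, rfl, rfl, (EReal.coe_lt_coe_iff.1 hx).le⟩

lemma Joins.exists_weight_le {g : Grid} (hn : 0 < g.n) {E : Env} {A B : ℤ} {u v : Plane} {x : ℝ}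
    (h : Joins g E A B u v x) (hAB : A < B) (hu : u 0 = A * g.n) (hv : v 0 = B * g.n) :
    ∃ γ, γ 0 = u ∧ γ 1 = v ∧ weight g E γ ≤ (x : EReal) := by
  obtain ⟨γ, t, hc, rfl, rfl, hx⟩ := h
  exact ⟨γ, rfl, rfl, (weight_le_timedWeight (columnRange_boundary hn hAB hu hv) hc).trans
    (EReal.coe_le_coe_iff.2 hx)⟩

/-- The second path is run on `[1, 2]` and the whole is rescaled to `[0, 1]`. The junction becomes
an interior crossing, so its height must respect `H`. -/
lemma Joins.trans {g : Grid} {E : Env} {A B C : ℤ} {u v z : Plane} {x y : ℝ}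
    (h₁ : Joins g E A B u v x) (h₂ : Joins g E B C v z y) (hAB : A < B) (hBC : B < C)
    (hv : v 0 = B * g.n) (hvH : |v 1| ≤ g.H) : Joins g E A C u z (x + y) := by
  obtain ⟨γ₁, t₁, c₁, rfl, e₁, w₁⟩ := h₁
  obtain ⟨γ₂, t₂, c₂, e₂, rfl, w₂⟩ := h₂
  have c₁s := c₁.start
  rw [add_sub_cancel_right] at c₁s
  have c₂s := c₂.start
  rw [add_sub_cancel_right] at c₂s
  -- A shift by one, in the form `s + (e - s) * τ` to which `pathLength_comp_affine` applies.
  set f : ℝ → Plane := fun τ => γ₂ (-1 + (0 - (-1)) * τ) with hf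
  have hc : γ₁ 1 = f 1 := by
    rw [e₁, ← e₂, hf]
    norm_num
  set γ := glue 1 γ₁ f with hγ
  have hl : ∀ τ, τ ≤ 1 → γ τ = γ₁ τ := fun τ hτ => glue_of_le _ _ hτ
  have hr : ∀ τ, 1 ≤ τ → γ τ = f τ := fun τ hτ => glue_of_ge hc hτ
  set t : ℤ → ℝ := fun k => if k ≤ B then t₁ k else 1 + t₂ k with ht
  have tl : ∀ k, k ≤ B → t k = t₁ k := fun k hk => if_pos hk
  have tr : ∀ k, B ≤ k → t k = 1 + t₂ k := by
    intro k hk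
    rcases hk.eq_or_lt with rfl | hk
    · rw [tl _ le_rfl, c₁.finish, c₂s, add_zero]
    · exact if_neg (not_le.2 hk)
  have fsh : ∀ x, f (1 + x) = γ₂ x := fun x => by simp [hf]
  have m₁ : ∀ k, A ≤ k → k ≤ B → t₁ k ≤ 1 := fun k h1 h2 => by
    rw [← c₁.finish]
    exact times_mono c₁.mono (by lia) h2 le_rfl
  have m₂ : ∀ k, B ≤ k → k ≤ C → 0 ≤ t₂ k := fun k h1 h2 => by
    rw [← c₂s]
    exact times_mono c₂.mono (by lia) h1 h2
  have hconf : ConfOn g.n g.H (A + 1) C γ t := by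
    refine ⟨?_, ?_, ?_, ?_⟩
    · obtain ⟨C₁, hC₁⟩ := c₁.isPath
      obtain ⟨C₂, hC₂⟩ := c₂.isPath
      refine ⟨max C₁ C₂, ?_⟩
      rw [add_sub_cancel_right, tl _ hAB.le, tr _ hBC.le, c₁s, c₂.finish]
      refine lipschitzOnWith_glue hC₁ ?_ hc zero_le_one (by norm_num)
      refine LipschitzOnWith.of_dist_le_mul fun x hx y hy => ?_
      have := hC₂.dist_le_mul (-1 + (0 - (-1)) * x) ⟨by linarith [hx.1], by linarith [hx.2]⟩
        (-1 + (0 - (-1)) * y) ⟨by linarith [hy.1], by linarith [hy.2]⟩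
      refine this.trans_eq ?_
      rw [Real.dist_eq, Real.dist_eq]
      congr 2
      ring
    · intro k h1 h2
      rcases le_or_gt k B with hk | hk
      · rw [tl _ hk, tl _ (by lia)]
        exact c₁.mono k h1 hk
      · rw [tr _ hk.le, tr _ (by lia)]
        linarith [c₂.mono k (by lia) h2]
    · intro k h1 h2
      rcases lt_trichotomy k B with hk | rfl | hk
      · rw [tl _ hk.le, hl _ (m₁ k (by lia) hk.le)]
        exact c₁.crossing k h1 hk
      · rw [tl _ le_rfl, c₁.finish, hl _ le_rfl, e₁]
        exact ⟨hv, hvH⟩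
      · rw [tr _ hk.le, hr _ (by linarith [m₂ k hk.le h2.le]), fsh]
        exact c₂.crossing k (by lia) h2
    · intro k h1 h2
      rcases le_or_gt k B with hk | hk
      · rw [tl _ hk, tl _ (by lia)]
        rintro _ ⟨τ, hτ, rfl⟩
        rw [hl _ (hτ.2.trans (m₁ k (by lia) hk))]
        exact c₁.inside k h1 hk ⟨τ, hτ, rfl⟩
      · rw [tr _ hk.le, tr _ (by lia)]
        rintro _ ⟨τ, hτ, rfl⟩
        rw [hr _ (by linarith [m₂ (k - 1) (by lia) (by lia), hτ.1])]
        refine c₂.inside k (by lia) h2 ⟨τ - 1, ⟨by linarith [hτ.1], by linarith [hτ.2]⟩, ?_⟩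
        simp only [hf]
        congr 1
        ring
  have hw : timedWeight E (A + 1) C γ t =
      timedWeight E (A + 1) B γ₁ t₁ + timedWeight E (B + 1) C γ₂ t₂ := by
    unfold timedWeight
    have hsplit : Finset.Icc (A + 1) C = Finset.Icc (A + 1) B ∪ Finset.Icc (B + 1) C := by
      ext k
      simp only [Finset.mem_union, Finset.mem_Icc]
      lia
    rw [hsplit, Finset.sum_union]
    · congr 1
      · refine Finset.sum_congr rfl fun k hk => ?_
        rw [Finset.mem_Icc] at hk
        rw [tl _ hk.2, tl _ (by lia)]
        exact pathLength_congr (c₁.mono k hk.1 hk.2) fun τ hτ =>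
          hl τ (hτ.2.le.trans (m₁ k (by lia) hk.2))
      · refine Finset.sum_congr rfl fun k hk => ?_
        rw [Finset.mem_Icc] at hk
        rw [tr _ (by lia), tr _ (by lia), pathLength_congr (γ₁ := f)
          (by linarith [c₂.mono k hk.1 hk.2])
          fun τ hτ => hr τ (by linarith [hτ.1, m₂ (k - 1) (by lia) (by lia)]), hf,
          pathLength_comp_affine _ _ _ _ _ _ (by norm_num)]
        congr 1 <;> ring
    · rw [Finset.disjoint_left]
      intro k hk hk'
      rw [Finset.mem_Icc] at hk hk'
      lia
  obtain ⟨γ₃, t₃, c₃, l₃, r₃, -, w₃⟩ := hconf.reparam (by lia)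
  refine ⟨γ₃, t₃, c₃, ?_, ?_, ?_⟩
  · rw [l₃, add_sub_cancel_right, tl _ hAB.le, c₁s, hl _ zero_le_one]
  · rw [r₃, tr _ hBC.le, c₂.finish, hr _ (by norm_num), fsh]
  · rw [w₃, hw]
    linarith

/-! ### Geodesics -/

section Geodesic

variable {g : Grid} {E : Env} {γ : ℝ → Plane} {t : ℤ → ℝ}

/-- The weight of a path between its crossings of the boundaries with the indices `A` and `B`. -/
def geoCost (g : Grid) (E : Env) (γ : ℝ → Plane) (t : ℤ → ℝ) (A B : ℤ) : ℝ :=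
  cumWeight E 1 g.M γ t (t B) - cumWeight E 1 g.M γ t (t A)

lemma geoCost_add (A B C : ℤ) :
    geoCost g E γ t A B + geoCost g E γ t B C = geoCost g E γ t A C := by
  unfold geoCost
  ring

lemma IsGeodesic.confOn (h : IsGeodesic g E γ t) : ConfOn g.n g.H 1 g.M γ t := h.2.2.1.confOn

lemma IsGeodesic.time_zero (h : IsGeodesic g E γ t) : t 0 = 0 := by
  have := h.2.2.1.start
  simpa using this

lemma IsGeodesic.time_mono (h : IsGeodesic g E γ t) {A B : ℤ} (hA : 0 ≤ A) (hAB : A ≤ B)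
    (hB : B ≤ g.M) : t A ≤ t B :=
  times_mono h.confOn.mono (by lia) hAB hB

lemma IsGeodesic.boundary (h : IsGeodesic g E γ t) (hH : 0 ≤ g.H) {A : ℤ} (hA : 0 ≤ A)
    (hAM : A ≤ g.M) : γ (t A) 0 = A * g.n ∧ |γ (t A) 1| ≤ g.H := by
  rcases hA.eq_or_lt with rfl | hA
  · rw [h.time_zero, h.1]
    simpa using hH
  rcases hAM.eq_or_lt with rfl | hAM
  · rw [h.2.2.1.finish, h.2.1]
    simpa using hH
  · exact h.confOn.crossing A (by lia) hAM

lemma IsGeodesic.eq_pt (h : IsGeodesic g E γ t) (hH : 0 ≤ g.H) {A : ℤ} (hA : 0 ≤ A)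
    (hAM : A ≤ g.M) : γ (t A) = pt (A * g.n) (γ (t A) 1) :=
  plane_ext (h.boundary hH hA hAM).1 rfl

lemma IsGeodesic.exists_restrict (h : IsGeodesic g E γ t) {A B : ℤ} (hA : 0 ≤ A)
    (hAB : A < B) (hB : B ≤ g.M) {d : ℝ} (hE : E.Regular d) :
    ∃ γ₁ t₁, IsConforming g.n g.H (A + 1) B γ₁ t₁ ∧ γ₁ 0 = γ (t A) ∧ γ₁ 1 = γ (t B) ∧
      trace γ₁ = γ '' Icc (t A) (t B) ∧
      timedWeight E (A + 1) B γ₁ t₁ = geoCost g E γ t A B := by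
  obtain ⟨τ, h1, h2, hc, hw⟩ := h.confOn.restrict (A := A + 1) (B := B) (by lia) (by lia) hB
    (s₁ := t A) (s₂ := t B) (h.time_mono hA hAB.le hB) (by simp)
    (h.time_mono hA (by lia) (by lia)) (h.time_mono (by lia) (by lia) hB) le_rfl
  obtain ⟨γ₁, t₁, c₁, l₁, r₁, tr₁, w₁⟩ := hc.reparam (by lia)
  rw [h1] at l₁
  rw [h2] at r₁
  rw [h1, h2] at tr₁
  exact ⟨γ₁, t₁, c₁, l₁, r₁, tr₁, (w₁ E).trans (hw E d hE)⟩

lemma IsGeodesic.joins (h : IsGeodesic g E γ t) {A B : ℤ} (hA : 0 ≤ A)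
    (hAB : A < B) (hB : B ≤ g.M) {d : ℝ} (hE : E.Regular d) :
    Joins g E A B (γ (t A)) (γ (t B)) (geoCost g E γ t A B) := by
  obtain ⟨γ₁, t₁, c₁, l₁, r₁, -, w₁⟩ := h.exists_restrict hA hAB hB hE
  exact ⟨γ₁, t₁, c₁, l₁, r₁, w₁.le⟩

/-- A cheaper piece could be spliced into the geodesic: the rest is attached first on the right,
then on the left. This is the only place where minimality is used. -/
lemma IsGeodesic.geoCost_le (h : IsGeodesic g E γ t) (hH : 0 ≤ g.H) {A B : ℤ} (hA : 0 ≤ A)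
    (hAB : A < B) (hB : B ≤ g.M) {d : ℝ} (hE : E.Regular d) {x : ℝ}
    (hx : Joins g E A B (γ (t A)) (γ (t B)) x) : geoCost g E γ t A B ≤ x := by
  have hM : (0 : ℤ) < g.M := by lia
  have htot : ∀ y, Joins g E 0 g.M (γ (t 0)) (γ (t g.M)) y → geoCost g E γ t 0 g.M ≤ y := by
    rintro y ⟨γ₁, t₁, c₁, l₁, r₁, w₁⟩
    rw [zero_add] at c₁ w₁
    rw [h.time_zero, h.1] at l₁
    rw [h.2.2.1.finish, h.2.1] at r₁
    have h1 := h.2.2.2 γ₁ t₁ l₁ r₁ c₁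
    have h2 : timedWeight E 1 g.M γ t = geoCost g E γ t 0 g.M := by
      unfold geoCost timedWeight cumWeight
      rw [← Finset.sum_sub_distrib]
      refine Finset.sum_congr rfl fun k hk => ?_
      rw [Finset.mem_Icc] at hk
      rw [min_eq_right (h.time_mono (by lia) hk.2 le_rfl),
        min_eq_right (h.time_mono (A := k - 1) (by lia) (by lia) le_rfl),
        min_eq_left (h.time_mono le_rfl (by lia) hk.2),
        min_eq_left (h.time_mono (B := k - 1) le_rfl (by lia) (by lia))]
      simp [pathLength]
    linarith
  have step : ∀ y, Joins g E 0 B (γ (t 0)) (γ (t B)) y → geoCost g E γ t 0 B ≤ y := by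
    intro y hy
    rcases hB.eq_or_lt with rfl | hB'
    · exact htot y hy
    · have hb := h.boundary hH (by lia : 0 ≤ B) hB
      have := htot _ (hy.trans (h.joins (by lia) hB' le_rfl hE) (by lia) hB' hb.1 hb.2)
      have e := geoCost_add (g := g) (E := E) (γ := γ) (t := t) 0 B g.M
      linarith
  rcases hA.eq_or_lt with rfl | hA'
  · exact step x hx
  · have ha := h.boundary hH hA (by lia)
    have := step _ ((h.joins le_rfl hA' (by lia) hE).trans hx hA' hAB ha.1 ha.2)
    have e := geoCost_add (g := g) (E := E) (γ := γ) (t := t) 0 A B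
    linarith

end Geodesic

/-! ### Lower bounds for the weight of a geodesic in a column -/

/-- Removes the error of order `ε` caused by the displacements in `ConfOn.exists_weight_le`. -/
lemma le_of_forall_small {A B K n : ℝ} (hn : 0 < n)
    (h : ∀ ε, 0 < ε → ε < n → A ≤ B + K * ε) : A ≤ B := by
  by_contra! hAB
  have hK : 0 < |K| + 1 := by positivity
  set ε := min (n / 2) ((A - B) / (2 * (|K| + 1))) with hε
  have h1 : 0 < ε := lt_min (by linarith) (div_pos (by linarith) (by linarith))
  have h2 : ε < n := (min_le_left _ _).trans_lt (by linarith)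
  have h3 : ε * (2 * (|K| + 1)) ≤ A - B := by
    rw [← le_div_iff₀ (by linarith)]
    exact min_le_right _ _
  have h4 := h ε h1 h2
  nlinarith [le_abs_self K]

lemma add_le_of_coe_le_sub {W : EReal} {x z c : ℝ} (h : (z : EReal) ≤ W - (c : EReal))
    (hW : W ≤ (x : EReal)) : z + c ≤ x := by
  have h1 : (z : EReal) ≤ ((x - c : ℝ) : EReal) := by
    rw [EReal.coe_sub]
    exact h.trans (EReal.sub_le_sub hW le_rfl)
  linarith [EReal.coe_le_coe_iff.1 h1]

/-- Let `s₂` be the first time at `h₂`, and `s₁` the last time at `h₁` before it. Leaving the band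
in between would produce, by the intermediate value theorem, an earlier visit to `h₂` or a later one
to `h₁`. -/
lemma exists_monotone_crossing_of_le {f : ℝ → ℝ} {τ₁ τ₂ h₁ h₂ : ℝ}
    (hτ : τ₁ ≤ τ₂) (hf : ContinuousOn f (Icc τ₁ τ₂)) (hh : h₁ < h₂) (h1 : f τ₁ = h₁)
    (h2 : f τ₂ = h₂) :
    ∃ s₁ s₂, τ₁ ≤ s₁ ∧ s₁ ≤ s₂ ∧ s₂ ≤ τ₂ ∧ f s₁ = h₁ ∧ f s₂ = h₂ ∧
      ∀ τ ∈ Icc s₁ s₂, h₁ ≤ f τ ∧ f τ ≤ h₂ := by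
  have hS : IsCompact (Icc τ₁ τ₂ ∩ f ⁻¹' {h₂}) :=
    isCompact_Icc.of_isClosed_subset
      (hf.preimage_isClosed_of_isClosed isClosed_Icc isClosed_singleton) inter_subset_left
  obtain ⟨s₂, ⟨hs₂, hfs₂⟩, hmin⟩ := hS.exists_isLeast ⟨τ₂, ⟨hτ, le_rfl⟩, h2⟩
  have hf' : ContinuousOn f (Icc τ₁ s₂) := hf.mono (Icc_subset_Icc_right hs₂.2)
  have hT : IsCompact (Icc τ₁ s₂ ∩ f ⁻¹' {h₁}) :=
    isCompact_Icc.of_isClosed_subset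
      (hf'.preimage_isClosed_of_isClosed isClosed_Icc isClosed_singleton) inter_subset_left
  obtain ⟨s₁, ⟨hs₁, hfs₁⟩, hmax⟩ := hT.exists_isGreatest ⟨τ₁, ⟨le_rfl, hs₂.1⟩, h1⟩
  refine ⟨s₁, s₂, hs₁.1, hs₁.2, hs₂.2, hfs₁, hfs₂, fun τ hτ' => ⟨?_, ?_⟩⟩
  · by_contra! hlt
    have hc : ContinuousOn f (Icc τ s₂) := hf'.mono (Icc_subset_Icc_left (hs₁.1.trans hτ'.1))
    have hfs₂' : f s₂ = h₂ := hfs₂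
    obtain ⟨c, hc1, hc2⟩ := intermediate_value_Icc hτ'.2 hc
      (⟨hlt.le, by rw [hfs₂']; exact hh.le⟩ : h₁ ∈ Icc (f τ) (f s₂))
    have := hmax ⟨⟨(hs₁.1.trans hτ'.1).trans hc1.1, hc1.2⟩, hc2⟩
    have e : c = τ := le_antisymm (this.trans hτ'.1) hc1.1
    rw [e] at hc2
    linarith
  · by_contra! hlt
    have hτ₁ : τ₁ ≤ τ := hs₁.1.trans hτ'.1
    have hc : ContinuousOn f (Icc τ₁ τ) := hf'.mono (Icc_subset_Icc_right hτ'.2)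
    obtain ⟨c, hc1, hc2⟩ := intermediate_value_Icc hτ₁ hc
      (⟨by rw [h1]; exact hh.le, hlt.le⟩ : h₂ ∈ Icc (f τ₁) (f τ))
    have := hmin ⟨⟨hc1.1, (hc1.2.trans hτ'.2).trans hs₂.2⟩, hc2⟩
    have e : c = τ := le_antisymm hc1.2 (hτ'.2.trans this)
    rw [e] at hc2
    linarith

/-- A continuous function which takes the values `h₁ < h₂` has an excursion from one to the other
between these values. -/
lemma exists_monotone_crossing {f : ℝ → ℝ} {a b τ₁ τ₂ h₁ h₂ : ℝ} (hf : ContinuousOn f (Icc a b))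
    (hτ₁ : τ₁ ∈ Icc a b) (hτ₂ : τ₂ ∈ Icc a b) (hh : h₁ < h₂) (h1 : f τ₁ = h₁) (h2 : f τ₂ = h₂) :
    ∃ s₁ s₂, a ≤ s₁ ∧ s₁ ≤ s₂ ∧ s₂ ≤ b ∧
      (f s₁ = h₁ ∧ f s₂ = h₂ ∨ f s₁ = h₂ ∧ f s₂ = h₁) ∧
      ∀ τ ∈ Icc s₁ s₂, h₁ ≤ f τ ∧ f τ ≤ h₂ := by
  rcases le_total τ₁ τ₂ with hle | hle
  · obtain ⟨s₁, s₂, e1, e2, e3, e4, e5, e6⟩ := exists_monotone_crossing_of_le hle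
      (hf.mono (Icc_subset_Icc hτ₁.1 hτ₂.2)) hh h1 h2
    exact ⟨s₁, s₂, hτ₁.1.trans e1, e2, e3.trans hτ₂.2, Or.inl ⟨e4, e5⟩, e6⟩
  · obtain ⟨s₁, s₂, e1, e2, e3, e4, e5, e6⟩ := exists_monotone_crossing_of_le (f := fun τ => -f τ)
      hle (hf.mono (Icc_subset_Icc hτ₂.1 hτ₁.2)).neg (neg_lt_neg hh)
      (by simp [h2]) (by simp [h1])
    refine ⟨s₁, s₂, hτ₂.1.trans e1, e2, e3.trans hτ₁.2, Or.inr ⟨by linarith, by linarith⟩,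
      fun τ hτ => ?_⟩
    have := e6 τ hτ
    exact ⟨by linarith, by linarith⟩

/-! ### The geodesic inside one column at scale `r` -/

/-- Non-degeneracy of the scales. -/
structure Grid.Good (g : Grid) : Prop where
  n_pos : 0 < g.n
  Qn_pos : 0 < g.Q g.n
  Qr_pos : 0 < g.Qr
  le_H : g.M * g.Wn ≤ g.H

lemma Grid.p_pos (g : Grid) : 0 < g.p := by unfold Grid.p; positivity

lemma Grid.line_eq (g : Grid) (i : ℤ) : ((i * g.p : ℤ) : ℝ) * g.n = (i : ℝ) * g.r := by
  unfold Grid.r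
  push_cast
  ring

lemma Grid.left_line_eq (g : Grid) (i : ℤ) :
    (((i - 1) * g.p : ℤ) : ℝ) * g.n = ((i : ℝ) - 1) * g.r := by
  unfold Grid.r
  push_cast
  ring

namespace Grid.Good

variable {g : Grid}

lemma r_pos (hg : g.Good) : 0 < g.r := mul_pos (by exact_mod_cast g.p_pos) hg.n_pos

lemma Wr_pos (hg : g.Good) : 0 < g.Wr := Real.sqrt_pos.2 (mul_pos hg.r_pos hg.Qr_pos)

lemma Wn_pos (hg : g.Good) : 0 < g.Wn := Real.sqrt_pos.2 (mul_pos hg.n_pos hg.Qn_pos)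

lemma Wr_sq (hg : g.Good) : g.Wr ^ 2 = g.r * g.Qr := Real.sq_sqrt (mul_pos hg.r_pos hg.Qr_pos).le

lemma Wn_sq (hg : g.Good) : g.Wn ^ 2 = g.n * g.Q g.n := Real.sq_sqrt (mul_pos hg.n_pos hg.Qn_pos).le

lemma H_nonneg (hg : g.Good) : 0 ≤ g.H :=
  (mul_nonneg (Nat.cast_nonneg _) hg.Wn_pos.le).trans hg.le_H

end Grid.Good

section Column

variable {g : Grid} {E : Env} {γ : ℝ → Plane} {t : ℤ → ℝ}

/-- The height, in units of `W_r` relative to `j`, of a path at the time `τ`. -/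
def relHeight (g : Grid) (γ : ℝ → Plane) (j τ : ℝ) : ℝ := γ τ 1 / g.Wr - j

/-- The relative height at which a path crosses the line `x = ar`. -/
def eta (g : Grid) (γ : ℝ → Plane) (t : ℤ → ℝ) (j : ℝ) (a : ℤ) : ℝ :=
  relHeight g γ j (t (a * g.p))

/-- The weight, in units of `Q_r`, of a path between the lines `x = ar` and `x = br` in excess of
the distance of these lines. -/
def excess (g : Grid) (E : Env) (γ : ℝ → Plane) (t : ℤ → ℝ) (a b : ℤ) : ℝ :=
  (geoCost g E γ t (a * g.p) (b * g.p) - ((b : ℝ) - a) * g.r) / g.Qr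

lemma excess_add (a b c : ℤ) :
    excess g E γ t a b + excess g E γ t b c = excess g E γ t a c := by
  unfold excess
  rw [← geoCost_add (a * g.p) (b * g.p) (c * g.p)]
  ring

lemma height_eq (hg : g.Good) (j τ : ℝ) : γ τ 1 = (j + relHeight g γ j τ) * g.Wr := by
  have := hg.Wr_pos.ne'
  unfold relHeight
  field_simp
  ring

/-- The time interval which a path spends in the `i`-th column at scale `r`. -/
def stay (g : Grid) (t : ℤ → ℝ) (i : ℤ) : Set ℝ := Icc (t ((i - 1) * g.p)) (t (i * g.p))

/-- A geodesic in a regular environment, together with an admissible column. -/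
structure InColumn (g : Grid) (E : Env) (d : ℝ) (γ : ℝ → Plane) (t : ℤ → ℝ) (i : ℤ) : Prop where
  good : g.Good
  geo : IsGeodesic g E γ t
  reg : E.Regular d
  one_le : 1 ≤ i
  le : i * g.p ≤ g.M

namespace InColumn

variable {d : ℝ} {i : ℤ}

lemma left_nonneg (h : InColumn g E d γ t i) : 0 ≤ (i - 1) * (g.p : ℤ) :=
  mul_nonneg (by linarith [h.one_le]) (by positivity)

lemma left_lt (_ : InColumn g E d γ t i) : (i - 1) * (g.p : ℤ) < i * g.p := by
  have : (0 : ℤ) < g.p := by exact_mod_cast g.p_pos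
  nlinarith

lemma time_le (h : InColumn g E d γ t i) : t ((i - 1) * g.p) ≤ t (i * g.p) :=
  h.geo.time_mono h.left_nonneg h.left_lt.le h.le

lemma continuousOn_relHeight (h : InColumn g E d γ t i) (j : ℝ) :
    ContinuousOn (relHeight g γ j) (stay g t i) := by
  obtain ⟨C, hC⟩ := h.geo.2.2.1.isPath
  have hsub : stay g t i ⊆ Icc 0 1 := by
    refine Icc_subset_Icc ?_ ?_
    · rw [← h.geo.time_zero]
      exact h.geo.time_mono le_rfl h.left_nonneg (h.left_lt.le.trans h.le)
    · rw [← h.geo.2.2.1.finish]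
      exact h.geo.time_mono (h.left_nonneg.trans h.left_lt.le) h.le le_rfl
  exact ((continuous_coord 1).comp_continuousOn (hC.continuousOn.mono hsub)).div_const _ |>.sub
    continuousOn_const

lemma left_point (h : InColumn g E d γ t i) :
    γ (t ((i - 1) * g.p)) = pt (((i : ℝ) - 1) * g.r) (γ (t ((i - 1) * g.p)) 1) := by
  rw [← g.left_line_eq]
  exact h.geo.eq_pt h.good.H_nonneg h.left_nonneg (h.left_lt.le.trans h.le)

lemma right_point (h : InColumn g E d γ t i) :
    γ (t (i * g.p)) = pt ((i : ℝ) * g.r) (γ (t (i * g.p)) 1) := by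
  rw [← g.line_eq]
  exact h.geo.eq_pt h.good.H_nonneg (h.left_nonneg.trans h.left_lt.le) h.le

lemma left_height (h : InColumn g E d γ t i) : |γ (t ((i - 1) * g.p)) 1| ≤ g.H :=
  (h.geo.boundary h.good.H_nonneg h.left_nonneg (h.left_lt.le.trans h.le)).2

lemma right_height (h : InColumn g E d γ t i) : |γ (t (i * g.p)) 1| ≤ g.H :=
  (h.geo.boundary h.good.H_nonneg (h.left_nonneg.trans h.left_lt.le) h.le).2

lemma mem_column (h : InColumn g E d γ t i) {τ : ℝ} (hτ : τ ∈ stay g t i) :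
    ((i : ℝ) - 1) * g.r ≤ γ τ 0 ∧ γ τ 0 ≤ i * g.r := by
  obtain ⟨k, h1, h2, h3, h4⟩ := exists_time_mem h.left_lt hτ.1 hτ.2
  have hl := h.left_nonneg
  have hle := h.le
  have := h.geo.confOn.inside k (by lia) (by lia) ⟨τ, ⟨h3, h4⟩, rfl⟩
  rw [← g.left_line_eq, ← g.line_eq]
  have c1 : (((i - 1) * g.p : ℤ) : ℝ) ≤ k - 1 := by
    exact_mod_cast (by lia : (i - 1) * (g.p : ℤ) ≤ k - 1)
  have c2 : (k : ℝ) ≤ ((i * g.p : ℤ) : ℝ) := by exact_mod_cast h2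
  exact ⟨(mul_le_mul_of_nonneg_right c1 h.good.n_pos.le).trans this.1,
    this.2.trans (mul_le_mul_of_nonneg_right c2 h.good.n_pos.le)⟩

lemma mem_rect (h : InColumn g E d γ t i) {τ : ℝ} (hτ : τ ∈ stay g t i) {j lo hi : ℝ} :
    γ τ ∈ rect g i (j + lo) (j + hi) ↔ lo ≤ relHeight g γ j τ ∧ relHeight g γ j τ ≤ hi := by
  have hc := h.mem_column hτ
  have hW := h.good.Wr_pos
  have e := height_eq (γ := γ) h.good j τ
  constructor
  · rintro ⟨-, -, h1, h2⟩
    rw [e] at h1 h2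
    have h1' := le_of_mul_le_mul_right h1 hW
    have h2' := le_of_mul_le_mul_right h2 hW
    exact ⟨by linarith, by linarith⟩
  · rintro ⟨h1, h2⟩
    refine ⟨hc.1, hc.2, ?_, ?_⟩
    · rw [e]
      gcongr
    · rw [e]
      gcongr

/-- The part of a geodesic in the column before a visit to a height controlled by `𝒦`. -/
lemma le_cumWeight_left (h : InColumn g E d γ t i) {j s z τ : ℝ} (hK : evK g E i (j + s) z)
    (hτ : τ ∈ stay g t i)
    (hs : relHeight g γ j τ = s) :
    γ τ 0 - ((i : ℝ) - 1) * g.r + 1 / 2 * (|eta g γ t j (i - 1) - s| - 1) ^ 2 * g.Qr - z * g.Qr ≤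
      cumWeight E 1 g.M γ t τ - cumWeight E 1 g.M γ t (t ((i - 1) * g.p)) := by
  -- `2 * d * ε` pays for the added horizontal segments and one `ε` for the displaced end at time
  -- `τ`; the end on the line `x = (i-1)r` stays in place.
  refine le_of_forall_small (K := 2 * d + 1) h.good.n_pos fun ε hε hεn => ?_
  obtain ⟨γ₁, x₁, x₂, e1, e2, -, e4, e5, -, e7, e8⟩ := h.geo.confOn.exists_weight_le
    h.good.n_pos (A₀ := (i - 1) * g.p) (B₀ := i * g.p) (by linarith [h.left_nonneg])
    h.left_lt h.le (s₁ := t ((i - 1) * g.p)) hτ.1 le_rfl hτ.2 hε hεn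
  have hx := e7 (γ₁ 1) ⟨1, by simp, rfl⟩
  rw [g.left_line_eq, g.line_eq, e2, pt_zero] at hx
  have hp := h.left_point
  have hx₁ := e5 (by rw [g.left_line_eq, hp, pt_zero])
  rw [hx₁, g.left_line_eq] at e1
  have hW := h.good.Wr_pos
  have hh := height_eq (γ := γ) h.good j τ
  rw [hs] at hh
  rw [hh] at e2
  have h1 := add_le_of_coe_le_sub (hK.1 x₂ _ γ₁ hx.1 hx.2.1 h.left_height e1 e2) (e8 E d h.reg)
  have h2 : |γ (t ((i - 1) * g.p)) 1 - (j + s) * g.Wr| / g.Wr = |eta g γ t j (i - 1) - s| := by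
    rw [height_eq h.good j, ← sub_mul, abs_mul, abs_of_pos hW, mul_div_cancel_right₀ _ hW.ne',
      add_sub_add_left_eq_sub]
    rfl
  rw [h2] at h1
  have h3 := (abs_le.1 e4).1
  linarith

/-- The part of a geodesic in the column after a visit to a height controlled by `𝒦`. -/
lemma le_cumWeight_right (h : InColumn g E d γ t i) {j s z τ : ℝ} (hK : evK g E i (j + s) z)
    (hτ : τ ∈ stay g t i)
    (hs : relHeight g γ j τ = s) :
    (i : ℝ) * g.r - γ τ 0 + 1 / 2 * (|eta g γ t j i - s| - 1) ^ 2 * g.Qr - z * g.Qr ≤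
      cumWeight E 1 g.M γ t (t (i * g.p)) - cumWeight E 1 g.M γ t τ := by
  refine le_of_forall_small (K := 2 * d + 1) h.good.n_pos fun ε hε hεn => ?_
  obtain ⟨γ₁, x₁, x₂, e1, e2, e3, -, -, e6, e7, e8⟩ := h.geo.confOn.exists_weight_le
    h.good.n_pos (A₀ := (i - 1) * g.p) (B₀ := i * g.p) (by linarith [h.left_nonneg])
    h.left_lt h.le (s₂ := t (i * g.p)) hτ.2 hτ.1 le_rfl hε hεn
  have hx := e7 (γ₁ 0) ⟨0, by simp, rfl⟩
  rw [g.left_line_eq, g.line_eq, e1, pt_zero] at hx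
  have hp := h.right_point
  have hx₂ := e6 (by rw [g.line_eq, hp, pt_zero])
  rw [hx₂, g.line_eq] at e2
  have hW := h.good.Wr_pos
  have hh := height_eq (γ := γ) h.good j τ
  rw [hs] at hh
  rw [hh] at e1
  have h1 := add_le_of_coe_le_sub (hK.2 x₁ _ γ₁ hx.1 hx.2.1 h.right_height e1 e2) (e8 E d h.reg)
  have h2 : |γ (t (i * g.p)) 1 - (j + s) * g.Wr| / g.Wr = |eta g γ t j i - s| := by
    rw [height_eq h.good j, ← sub_mul, abs_mul, abs_of_pos hW, mul_div_cancel_right₀ _ hW.ne',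
      add_sub_add_left_eq_sub]
    rfl
  rw [h2] at h1
  have h3 := (abs_le.1 e3).2
  linarith

/-- A part of a geodesic with a large vertical extension inside a barrier. -/
lemma le_cumWeight_mid (h : InColumn g E d γ t i) {j lo hi z w s₁ s₂ : ℝ}
    (hJ : evJ g E i (j + lo) (j + hi) z w)
    (h1 : t ((i - 1) * g.p) ≤ s₁) (hs : s₁ ≤ s₂) (h2 : s₂ ≤ t (i * g.p))
    (hb : ∀ τ ∈ Icc s₁ s₂, lo ≤ relHeight g γ j τ ∧ relHeight g γ j τ ≤ hi)
    (hw : w ≤ |relHeight g γ j s₁ - relHeight g γ j s₂|) :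
    γ s₂ 0 - γ s₁ 0 + z * g.Qr ≤ cumWeight E 1 g.M γ t s₂ - cumWeight E 1 g.M γ t s₁ := by
  -- Here both ends may be displaced.
  refine le_of_forall_small (K := 2 * d + 2) h.good.n_pos fun ε hε hεn => ?_
  obtain ⟨γ₁, x₁, x₂, e1, e2, e3, e4, -, -, e7, e8⟩ := h.geo.confOn.exists_weight_le
    h.good.n_pos (A₀ := (i - 1) * g.p) (B₀ := i * g.p) (by linarith [h.left_nonneg])
    h.left_lt h.le hs h1 h2 hε hεn
  have hW := h.good.Wr_pos
  have htr : trace γ₁ ⊆ rect g i (j + lo) (j + hi) := by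
    intro x hx
    obtain ⟨a1, a2, τ, hτ, a3⟩ := e7 x hx
    rw [g.left_line_eq] at a1
    rw [g.line_eq] at a2
    have := hb τ hτ
    refine ⟨a1, a2, ?_, ?_⟩
    · rw [a3, height_eq h.good j]
      gcongr
      exact this.1
    · rw [a3, height_eq h.good j]
      gcongr
      exact this.2
  have hv : w * g.Wr ≤ |γ₁ 0 1 - γ₁ 1 1| := by
    rw [e1, e2, pt_one, pt_one, height_eq h.good j s₁, height_eq h.good j s₂, ← sub_mul, abs_mul,
      abs_of_pos hW, add_sub_add_left_eq_sub]
    gcongr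
  have h3 := add_le_of_coe_le_sub (hJ γ₁ htr hv) (e8 E d h.reg)
  rw [e1, e2, pt_zero, pt_zero] at h3
  have h4 := neg_abs_le (x₁ - x₂)
  have h5 := (abs_le.1 e3).2
  have h6 := (abs_le.1 e4).1
  linarith

lemma excess_eq (h : InColumn g E d γ t i) : excess g E γ t (i - 1) i * g.Qr =
    cumWeight E 1 g.M γ t (t (i * g.p)) - cumWeight E 1 g.M γ t (t ((i - 1) * g.p)) - g.r := by
  have := h.good.Qr_pos.ne'
  unfold excess geoCost
  rw [div_mul_cancel₀ _ this]
  push_cast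
  ring

/-- The two halves of `𝒦` apply before and after the visit, and the abscissa of the visited point
cancels. -/
lemma excess_ge_of_hit (h : InColumn g E d γ t i) {j s z : ℝ} (hK : evK g E i (j + s) z)
    (hs : ∃ τ ∈ stay g t i, relHeight g γ j τ = s) :
    1 / 2 * (|eta g γ t j (i - 1) - s| - 1) ^ 2 + 1 / 2 * (|eta g γ t j i - s| - 1) ^ 2 - 2 * z ≤
      excess g E γ t (i - 1) i := by
  obtain ⟨τ, hτ, hs⟩ := hs
  have h1 := h.le_cumWeight_left hK hτ hs
  have h2 := h.le_cumWeight_right hK hτ hs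
  have h3 := h.excess_eq
  refine le_of_mul_le_mul_right ?_ h.good.Qr_pos
  linarith

/-- The geodesic is cut at the ends of an excursion between `h₁` and `h₂` which stays between them.
`𝒥` bounds the excursion, and `𝒦` bounds the two outer pieces, whose squares are dropped. The
direction of the excursion is immaterial. -/
lemma excess_ge_of_barrier (h : InColumn g E d γ t i) {j h₁ h₂ lo hi z zJ w : ℝ} (hh : h₁ < h₂)
    (hK₁ : evK g E i (j + h₁) z)
    (hK₂ : evK g E i (j + h₂) z) (hJ : evJ g E i (j + lo) (j + hi) zJ w) (hlo : lo ≤ h₁)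
    (hhi : h₂ ≤ hi) (hw : w ≤ h₂ - h₁) (hit₁ : ∃ τ ∈ stay g t i, relHeight g γ j τ = h₁)
    (hit₂ : ∃ τ ∈ stay g t i, relHeight g γ j τ = h₂) :
    zJ - 2 * z ≤ excess g E γ t (i - 1) i := by
  obtain ⟨τ₁, hτ₁, e₁⟩ := hit₁
  obtain ⟨τ₂, hτ₂, e₂⟩ := hit₂
  obtain ⟨s₁, s₂, a1, a2, a3, a4, a5⟩ :=
    exists_monotone_crossing (h.continuousOn_relHeight j) hτ₁ hτ₂ hh e₁ e₂
  have m₁ : s₁ ∈ stay g t i := ⟨a1, a2.trans a3⟩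
  have m₂ : s₂ ∈ stay g t i := ⟨a1.trans a2, a3⟩
  have hmid := h.le_cumWeight_mid hJ a1 a2 a3
    (fun τ hτ => ⟨hlo.trans (a5 τ hτ).1, (a5 τ hτ).2.trans hhi⟩) (by
      rcases a4 with ⟨b1, b2⟩ | ⟨b1, b2⟩
      · rw [b1, b2, abs_sub_comm]
        exact hw.trans (le_abs_self _)
      · rw [b1, b2]
        exact hw.trans (le_abs_self _))
  have hex := h.excess_eq
  have hQ := h.good.Qr_pos
  have key : ∀ u v, relHeight g γ j s₁ = u → relHeight g γ j s₂ = v → evK g E i (j + u) z →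
      evK g E i (j + v) z → zJ - 2 * z ≤ excess g E γ t (i - 1) i := by
    intro u v hu hv hKu hKv
    have c1 := h.le_cumWeight_left hKu m₁ hu
    have c2 := h.le_cumWeight_right hKv m₂ hv
    have c3 : 0 ≤ 1 / 2 * (|eta g γ t j (i - 1) - u| - 1) ^ 2 * g.Qr := by positivity
    have c4 : 0 ≤ 1 / 2 * (|eta g γ t j i - v| - 1) ^ 2 * g.Qr := by positivity
    refine le_of_mul_le_mul_right ?_ hQ
    linarith
  rcases a4 with ⟨b1, b2⟩ | ⟨b1, b2⟩
  · exact key _ _ b1 b2 hK₁ hK₂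
  · exact key _ _ b1 b2 hK₂ hK₁

/-- The part of a geodesic in the column as a path of its own. -/
lemma exists_path (h : InColumn g E d γ t i) : ∃ γ₁ : ℝ → Plane,
    γ₁ 0 = γ (t ((i - 1) * g.p)) ∧ γ₁ 1 = γ (t (i * g.p)) ∧
    trace γ₁ = segment g i γ t ∧
    weight g E γ₁ ≤ ((g.r + excess g E γ t (i - 1) i * g.Qr : ℝ) : EReal) := by
  obtain ⟨γ₁, t₁, c₁, l₁, r₁, tr₁, w₁⟩ :=
    h.geo.exists_restrict h.left_nonneg h.left_lt h.le h.reg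
  refine ⟨γ₁, l₁, r₁, tr₁, ?_⟩
  have hu : γ₁ 0 0 = ((i - 1) * g.p : ℤ) * g.n := by
    rw [l₁, h.left_point, g.left_line_eq, pt_zero]
  have hv : γ₁ 1 0 = (i * g.p : ℤ) * g.n := by
    rw [r₁, h.right_point, g.line_eq, pt_zero]
  refine (weight_le_timedWeight (columnRange_boundary h.good.n_pos h.left_lt hu hv) c₁).trans
    (EReal.coe_le_coe_iff.2 ?_)
  rw [w₁, h.excess_eq, geoCost]
  linarith

/-- `W_r ^ 2 = r Q_r` turns the quadratic term of the centring into a pure number times `Q_r`. -/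
lemma centring_eq (h : InColumn g E d γ t i) (j : ℝ) :
    centring (γ (t ((i - 1) * g.p))) (γ (t (i * g.p))) =
      g.r + (eta g γ t j i - eta g γ t j (i - 1)) ^ 2 / 2 * g.Qr := by
  have hW := h.good.Wr_sq
  have hr := h.good.r_pos.ne'
  rw [h.left_point, h.right_point, centring]
  simp only [pt_zero, pt_one]
  rw [height_eq h.good j (t (i * g.p)), height_eq h.good j (t ((i - 1) * g.p))]
  change _ = g.r + (relHeight g γ j (t (i * g.p)) - relHeight g γ j (t ((i - 1) * g.p))) ^ 2 / 2 *
    g.Qr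
  generalize relHeight g γ j (t (i * g.p)) = x
  generalize relHeight g γ j (t ((i - 1) * g.p)) = y
  have e1 : (i : ℝ) * g.r - ((i : ℝ) - 1) * g.r = g.r := by ring
  have e2 : ((j + x) * g.Wr - (j + y) * g.Wr) ^ 2 = (x - y) ^ 2 * (g.r * g.Qr) := by
    rw [← hW]
    ring
  rw [e1, e2]
  field_simp

lemma trace_subset_iff (h : InColumn g E d γ t i) {j lo hi : ℝ} :
    segment g i γ t ⊆ rect g i (j + lo) (j + hi) ↔
    ∀ τ ∈ stay g t i, lo ≤ relHeight g γ j τ ∧ relHeight g γ j τ ≤ hi :=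
  ⟨fun hs τ hτ => (h.mem_rect hτ).1 (hs ⟨τ, hτ, rfl⟩), by
    rintro hs _ ⟨τ, hτ, rfl⟩
    exact (h.mem_rect hτ).2 (hs τ hτ)⟩

lemma left_mem_stay (h : InColumn g E d γ t i) : t ((i - 1) * g.p) ∈ stay g t i :=
  ⟨le_rfl, h.time_le⟩

lemma right_mem_stay (h : InColumn g E d γ t i) : t (i * g.p) ∈ stay g t i := ⟨h.time_le, le_rfl⟩

lemma crossesColumn (h : InColumn g E d γ t i) {γ₁ : ℝ → Plane} (h0 : γ₁ 0 = γ (t ((i - 1) * g.p)))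
    (h1 : γ₁ 1 = γ (t (i * g.p))) {j lo hi : ℝ}
    (hl : lo ≤ eta g γ t j (i - 1) ∧ eta g γ t j (i - 1) ≤ hi)
    (hr : lo ≤ eta g γ t j i ∧ eta g γ t j i ≤ hi) :
    CrossesColumn g i (j + lo) (j + hi) γ₁ := by
  have m1 := ((h.mem_rect h.left_mem_stay).2 hl).2.2
  have m2 := ((h.mem_rect h.right_mem_stay).2 hr).2.2
  exact ⟨_, m1, _, m2, h0.trans h.left_point, h1.trans h.right_point⟩

lemma excess_ge_of_subset (h : InColumn g E d γ t i) {j lo hi z : ℝ}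
    (hI : evIplus g E i (j + lo) (j + hi) z)
    (hs : ∀ τ ∈ stay g t i, lo ≤ relHeight g γ j τ ∧ relHeight g γ j τ ≤ hi) :
    (eta g γ t j i - eta g γ t j (i - 1)) ^ 2 / 2 + z ≤ excess g E γ t (i - 1) i := by
  obtain ⟨γ₁, h0, h1, htr, hw⟩ := h.exists_path
  have hc := h.crossesColumn h0 h1 (hs _ h.left_mem_stay) (hs _ h.right_mem_stay)
  have hle : ((z * g.Qr : ℝ) : EReal) ≤ hatWeight g E γ₁ :=
    hI.trans (iInf_le_of_le γ₁ (iInf_le_of_le hc (iInf_le_of_le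
      (by rw [htr]; exact h.trace_subset_iff.2 hs) le_rfl)))
  have := add_le_of_coe_le_sub hle hw
  rw [h0, h1, h.centring_eq j] at this
  refine le_of_mul_le_mul_right ?_ h.good.Qr_pos
  linarith

lemma excess_ge_of_exit (h : InColumn g E d γ t i) {j L₀ : ℝ} (hX : evExit g E i j L₀)
    (hl : -(L₀ / 4) ≤ eta g γ t j (i - 1) ∧ eta g γ t j (i - 1) ≤ L₀ / 4)
    (hr : -(L₀ / 4) ≤ eta g γ t j i ∧ eta g γ t j i ≤ L₀ / 4)
    (hs : ∀ τ ∈ stay g t i,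
      -(3 / 2 * L₀) ≤ relHeight g γ j τ ∧ relHeight g γ j τ ≤ 3 / 2 * L₀)
    (hs' : ¬ ∀ τ ∈ stay g t i, -(L₀ / 2) ≤ relHeight g γ j τ ∧ relHeight g γ j τ ≤ L₀ / 2) :
    1 / 40 * L₀ ^ 2 ≤ excess g E γ t (i - 1) i := by
  obtain ⟨γ₁, h0, h1, htr, hw⟩ := h.exists_path
  have hc := h.crossesColumn h0 h1 hl hr
  rw [← h.trace_subset_iff, ← htr] at hs hs'
  have := (hX γ₁ hc hs hs').trans hw
  have := EReal.coe_le_coe_iff.1 this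
  refine le_of_mul_le_mul_right ?_ h.good.Qr_pos
  linarith

end InColumn

end Column

/-! ### Passage between the lines `x = ar` -/

/-- The point on the line `x = ar` at the relative height `η`. -/
def linePt (g : Grid) (j : ℝ) (a : ℤ) (η : ℝ) : Plane := pt (a * g.r) ((j + η) * g.Wr)

/-- There are conforming paths from `linePt g j a η` to `linePt g j b η'` whose weight, in units of
`Q_r`, in excess of the distance of the lines is at most `x`, or exceeds `x` by arbitrarily
little. -/
def Reach (g : Grid) (E : Env) (j : ℝ) (a b : ℤ) (η η' x : ℝ) : Prop :=
  ∀ ε : ℝ, 0 < ε → Joins g E (a * g.p) (b * g.p) (linePt g j a η) (linePt g j b η')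
    (((b : ℝ) - a) * g.r + (x + ε) * g.Qr)

/-- A geodesic in a regular environment. -/
structure GeoSetup (g : Grid) (E : Env) (d : ℝ) (γ : ℝ → Plane) (t : ℤ → ℝ) : Prop where
  good : g.Good
  geo : IsGeodesic g E γ t
  reg : E.Regular d

variable {g : Grid} {E : Env} {d : ℝ} {γ : ℝ → Plane} {t : ℤ → ℝ} {j : ℝ} {a b c : ℤ}
  {η η' η'' x y z : ℝ}

lemma Grid.line_lt (g : Grid) (hab : a < b) : a * (g.p : ℤ) < b * g.p :=
  mul_lt_mul_of_pos_right hab (by exact_mod_cast g.p_pos)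

lemma linePt_zero : linePt g j a η 0 = ((a * g.p : ℤ) : ℝ) * g.n := by
  rw [g.line_eq]
  rfl

lemma Reach.mono (h : Reach g E j a b η η' x) (hg : g.Good) (hxy : x ≤ y) :
    Reach g E j a b η η' y := by
  intro ε hε
  obtain ⟨γ, t, h1, h2, h3, h4⟩ := h ε hε
  refine ⟨γ, t, h1, h2, h3, h4.trans ?_⟩
  have := hg.Qr_pos
  gcongr

lemma Reach.trans (h₁ : Reach g E j a b η η' x) (h₂ : Reach g E j b c η' η'' y)
    (hab : a < b) (hbc : b < c) (hH : |(j + η') * g.Wr| ≤ g.H) :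
    Reach g E j a c η η'' (x + y) := by
  intro ε hε
  have := (h₁ (ε / 2) (by linarith)).trans (h₂ (ε / 2) (by linarith)) (g.line_lt hab)
    (g.line_lt hbc) linePt_zero hH
  convert this using 1
  ring

lemma centring_linePt (hg : g.Good) (hab : a < b) :
    centring (linePt g j a η) (linePt g j b η') =
      ((b : ℝ) - a) * g.r + (η' - η) ^ 2 / (2 * (b - a)) * g.Qr := by
  have hab' : (b : ℝ) - a ≠ 0 := by
    have : (a : ℝ) < b := by exact_mod_cast hab
    linarith
  have hr := hg.r_pos.ne'
  simp only [centring, linePt, pt_zero, pt_one]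
  have e2 : ((j + η') * g.Wr - (j + η) * g.Wr) ^ 2 = (η' - η) ^ 2 * (g.r * g.Qr) := by
    rw [← hg.Wr_sq]
    ring
  rw [e2, ← sub_mul]
  field_simp

/-- An infimum only provides paths up to an arbitrarily small loss, which is why `Reach` carries an
`ε`. -/
lemma reach_of_hatDist_le (hg : g.Good) (hab : a < b)
    (h : hatDist g E (linePt g j a η) (linePt g j b η') ≤ ((z * g.Qr : ℝ) : EReal)) :
    Reach g E j a b η η' ((η' - η) ^ 2 / (2 * (b - a)) + z) := by
  intro ε hε
  have hQ := hg.Qr_pos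
  have hlt : hatDist g E (linePt g j a η) (linePt g j b η') <
      (((z + ε) * g.Qr : ℝ) : EReal) := by
    refine h.trans_lt (EReal.coe_lt_coe_iff.2 ?_)
    gcongr
    linarith
  unfold hatDist at hlt
  simp only [iInf_lt_iff] at hlt
  obtain ⟨γ₁, h0, h1, hw⟩ := hlt
  rw [hatWeight, h0, h1, centring_linePt hg hab] at hw
  have hw' := (EReal.sub_lt_iff (Or.inl (EReal.coe_ne_bot _)) (Or.inl (EReal.coe_ne_top _))).1 hw
  rw [← EReal.coe_add] at hw'
  have := joins_of_weight_lt hg.n_pos (g.line_lt hab) (by rw [h0, linePt_zero])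
    (by rw [h1, linePt_zero]) hw'
  rw [h0, h1] at this
  convert this using 1
  ring

lemma Joins.le_of_le_hatDist (hg : g.Good) (hab : a < b)
    (h : ((z * g.Qr : ℝ) : EReal) ≤ hatDist g E (linePt g j a η) (linePt g j b η'))
    (hx : Joins g E (a * g.p) (b * g.p) (linePt g j a η) (linePt g j b η')
      (((b : ℝ) - a) * g.r + x * g.Qr)) : (η' - η) ^ 2 / (2 * (b - a)) + z ≤ x := by
  obtain ⟨γ₁, h0, h1, hw⟩ := hx.exists_weight_le hg.n_pos (g.line_lt hab) linePt_zero linePt_zero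
  have h2 : ((z * g.Qr : ℝ) : EReal) ≤ hatWeight g E γ₁ :=
    h.trans (iInf_le_of_le γ₁ (iInf_le_of_le h0 (iInf_le_of_le h1 le_rfl)))
  have h3 := add_le_of_coe_le_sub h2 hw
  rw [h0, h1, centring_linePt hg hab] at h3
  refine le_of_mul_le_mul_right ?_ hg.Qr_pos
  linarith

namespace GeoSetup

lemma inColumn (h : GeoSetup g E d γ t) {i : ℤ} (h1 : 1 ≤ i) (h2 : i * g.p ≤ g.M) :
    InColumn g E d γ t i := ⟨h.good, h.geo, h.reg, h1, h2⟩

lemma eq_linePt (h : GeoSetup g E d γ t) (ha : 0 ≤ a) (hM : a * g.p ≤ g.M) :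
    γ (t (a * g.p)) = linePt g j a (eta g γ t j a) := by
  rw [h.geo.eq_pt h.good.H_nonneg (by positivity) hM, g.line_eq, height_eq h.good j]
  rfl

lemma abs_eta_le (h : GeoSetup g E d γ t) (ha : 0 ≤ a) (hM : a * g.p ≤ g.M) :
    |(j + eta g γ t j a) * g.Wr| ≤ g.H := by
  have := (h.geo.boundary h.good.H_nonneg (by positivity) hM).2
  rwa [height_eq h.good j] at this

lemma excess_joins (h : GeoSetup g E d γ t) (ha : 0 ≤ a) (hab : a < b) (hM : b * g.p ≤ g.M) :
    Joins g E (a * g.p) (b * g.p) (linePt g j a (eta g γ t j a)) (linePt g j b (eta g γ t j b))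
      (((b : ℝ) - a) * g.r + excess g E γ t a b * g.Qr) := by
  have hlt := g.line_lt hab
  have := h.geo.joins (by positivity) hlt hM h.reg
  rw [h.eq_linePt (j := j) ha (hlt.le.trans hM), h.eq_linePt (j := j) (ha.trans hab.le) hM] at this
  convert this using 1
  have := h.good.Qr_pos.ne'
  unfold excess
  field_simp
  ring

/-- The form in which optimality is used from here on: every competitor between two crossing points
of the geodesic bounds its excess. -/
lemma excess_le (h : GeoSetup g E d γ t) (ha : 0 ≤ a) (hab : a < b) (hM : b * g.p ≤ g.M)
    (hx : Reach g E j a b (eta g γ t j a) (eta g γ t j b) x) : excess g E γ t a b ≤ x := by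
  have hlt := g.line_lt hab
  refine le_of_forall_pos_le_add fun ε hε => ?_
  have h1 := hx ε hε
  rw [← h.eq_linePt ha (hlt.le.trans hM), ← h.eq_linePt (ha.trans hab.le) hM] at h1
  have h2 := h.geo.geoCost_le h.good.H_nonneg (by positivity) hlt hM h.reg h1
  unfold excess
  rw [div_le_iff₀ h.good.Qr_pos]
  linarith

lemma le_excess (h : GeoSetup g E d γ t) (ha : 0 ≤ a) (hab : a < b) (hM : b * g.p ≤ g.M)
    (hz : ((z * g.Qr : ℝ) : EReal) ≤
      hatDist g E (linePt g j a (eta g γ t j a)) (linePt g j b (eta g γ t j b))) :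
    (eta g γ t j b - eta g γ t j a) ^ 2 / (2 * (b - a)) + z ≤ excess g E γ t a b :=
  Joins.le_of_le_hatDist h.good hab hz (h.excess_joins ha hab hM)

end GeoSetup

/-! ### Bounds from the elementary events -/

lemma linePt_left {i : ℤ} : linePt g j (i - 1) η = pt (((i : ℝ) - 1) * g.r) ((j + η) * g.Wr) := by
  unfold linePt
  push_cast
  rfl

lemma abs_sub_div (hg : g.Good) (j η : ℝ) : |(j + η) * g.Wr - j * g.Wr| / g.Wr = |η| := by
  have hW := hg.Wr_pos
  rw [← sub_mul, add_sub_cancel_left, abs_mul, abs_of_pos hW, mul_div_cancel_right₀ _ hW.ne']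

lemma evAminus.reach {i : ℤ} (h : evAminus g E i j z) (hg : g.Good)
    (hη : |(j + η) * g.Wr| ≤ g.M * g.Wn) (hη' : |(j + η') * g.Wr| ≤ g.M * g.Wn) :
    Reach g E j (i - 1) i η η' ((η' - η) ^ 2 / 2 + |η| + |η'| + z) := by
  have h1 := h _ _ hη hη'
  rw [add_div, abs_sub_div hg, abs_sub_div hg, ← add_mul, ← linePt_left] at h1
  have := reach_of_hatDist_le hg (by lia) h1
  convert this using 1
  push_cast
  ring

lemma evAplus.le_excess {i : ℤ} (h : evAplus g E i j z) (hs : GeoSetup g E d γ t) (hi : 1 ≤ i)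
    (hM : i * g.p ≤ g.M) :
    (eta g γ t j i - eta g γ t j (i - 1)) ^ 2 / 2 - |eta g γ t j (i - 1)| - |eta g γ t j i| - z ≤
      excess g E γ t (i - 1) i := by
  have hM' : (i - 1) * g.p ≤ g.M := (g.line_lt (by lia : i - 1 < i)).le.trans hM
  have h1 := h _ _ (hs.abs_eta_le (j := j) (by lia : 0 ≤ i - 1) hM')
    (hs.abs_eta_le (j := j) (by lia : 0 ≤ i) hM)
  rw [add_div, abs_sub_div hs.good, abs_sub_div hs.good, ← sub_mul, ← linePt_left] at h1
  have h2 := hs.le_excess (by lia) (by lia) hM h1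
  push_cast at h2
  rw [sub_sub_cancel, mul_one] at h2
  linarith

/-- The added `1` exceeds the infimum strictly, so that one path with definite end heights can be
chosen; nothing is known about these except that they lie in the opening. -/
lemma evIminus.exists_reach {i : ℤ} {lo hi : ℝ} (h : evIminus g E i (j + lo) (j + hi) z)
    (hg : g.Good) : ∃ η ∈ Icc lo hi, ∃ η' ∈ Icc lo hi,
      Reach g E j (i - 1) i η η' ((η' - η) ^ 2 / 2 + z + 1) := by
  have hQ := hg.Qr_pos
  have hW := hg.Wr_pos
  have hlt : sideToSide g E i (j + lo) (j + hi) (j + lo) (j + hi) <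
      (((z + 1) * g.Qr : ℝ) : EReal) := by
    refine h.trans_lt (EReal.coe_lt_coe_iff.2 ?_)
    gcongr
    linarith
  unfold sideToSide at hlt
  simp only [iInf_lt_iff] at hlt
  obtain ⟨γ₁, ⟨u, hu, v, hv, h0, h1⟩, -, hw⟩ := hlt
  have key : ∀ u, u ∈ Icc ((j + lo) * g.Wr) ((j + hi) * g.Wr) →
      ∃ η ∈ Icc lo hi, u = (j + η) * g.Wr := by
    intro u hu
    refine ⟨u / g.Wr - j, ⟨?_, ?_⟩, ?_⟩
    · have := (le_div_iff₀ hW).2 hu.1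
      linarith
    · have := (div_le_iff₀ hW).2 hu.2
      linarith
    · field_simp
      ring
  obtain ⟨η, hη, rfl⟩ := key u hu
  obtain ⟨η', hη', rfl⟩ := key v hv
  refine ⟨η, hη, η', hη', ?_⟩
  rw [← linePt_left] at h0
  have h2 : hatDist g E (linePt g j (i - 1) η) (linePt g j i η') ≤ hatWeight g E γ₁ :=
    iInf_le_of_le γ₁ (iInf_le_of_le h0 (iInf_le_of_le h1 le_rfl))
  have := reach_of_hatDist_le hg (by lia) (h2.trans hw.le)
  convert this using 1
  push_cast
  ring

/-- The error allowed by `𝒵_{i,j,k}`, in units of `Q_r`. -/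
def zErr (L : ℝ) (k : ℕ) (η η' : ℝ) : ℝ :=
  (|η| ^ (1 / 100 : ℝ) + |η'| ^ (1 / 100 : ℝ)) / (2 ^ k * L ^ 2) + (2 ^ k * L) ^ (3 / 5 : ℝ)

/-- The condition of `𝒵` on the passage times from `x = ar` to `x = br`, for one environment. -/
def ZBound (g : Grid) (E : Env) (L : ℝ) (j : ℝ) (a b : ℤ) (k : ℕ) : Prop :=
  ∀ η η' : ℝ, |(j + η) * g.Wr| ≤ g.M * g.Wn → |(j + η') * g.Wr| ≤ g.M * g.Wn →
    (((-zErr L k η η') * g.Qr : ℝ) : EReal) ≤ hatDist g E (linePt g j a η) (linePt g j b η') ∧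
    hatDist g E (linePt g j a η) (linePt g j b η') ≤ ((zErr L k η η' * g.Qr : ℝ) : EReal)

lemma evZ.zBound {c : Consts} {Ψ Ψ' : Env} {i i' : ℤ} {k : ℕ} (h : evZ g c Ψ Ψ' i j k)
    (hg : g.Good) (hi' : i' = i + 2 ^ k * c.L₂) :
    ZBound g Ψ c.L₂ j i i' k ∧ ZBound g Ψ' c.L₂ j i i' k := by
  have hW := hg.Wr_pos
  have e : ∀ η : ℝ, (j + η) * g.Wr / g.Wr - j = η := fun η => by
    rw [mul_div_cancel_right₀ _ hW.ne', add_sub_cancel_left]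
  have e2 : ∀ η' : ℝ, linePt g j i' η' =
      pt (((i : ℝ) + 2 ^ k * (c.L₂ : ℝ)) * g.r) ((j + η') * g.Wr) := fun η' => by
    rw [hi', linePt]
    push_cast
    rfl
  have key : ∀ η η' : ℝ, zErr c.L₂ k η η' * g.Qr =
      (|η| ^ (1 / 100 : ℝ) + |η'| ^ (1 / 100 : ℝ)) * (g.Qr / (2 ^ k * (c.L₂ : ℝ) ^ 2)) +
        (2 ^ k * (c.L₂ : ℝ)) ^ (3 / 5 : ℝ) * g.Qr := fun η η' => by
    unfold zErr
    ring
  constructor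
  · intro η η' h1 h2
    have := h.1 _ _ h1 h2
    simp only [e] at this
    rw [neg_mul, key, e2]
    exact this
  · intro η η' h1 h2
    have := h.2 _ _ h1 h2
    simp only [e] at this
    rw [neg_mul, key, e2]
    exact this

lemma ZBound.le_excess {L : ℝ} {k : ℕ} (h : ZBound g E L j a b k) (hs : GeoSetup g E d γ t)
    (ha : 0 ≤ a) (hab : a < b) (hM : b * g.p ≤ g.M)
    (h1 : |(j + eta g γ t j a) * g.Wr| ≤ g.M * g.Wn)
    (h2 : |(j + eta g γ t j b) * g.Wr| ≤ g.M * g.Wn) :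
    (eta g γ t j b - eta g γ t j a) ^ 2 / (2 * (b - a)) -
      zErr L k (eta g γ t j a) (eta g γ t j b) ≤ excess g E γ t a b := by
  have := hs.le_excess ha hab hM (h _ _ h1 h2).1
  linarith

lemma ZBound.reach {L : ℝ} {k : ℕ} (h : ZBound g E L j a b k) (hg : g.Good) (hab : a < b)
    (h1 : |(j + η) * g.Wr| ≤ g.M * g.Wn) (h2 : |(j + η') * g.Wr| ≤ g.M * g.Wn) :
    Reach g E j a b η η' ((η' - η) ^ 2 / (2 * (b - a)) + zErr L k η η') :=
  reach_of_hatDist_le hg hab (h _ _ h1 h2).2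

/-! ### Geodesics in the central and in the outer columns -/

section Columns

variable {g : Grid} {E : Env} {d : ℝ} {γ : ℝ → Plane} {t : ℤ → ℝ} {i : ℤ} {j : ℝ}

namespace InColumn

lemma exists_hit (h : InColumn g E d γ t i) {s τ₁ τ₂ : ℝ} (h1 : τ₁ ∈ stay g t i)
    (h2 : τ₂ ∈ stay g t i) (e1 : relHeight g γ j τ₁ ≤ s) (e2 : s ≤ relHeight g γ j τ₂) :
    ∃ τ ∈ stay g t i, relHeight g γ j τ = s :=
  isPreconnected_Icc.intermediate_value h1 h2 (h.continuousOn_relHeight j) ⟨e1, e2⟩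

/-- Either the geodesic pays for a passage through the barrier, or it stays on one side of it. -/
lemma barrier_dichotomy (h : InColumn g E d γ t i) {h₁ h₂ lo hi z zJ w : ℝ} (hh : h₁ < h₂)
    (hK₁ : evK g E i (j + h₁) z) (hK₂ : evK g E i (j + h₂) z)
    (hJ : evJ g E i (j + lo) (j + hi) zJ w) (hlo : lo ≤ h₁) (hhi : h₂ ≤ hi) (hw : w ≤ h₂ - h₁) :
    (zJ - 2 * z ≤ excess g E γ t (i - 1) i ∧ ∃ τ ∈ stay g t i, relHeight g γ j τ = h₁) ∨
      (∀ τ ∈ stay g t i, h₁ < relHeight g γ j τ) ∨ (∀ τ ∈ stay g t i, relHeight g γ j τ < h₂) := by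
  by_contra! hcon
  obtain ⟨hc, ⟨τ₁, m₁, e₁⟩, ⟨τ₂, m₂, e₂⟩⟩ := hcon
  have hit₁ := h.exists_hit m₁ m₂ e₁ (hh.le.trans e₂)
  have hit₂ := h.exists_hit m₁ m₂ (e₁.trans hh.le) e₂
  obtain ⟨τ, hτ, hτ'⟩ := hit₁
  exact hc (h.excess_ge_of_barrier hh hK₁ hK₂ hJ hlo hhi hw ⟨τ, hτ, hτ'⟩ hit₂) τ hτ hτ'

end InColumn

/-- The conditions of `ℬ_{i,j}` on the central column that are common to both environments. -/
structure CenterOK (g : Grid) (c : Consts) (E : Env) (i : ℤ) (j : ℝ) : Prop where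
  opening : evIminus g E i (j + -(c.L₀ / 40)) (j + c.L₀ / 40) c.L₀
  exit : evExit g E i j c.L₀
  middle : evIplus g E i (j + -(3 / 2 * c.L₀)) (j + 3 / 2 * c.L₀) (-c.L₀)
  bottom : evIplus g E i (j + (-c.L₁ - 1)) (j + (-c.L₁ + 1)) (-c.L₀)
  top : evIplus g E i (j + (c.L₁ - 1)) (j + (c.L₁ + 1)) (-c.L₀)
  level : ∀ s ∈ ({-(c.L₁ : ℝ), -(c.L₁ : ℝ) + c.w, -√c.α - 2 * c.w / 3,
      -√c.α + c.h + 2 * c.w / 3, -(3 / 2 * c.L₀), 3 / 2 * c.L₀, (c.L₁ : ℝ) - c.w,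
      (c.L₁ : ℝ)} : Set ℝ), evKstar g E i (j + s) c.L₁ c.w
  lower : evBarrier g c i E (j + (-c.L₁ + 2 / g.Wr)) (j + (-√c.α - 2 / g.Wr)) ((c.L₂ : ℝ) ^ 2)
  mid : evBarrier g c i E (j + (-√c.α + c.h + 2 / g.Wr)) (j + (-c.L₀ - 2 / g.Wr))
    ((c.L₂ : ℝ) ^ 2)
  upper : evBarrier g c i E (j + (c.L₀ + 2 / g.Wr)) (j + (c.L₁ - 2 / g.Wr)) ((c.L₂ : ℝ) ^ 2)

lemma evB.centerOK {c : Consts} {Ψ Ψ' : Env} (h : evB g c Ψ Ψ' i j) :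
    CenterOK g c Ψ i j ∧ CenterOK g c Ψ' i j := by
  obtain ⟨h1, h2, h3, -, -, h6, h7⟩ := h
  constructor
  · refine ⟨?_, h2.1.1, ?_, ?_, ?_, h6.1, ?_, ?_, ?_⟩
    · convert h1.1 using 1
      ring
    · convert h2.1.2 using 1
      ring
    · convert h3.1.1 using 1 <;> ring
    · convert h3.1.2 using 1 <;> ring
    · convert h7.1.1 using 1 <;> ring
    · convert h7.1.2.1 using 1 <;> ring
    · convert h7.1.2.2 using 1 <;> ring
  · refine ⟨?_, h2.2.1, ?_, ?_, ?_, h6.2, ?_, ?_, ?_⟩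
    · convert h1.2 using 1
      ring
    · convert h2.2.2 using 1
      ring
    · convert h3.2.1 using 1 <;> ring
    · convert h3.2.2 using 1 <;> ring
    · convert h7.2.1 using 1 <;> ring
    · convert h7.2.2.1 using 1 <;> ring
    · convert h7.2.2.2 using 1 <;> ring

/-- The order relations between the parameters of the construction. -/
structure Consts.Good (c : Consts) (g : Grid) : Prop where
  w_pos : 0 < c.w
  w_le : c.w ≤ 1 / 4
  h_ge : 1 ≤ c.h
  h_le : c.h ≤ 3 / 2
  L₀_ge : 10000 ≤ c.L₀
  α_ge : 4 * c.L₀ ≤ √c.α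
  L₁_ge : 4 * √c.α ≤ c.L₁
  Wr_ge : 2 / g.Wr ≤ c.w / 3

lemma Consts.L₁_le_L₂ (c : Consts) : (c.L₁ : ℝ) ≤ c.L₂ := by
  unfold Consts.L₂
  exact_mod_cast Nat.le_self_pow (by norm_num) _

/-- Replaces the cost of reaching an unspecified level `s` by a quantity that depends only on a
bound for `|s|`. -/
lemma sq_max_le {a s L : ℝ} (hs : |s| ≤ L + 1) :
    (max (|a| - L - 2) 0) ^ 2 ≤ (|a - s| - 1) ^ 2 := by
  rcases le_total (|a| - L - 2) 0 with h | h
  · rw [max_eq_right h, zero_pow two_ne_zero]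
    positivity
  · rw [max_eq_left h]
    have := abs_sub_abs_le_abs_sub a s
    exact pow_le_pow_left₀ h (by linarith) 2

/-- A geodesic which is neither of Type 3 nor of Type 6 stays near the middle of the central
column, or passes through a barrier, or stays at distance about `L₁` from the middle. -/
lemma CenterOK.alternatives {c : Consts} (hc : CenterOK g c E i j) (hp : c.Good g)
    (h : InColumn g E d γ t i)
    (h3 : ∃ τ ∈ stay g t i, relHeight g γ j τ < -√c.α - 5 / 3 * c.w ∨
      -√c.α + c.h + 5 / 3 * c.w < relHeight g γ j τ)
    (h6 : ∃ τ ∈ stay g t i, |relHeight g γ j τ| ≤ c.L₁ + 2 / g.Wr) :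
    1 / 2 * max (|eta g γ t j (i - 1)| - c.L₁ - 2) 0 ^ 2 +
        1 / 2 * max (|eta g γ t j i| - c.L₁ - 2) 0 ^ 2 - 2 * c.L₁ ≤ excess g E γ t (i - 1) i ∧
      ((∀ τ ∈ stay g t i,
          -(3 / 2 * c.L₀) ≤ relHeight g γ j τ ∧ relHeight g γ j τ ≤ 3 / 2 * c.L₀) ∨
        (c.L₂ : ℝ) ^ 2 - 2 * c.L₁ ≤ excess g E γ t (i - 1) i ∨
        ((c.L₁ : ℝ) - 1 ≤ |eta g γ t j (i - 1)| ∧ (c.L₁ : ℝ) - 1 ≤ |eta g γ t j i|)) := by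
  obtain ⟨w0, w1, hh0, hh1, L0, hα, hL1, hW⟩ := hp
  have hδ : 0 < 2 / g.Wr := div_pos two_pos h.good.Wr_pos
  set δ := 2 / g.Wr
  set A := √c.α
  set e := excess g E γ t (i - 1) i
  have hl := h.left_mem_stay
  have hr := h.right_mem_stay
  -- A visit to any controlled level of height at most `L₁ + 1` already gives the first assertion.
  have hit : ∀ s : ℝ, |s| ≤ c.L₁ + 1 → evK g E i (j + s) c.L₁ →
      (∃ τ ∈ stay g t i, relHeight g γ j τ = s) →
      1 / 2 * max (|eta g γ t j (i - 1)| - c.L₁ - 2) 0 ^ 2 +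
        1 / 2 * max (|eta g γ t j i| - c.L₁ - 2) 0 ^ 2 - 2 * c.L₁ ≤ e := by
    intro s hs hK hs'
    have h1 := h.excess_ge_of_hit hK hs'
    have h2 := sq_max_le (a := eta g γ t j (i - 1)) hs
    have h3 := sq_max_le (a := eta g γ t j i) hs
    linarith
  -- For a path confined to a window within `[-L₁ - 1, L₁ + 1]` both positive parts vanish, so a
  -- crude bound for the excess suffices.
  have sub : ∀ lo hi z : ℝ, -(c.L₁ : ℝ) - 1 ≤ lo → hi ≤ c.L₁ + 1 → -(2 * (c.L₁ : ℝ)) ≤ z →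
      evIplus g E i (j + lo) (j + hi) z →
      (∀ τ ∈ stay g t i, lo ≤ relHeight g γ j τ ∧ relHeight g γ j τ ≤ hi) →
      (1 / 2 * max (|eta g γ t j (i - 1)| - c.L₁ - 2) 0 ^ 2 +
        1 / 2 * max (|eta g γ t j i| - c.L₁ - 2) 0 ^ 2 - 2 * c.L₁ ≤ e) ∧ z ≤ e := by
    intro lo hi z h1 h2 hz hI hs
    have h3 := h.excess_ge_of_subset hI hs
    have h4 : 0 ≤ (eta g γ t j i - eta g γ t j (i - 1)) ^ 2 / 2 := by positivity
    have b1 : |eta g γ t j (i - 1)| ≤ c.L₁ + 1 :=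
      abs_le.2 ⟨by linarith [(hs _ hl).1, eta.eq_def g γ t j (i - 1)],
        by linarith [(hs _ hl).2, eta.eq_def g γ t j (i - 1)]⟩
    have b2 : |eta g γ t j i| ≤ c.L₁ + 1 :=
      abs_le.2 ⟨by linarith [(hs _ hr).1, eta.eq_def g γ t j i],
        by linarith [(hs _ hr).2, eta.eq_def g γ t j i]⟩
    rw [max_eq_right (by linarith), max_eq_right (by linarith)]
    constructor <;> linarith
  have hL2 : 0 ≤ (c.L₂ : ℝ) ^ 2 := by positivity
  have bar : ∀ lo hi : ℝ, -(c.L₁ : ℝ) - 1 ≤ lo → hi ≤ c.L₁ + 1 →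
      evBarrier g c i E (j + lo) (j + hi) ((c.L₂ : ℝ) ^ 2) →
      (∀ τ ∈ stay g t i, lo ≤ relHeight g γ j τ ∧ relHeight g γ j τ ≤ hi) →
      (1 / 2 * max (|eta g γ t j (i - 1)| - c.L₁ - 2) 0 ^ 2 +
        1 / 2 * max (|eta g γ t j i| - c.L₁ - 2) 0 ^ 2 - 2 * c.L₁ ≤ e) ∧
        (c.L₂ : ℝ) ^ 2 - 2 * c.L₁ ≤ e := by
    intro lo hi h1 h2 hB hs
    have := sub lo hi _ h1 h2 (by linarith) hB.1 hs
    exact ⟨this.1, by linarith⟩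
  -- A thin strip inside a barrier is used as a test: without paying for the barrier, the path is
  -- entirely above its lower edge or entirely below its upper edge.
  have dich : ∀ s₁ s₂ lo hi : ℝ, -(c.L₁ : ℝ) - 1 ≤ s₁ → s₁ ≤ c.L₁ + 1 → c.w / 3 ≤ s₂ - s₁ →
      lo ≤ s₁ → s₂ ≤ hi → evK g E i (j + s₁) c.L₁ → evK g E i (j + s₂) c.L₁ →
      evBarrier g c i E (j + lo) (j + hi) ((c.L₂ : ℝ) ^ 2) →
      ((1 / 2 * max (|eta g γ t j (i - 1)| - c.L₁ - 2) 0 ^ 2 +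
        1 / 2 * max (|eta g γ t j i| - c.L₁ - 2) 0 ^ 2 - 2 * c.L₁ ≤ e) ∧
        (c.L₂ : ℝ) ^ 2 - 2 * c.L₁ ≤ e) ∨
      (∀ τ ∈ stay g t i, s₁ < relHeight g γ j τ) ∨
      (∀ τ ∈ stay g t i, relHeight g γ j τ < s₂) := by
    intro s₁ s₂ lo hi h1 h2 hs hlo hhi hK₁ hK₂ hB
    rcases h.barrier_dichotomy (by linarith) hK₁ hK₂ hB.2 hlo hhi hs with ⟨h4, h5⟩ | h4 | h4
    · exact Or.inl ⟨hit s₁ (abs_le.2 ⟨by linarith, h2⟩) hK₁ h5, h4⟩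
    · exact Or.inr (Or.inl h4)
    · exact Or.inr (Or.inr h4)
  have K : ∀ s ∈ ({-(c.L₁ : ℝ), -(c.L₁ : ℝ) + c.w, -A - 2 * c.w / 3,
      -A + c.h + 2 * c.w / 3, -(3 / 2 * c.L₀), 3 / 2 * c.L₀, (c.L₁ : ℝ) - c.w,
      (c.L₁ : ℝ)} : Set ℝ), ∀ u : ℝ, u = s - c.w ∨ u = s ∨ u = s + c.w →
      evK g E i (j + u) c.L₁ := by
    intro s hs u hu
    obtain ⟨k1, k2, k3⟩ := hc.level s hs
    rcases hu with rfl | rfl | rfl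
    · rwa [← add_sub_assoc]
    · exact k2
    · rwa [← add_assoc]
  obtain ⟨τ₆, m₆, e₆⟩ := h6
  obtain ⟨τ₃, m₃, e₃⟩ := h3
  have e₆' := abs_le.1 e₆
  -- The tests go from bottom to top. This strip lies just below the slot at `-√α`.
  rcases dich (-A - 5 / 3 * c.w) (-A - 2 * c.w / 3) (-c.L₁ + δ) (-A - δ) (by linarith)
    (by linarith) (by linarith) (by linarith) (by linarith)
    (K (-A - 2 * c.w / 3) (by simp) _ (Or.inl (by ring)))
    (K (-A - 2 * c.w / 3) (by simp) _ (Or.inr (Or.inl rfl))) hc.lower with hB | hup | hlow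
  · exact ⟨hB.1, Or.inr (Or.inl hB.2)⟩
  rotate_left
  -- The path is below the slot. A strip near `-L₁` decides whether it is confined to the lower
  -- barrier or stays near or below `-L₁`.
  · rcases dich (-c.L₁ + c.w) (-c.L₁ + 2 * c.w) (-c.L₁ + δ) (-A - δ) (by linarith)
      (by linarith) (by linarith) (by linarith) (by linarith)
      (K (-c.L₁ + c.w) (by simp) _ (Or.inr (Or.inl rfl)))
      (K (-c.L₁ + c.w) (by simp) _ (Or.inr (Or.inr (by ring)))) hc.lower with hB | hup' | hlow'
    · exact ⟨hB.1, Or.inr (Or.inl hB.2)⟩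
    · have := bar _ _ (by linarith) (by linarith) hc.lower fun τ hτ =>
        ⟨by linarith [hup' τ hτ], by linarith [hlow τ hτ]⟩
      exact ⟨this.1, Or.inr (Or.inl this.2)⟩
    · refine ⟨?_, Or.inr (Or.inr ⟨?_, ?_⟩)⟩
      · by_cases hall : ∀ τ ∈ stay g t i, -(c.L₁ : ℝ) - 1 ≤ relHeight g γ j τ
        · exact (sub _ _ _ le_rfl (by linarith) (by linarith) hc.bottom fun τ hτ =>
            ⟨hall τ hτ, by linarith [hlow' τ hτ]⟩).1
        -- A path which also goes below `-L₁ - 1` passes through the level `-L₁ - w`, because `h6`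
        -- provides a point not lower than `-L₁ - 2 / W_r`.
        · push Not at hall
          obtain ⟨τ, hτ, hτ'⟩ := hall
          exact hit (-c.L₁ - c.w) (abs_le.2 ⟨by linarith, by linarith⟩)
            (K (-c.L₁) (by simp) _ (Or.inl (by ring)))
            (h.exists_hit hτ m₆ (by linarith) (by linarith [e₆'.1]))
      · exact le_abs.2 (Or.inr (by linarith [hlow' _ hl, eta.eq_def g γ t j (i - 1)]))
      · exact le_abs.2 (Or.inr (by linarith [hlow' _ hr, eta.eq_def g γ t j i]))
  rcases dich (-A + c.h + 2 * c.w / 3) (-A + c.h + 5 / 3 * c.w) (-A + c.h + δ) (-c.L₀ - δ)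
    (by linarith) (by linarith) (by linarith) (by linarith) (by linarith)
    (K (-A + c.h + 2 * c.w / 3) (by simp) _ (Or.inr (Or.inl rfl)))
    (K (-A + c.h + 2 * c.w / 3) (by simp) _ (Or.inr (Or.inr (by ring)))) hc.mid
    with hB | hup2 | hlow2
  · exact ⟨hB.1, Or.inr (Or.inl hB.2)⟩
  rotate_left
  -- Between the strips below and above the slot the path would be of Type 3, which `h3` excludes.
  · rcases e₃ with e₃ | e₃
    · linarith [hup τ₃ m₃]
    · linarith [hlow2 τ₃ m₃]
  rcases dich (-(3 / 2 * c.L₀) - c.w) (-(3 / 2 * c.L₀)) (-A + c.h + δ) (-c.L₀ - δ)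
    (by linarith) (by linarith) (by linarith) (by linarith) (by linarith)
    (K (-(3 / 2 * c.L₀)) (by simp) _ (Or.inl rfl))
    (K (-(3 / 2 * c.L₀)) (by simp) _ (Or.inr (Or.inl rfl))) hc.mid
    with hB | hup3 | hlow3
  · exact ⟨hB.1, Or.inr (Or.inl hB.2)⟩
  rotate_left
  · have := bar _ _ (by linarith) (by linarith) hc.mid fun τ hτ =>
      ⟨by linarith [hup2 τ hτ], by linarith [hlow3 τ hτ]⟩
    exact ⟨this.1, Or.inr (Or.inl this.2)⟩
  -- The lower edge of this strip is that of the middle region; a path below its upper edge is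
  -- confined to the barrier between the slot and the middle.
  rcases dich (-(3 / 2 * c.L₀)) (-(3 / 2 * c.L₀) + c.w) (-A + c.h + δ) (-c.L₀ - δ)
    (by linarith) (by linarith) (by linarith) (by linarith) (by linarith)
    (K (-(3 / 2 * c.L₀)) (by simp) _ (Or.inr (Or.inl rfl)))
    (K (-(3 / 2 * c.L₀)) (by simp) _ (Or.inr (Or.inr rfl))) hc.mid
    with hB | hup4 | hlow4
  · exact ⟨hB.1, Or.inr (Or.inl hB.2)⟩
  rotate_left
  · have := bar _ _ (by linarith) (by linarith) hc.mid fun τ hτ =>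
      ⟨by linarith [hup2 τ hτ], by linarith [hlow4 τ hτ]⟩
    exact ⟨this.1, Or.inr (Or.inl this.2)⟩
  rcases dich (3 / 2 * c.L₀ - c.w) (3 / 2 * c.L₀) (c.L₀ + δ) (c.L₁ - δ)
    (by linarith) (by linarith) (by linarith) (by linarith) (by linarith)
    (K (3 / 2 * c.L₀) (by simp) _ (Or.inl rfl))
    (K (3 / 2 * c.L₀) (by simp) _ (Or.inr (Or.inl rfl))) hc.upper
    with hB | hup5 | hlow5
  · exact ⟨hB.1, Or.inr (Or.inl hB.2)⟩
  rotate_left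
  -- Above the strip at `-3/2 L₀` and below the one at `3/2 L₀`: this is the middle region.
  · have hs : ∀ τ ∈ stay g t i, -(3 / 2 * c.L₀) ≤ relHeight g γ j τ ∧
        relHeight g γ j τ ≤ 3 / 2 * c.L₀ := fun τ hτ => ⟨(hup4 τ hτ).le, (hlow5 τ hτ).le⟩
    exact ⟨(sub _ _ _ (by linarith) (by linarith) (by linarith) hc.middle hs).1, Or.inl hs⟩
  rcases dich (c.L₁ - 2 * c.w) (c.L₁ - c.w) (c.L₀ + δ) (c.L₁ - δ)
    (by linarith) (by linarith) (by linarith) (by linarith) (by linarith)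
    (K (c.L₁ - c.w) (by simp) _ (Or.inl (by ring)))
    (K (c.L₁ - c.w) (by simp) _ (Or.inr (Or.inl rfl))) hc.upper
    with hB | hup6 | hlow6
  · exact ⟨hB.1, Or.inr (Or.inl hB.2)⟩
  · refine ⟨?_, Or.inr (Or.inr ⟨?_, ?_⟩)⟩
    · by_cases hall : ∀ τ ∈ stay g t i, relHeight g γ j τ ≤ c.L₁ + 1
      · exact (sub _ _ _ (by linarith) le_rfl (by linarith) hc.top fun τ hτ =>
          ⟨by linarith [hup6 τ hτ], hall τ hτ⟩).1
      · push Not at hall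
        obtain ⟨τ, hτ, hτ'⟩ := hall
        exact hit (c.L₁ + c.w) (abs_le.2 ⟨by linarith, by linarith⟩)
          (K c.L₁ (by simp) _ (Or.inr (Or.inr rfl)))
          (h.exists_hit m₆ hτ (by linarith [e₆'.2]) (by linarith))
    · exact le_abs.2 (Or.inl (by linarith [hup6 _ hl, eta.eq_def g γ t j (i - 1)]))
    · exact le_abs.2 (Or.inl (by linarith [hup6 _ hr, eta.eq_def g γ t j i]))
  · have := bar _ _ (by linarith) (by linarith) hc.upper fun τ hτ =>
      ⟨by linarith [hup5 τ hτ], by linarith [hlow6 τ hτ]⟩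
    exact ⟨this.1, Or.inr (Or.inl this.2)⟩

/-- The conditions of `𝒟_{i,j}` on an outer column, for one environment. -/
structure OuterOK (g : Grid) (c : Consts) (E : Env) (i : ℤ) (j : ℝ) : Prop where
  opening : evIminus g E i (j + -(c.L₀ / 40)) (j + c.L₀ / 40) c.L₀
  aplus : evAplus g E i j c.L₀
  level : ∀ s ∈ ({-(c.L₂ : ℝ) + c.w, -(c.L₀ / 20), -(c.L₀ / 20) + 1, c.L₀ / 20 - 1,
      c.L₀ / 20, (c.L₂ : ℝ) - c.w} : Set ℝ), evK g E i (j + s) c.L₁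
  lower : evBarrier g c i E (j + (-c.L₂ + 2 / g.Wr)) (j + (-(c.L₀ / 40) - 2 / g.Wr))
    ((c.L₂ : ℝ) ^ 3)
  upper : evBarrier g c i E (j + (c.L₀ / 40 + 2 / g.Wr)) (j + (c.L₂ - 2 / g.Wr)) ((c.L₂ : ℝ) ^ 3)

lemma evD.outerOK {c : Consts} {Ψ Ψ' : Env} (h : evD g c Ψ Ψ' i j) :
    OuterOK g c Ψ i j ∧ OuterOK g c Ψ' i j := by
  obtain ⟨h1, -, h3, h4, h5⟩ := h
  constructor
  · refine ⟨?_, h3.1, h4.1, ?_, ?_⟩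
    · convert h1.1 using 1
      ring
    · convert h5.1.1 using 1 <;> ring
    · convert h5.1.2 using 1 <;> ring
  · refine ⟨?_, h3.2, h4.2, ?_, ?_⟩
    · convert h1.2 using 1
      ring
    · convert h5.2.1 using 1 <;> ring
    · convert h5.2.2 using 1 <;> ring

/-- A geodesic which crosses an outer column at moderate height and cost stays near the middle. -/
lemma OuterOK.abs_relHeight_le {c : Consts} (hc : OuterOK g c E i j) (hp : c.Good g)
    (h : InColumn g E d γ t i) (hL₂ : 100 * (c.L₁ : ℝ) ≤ c.L₂)
    (ha : |eta g γ t j (i - 1)| ≤ c.L₂ / 4) (hb : |eta g γ t j i| ≤ c.L₂ / 4)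
    (he : excess g E γ t (i - 1) i ≤ c.L₂) :
    ∀ τ ∈ stay g t i, |relHeight g γ j τ| ≤ c.L₀ / 20 := by
  obtain ⟨w0, w1, hh0, hh1, L0, hα, hL1, hW⟩ := hp
  have hδ : 0 < 2 / g.Wr := div_pos two_pos h.good.Wr_pos
  set δ := 2 / g.Wr
  set e := excess g E γ t (i - 1) i
  have hl := h.left_mem_stay
  have hr := h.right_mem_stay
  have hl' := abs_le.1 ha
  have hr' := abs_le.1 hb
  -- To get from heights at most `L₂/4` to `±(L₂ - w)` and back costs about `L₂ ^ 2 / 4` by `𝒦`,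
  -- more than the allowed `L₂`.
  have nohit : ∀ s : ℝ, |s| = c.L₂ - c.w → evK g E i (j + s) c.L₁ →
      (∃ τ ∈ stay g t i, relHeight g γ j τ = s) → False := by
    intro s hs hK hs'
    have h1 := h.excess_ge_of_hit hK hs'
    have k1 := abs_sub_abs_le_abs_sub s (eta g γ t j (i - 1))
    have k2 := abs_sub_abs_le_abs_sub s (eta g γ t j i)
    rw [abs_sub_comm] at k1 k2
    have k3 : (c.L₂ / 2 : ℝ) ^ 2 ≤ (|eta g γ t j (i - 1) - s| - 1) ^ 2 :=
      pow_le_pow_left₀ (by linarith) (by linarith) 2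
    have k4 : (c.L₂ / 2 : ℝ) ^ 2 ≤ (|eta g γ t j i - s| - 1) ^ 2 :=
      pow_le_pow_left₀ (by linarith) (by linarith) 2
    nlinarith
  have hcube : (c.L₂ : ℝ) < (c.L₂ : ℝ) ^ 3 - 2 * c.L₁ := by
    have : (1 : ℝ) ≤ c.L₂ := by linarith
    nlinarith [mul_nonneg (by linarith : (0 : ℝ) ≤ c.L₂) (by nlinarith : (0 : ℝ) ≤ c.L₂ ^ 2 - 3)]
  have htop : ∀ τ ∈ stay g t i, relHeight g γ j τ < c.L₂ - c.w := by
    intro τ hτ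
    by_contra! hcon
    exact nohit (c.L₂ - c.w) (abs_of_nonneg (by linarith)) (hc.level _ (by simp))
      (h.exists_hit hl hτ (by linarith [hl'.2, eta.eq_def g γ t j (i - 1)]) hcon)
  have hbot : ∀ τ ∈ stay g t i, -(c.L₂ : ℝ) + c.w < relHeight g γ j τ := by
    intro τ hτ
    by_contra! hcon
    exact nohit (-c.L₂ + c.w) (by rw [abs_of_nonpos (by linarith)]; ring)
      (hc.level _ (by simp))
      (h.exists_hit hτ hl hcon (by linarith [hl'.1, eta.eq_def g γ t j (i - 1)]))
  have hsq : 0 ≤ (eta g γ t j i - eta g γ t j (i - 1)) ^ 2 / 2 := by positivity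
  -- Crossing the strip below `L₀/20` and staying above it are both excluded by the barrier: either
  -- costs about `L₂ ^ 3`.
  have hup : ∀ τ ∈ stay g t i, relHeight g γ j τ < c.L₀ / 20 := by
    rcases h.barrier_dichotomy (by linarith) (hc.level (c.L₀ / 20 - 1) (by simp))
      (hc.level (c.L₀ / 20) (by simp)) hc.upper.2 (by linarith) (by linarith) (by linarith)
      with h1 | h1 | h1
    · linarith [h1.1]
    · have := h.excess_ge_of_subset hc.upper.1 fun τ hτ =>
        ⟨by linarith [h1 τ hτ], by linarith [htop τ hτ]⟩
      linarith
    · exact h1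
  have hdown : ∀ τ ∈ stay g t i, -(c.L₀ / 20) < relHeight g γ j τ := by
    rcases h.barrier_dichotomy (by linarith) (hc.level (-(c.L₀ / 20)) (by simp))
      (hc.level (-(c.L₀ / 20) + 1) (by simp)) hc.lower.2 (by linarith) (by linarith) (by linarith)
      with h1 | h1 | h1
    · linarith [h1.1]
    · exact h1
    · have := h.excess_ge_of_subset hc.lower.1 fun τ hτ =>
        ⟨by linarith [hbot τ hτ], by linarith [h1 τ hτ]⟩
      linarith
  exact fun τ hτ => abs_le.2 ⟨(hdown τ hτ).le, (hup τ hτ).le⟩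

end Columns

/-! ### The five columns around the central one -/

/-- The conditions of `𝒫_{i,j}` on the columns `i - 2, …, i + 2`, for one environment. -/
structure ColumnsOK (g : Grid) (c : Consts) (E : Env) (i : ℤ) (j : ℝ) : Prop where
  center : CenterOK g c E i j
  outer_left : OuterOK g c E (i - 2) j
  outer_right : OuterOK g c E (i + 2) j
  aminus_left : evAminus g E (i - 1) j c.L₀
  aminus_right : evAminus g E (i + 1) j c.L₀
  aplus_left : evAplus g E (i - 1) j c.L₀
  aplus_right : evAplus g E (i + 1) j c.L₀
  near : ∀ η : ℝ, |η| ≤ c.L₁ → |(j + η) * g.Wr| ≤ g.M * g.Wn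

/-- The geodesic is neither of Type 3 nor of Type 6. -/
def Relevant (g : Grid) (c : Consts) (γ : ℝ → Plane) (t : ℤ → ℝ) (i : ℤ) (j : ℝ) : Prop :=
  (∃ τ ∈ stay g t i, relHeight g γ j τ < -√c.α - 5 / 3 * c.w ∨
      -√c.α + c.h + 5 / 3 * c.w < relHeight g γ j τ) ∧
    ∃ τ ∈ stay g t i, |relHeight g γ j τ| ≤ c.L₁ + 2 / g.Wr

lemma mul_le_sq {x z : ℝ} (hx : 0 ≤ x) (h : z ≤ x) : z * x ≤ x ^ 2 := by
  rw [sq]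
  exact mul_le_mul_of_nonneg_right h hx

/-- Here `a₀` is an end height of the central column, `a₁` and `a₂` are the next two crossing
heights outwards. The increments pay for themselves quadratically, and the part of `|a₀|` beyond `L₁
+ 2` is paid for in the central column. The constant `24` is `6 * 4`: a square of a sum costs a
factor `6`, and a quarter of the squares survives after the linear losses are absorbed. -/
lemma half_bound {a₀ a₁ a₂ e₁ e₂ L₀ L₁ : ℝ} (hL₀ : 0 ≤ L₀) (hL : 16 * L₀ ≤ L₁) (hL₁ : 1000 ≤ L₁)
    (h1 : (a₁ - a₀) ^ 2 / 2 - |a₀| - |a₁| - L₀ ≤ e₁)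
    (h2 : (a₂ - a₁) ^ 2 / 2 - |a₁| - |a₂| - L₀ ≤ e₂) :
    a₂ ^ 2 / 24 - L₁ ^ 2 ≤ 1 / 2 * max (|a₀| - L₁ - 2) 0 ^ 2 + e₁ + e₂ ∧
      a₁ ^ 2 / 24 - L₁ ^ 2 ≤ 1 / 2 * max (|a₀| - L₁ - 2) 0 ^ 2 + e₁ + e₂ ∧
      -L₁ ^ 2 ≤ 1 / 2 * max (|a₀| - L₁ - 2) 0 ^ 2 + e₁ := by
  set C := max (|a₀| - L₁ - 2) 0
  have hC0 : 0 ≤ C := le_max_right _ _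
  have hC : |a₀| ≤ C + (L₁ + 2) := by linarith [le_max_left (|a₀| - L₁ - 2) 0]
  set A := |a₂ - a₁| with hA
  set B := |a₁ - a₀| with hB
  have hA0 : 0 ≤ A := abs_nonneg _
  have hB0 : 0 ≤ B := abs_nonneg _
  have t1 : |a₁| ≤ |a₀| + B := by
    have := abs_add_le a₀ (a₁ - a₀)
    rwa [add_sub_cancel] at this
  have t2 : |a₂| ≤ |a₁| + A := by
    have := abs_add_le a₁ (a₂ - a₁)
    rwa [add_sub_cancel] at this
  rw [← sq_abs, ← hB] at h1
  rw [← sq_abs, ← hA] at h2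
  have s1 : a₁ ^ 2 ≤ (B + C + (L₁ + 2)) ^ 2 := by
    rw [← sq_abs a₁]
    exact pow_le_pow_left₀ (abs_nonneg _) (by linarith) 2
  have s2 : a₂ ^ 2 ≤ (A + B + C + (L₁ + 2)) ^ 2 := by
    rw [← sq_abs a₂]
    exact pow_le_pow_left₀ (abs_nonneg _) (by linarith) 2
  have q1 : (B + C + (L₁ + 2)) ^ 2 ≤ 4 * (B ^ 2 + C ^ 2) + 2 * (L₁ + 2) ^ 2 := by
    linarith [sq_nonneg (B - C), sq_nonneg (B + C - (L₁ + 2))]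
  have q2 : (A + B + C + (L₁ + 2)) ^ 2 ≤ 6 * (A ^ 2 + B ^ 2 + C ^ 2) + 2 * (L₁ + 2) ^ 2 := by
    linarith [sq_nonneg (A - B), sq_nonneg (A - C), sq_nonneg (B - C),
      sq_nonneg (A + B + C - (L₁ + 2))]
  have l1 : -(C ^ 2 / 4 + B ^ 2 / 4) - 5 - 2 * (L₁ + 2) - L₀ ≤ e₁ - B ^ 2 / 2 := by
    linarith [sq_nonneg (C / 2 - 2), sq_nonneg (B / 2 - 1)]
  have l2 : 1 / 4 * (A ^ 2 + B ^ 2 + C ^ 2) - 26 - 4 * (L₁ + 2) - 2 * L₀ ≤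
      1 / 2 * C ^ 2 + e₁ + e₂ := by
    linarith [sq_nonneg (A / 2 - 1), sq_nonneg (B / 2 - 3), sq_nonneg (C / 2 - 4)]
  have hsq : 1000 * L₁ ≤ L₁ ^ 2 := by nlinarith
  have hsq' : (L₁ + 2) ^ 2 ≤ 2 * L₁ ^ 2 := by linarith
  have pA := sq_nonneg A
  have pB := sq_nonneg B
  have pC := sq_nonneg C
  refine ⟨?_, ?_, ?_⟩ <;> linarith

section Five

variable {g : Grid} {E : Env} {d : ℝ} {γ : ℝ → Plane} {t : ℤ → ℝ} {i : ℤ} {j : ℝ} {c : Consts}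

lemma Consts.Good.L₁_bounds (hp : c.Good g) : 16 * c.L₀ ≤ c.L₁ ∧ 160000 ≤ (c.L₁ : ℝ) := by
  constructor <;> linarith [hp.L₀_ge, hp.α_ge, hp.L₁_ge]

/-- Lower bounds for the weight of the geodesic in the five columns. -/
lemma ColumnsOK.five_lower (hc : ColumnsOK g c E i j) (hp : c.Good g) (hs : GeoSetup g E d γ t)
    (hi : 3 ≤ i) (hM : (i + 2) * g.p ≤ g.M) (hrel : Relevant g c γ t i j) :
    (eta g γ t j (i - 3) ^ 2 + eta g γ t j (i + 2) ^ 2) / 24 - 3 * (c.L₁ : ℝ) ^ 2 ≤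
        excess g E γ t (i - 3) (i + 2) ∧
      eta g γ t j (i - 2) ^ 2 / 24 - 3 * (c.L₁ : ℝ) ^ 2 ≤ excess g E γ t (i - 3) (i + 2) ∧
      eta g γ t j (i + 1) ^ 2 / 24 - 3 * (c.L₁ : ℝ) ^ 2 ≤ excess g E γ t (i - 3) (i + 2) ∧
      excess g E γ t (i - 3) (i - 2) ≤
        excess g E γ t (i - 3) (i + 2) + 3 * (c.L₁ : ℝ) ^ 2 ∧
      excess g E γ t (i + 1) (i + 2) ≤
        excess g E γ t (i - 3) (i + 2) + 3 * (c.L₁ : ℝ) ^ 2 := by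
  have hMk : ∀ k, k ≤ i + 2 → k * (g.p : ℤ) ≤ g.M := fun k hk =>
    (mul_le_mul_of_nonneg_right hk (by positivity)).trans hM
  obtain ⟨hL, hL'⟩ := hp.L₁_bounds
  have hL₀ : 0 ≤ c.L₀ := by linarith [hp.L₀_ge]
  have h0 := (hc.center.alternatives hp (hs.inColumn (by lia) (hMk i (by lia))) hrel.1 hrel.2).1
  have h1 := hc.aplus_right.le_excess hs (by lia) (hMk _ (by lia))
  have h2 := hc.outer_right.aplus.le_excess hs (by lia) (hMk _ (by lia))
  have h3 := hc.aplus_left.le_excess hs (by lia) (hMk _ (by lia))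
  have h4 := hc.outer_left.aplus.le_excess hs (by lia) (hMk _ (by lia))
  rw [show i + 1 - 1 = i by ring] at h1
  rw [show i + 2 - 1 = i + 1 by ring] at h2
  rw [show i - 1 - 1 = i - 2 by ring] at h3
  rw [show i - 2 - 1 = i - 3 by ring] at h4
  obtain ⟨r1, r2, r3⟩ := half_bound hL₀ hL (by linarith) h1 h2
  -- The left half is the mirror image, starting from the line `x = (i-1)r`.
  obtain ⟨l1, l2, l3⟩ := half_bound (a₀ := eta g γ t j (i - 1)) (a₁ := eta g γ t j (i - 2))
    (a₂ := eta g γ t j (i - 3)) (e₁ := excess g E γ t (i - 2) (i - 1))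
    (e₂ := excess g E γ t (i - 3) (i - 2)) hL₀ hL (by linarith)
    (by linear_combination h3) (by linear_combination h4)
  have s1 := excess_add (g := g) (E := E) (γ := γ) (t := t) (i - 3) (i - 2) (i + 2)
  have s2 := excess_add (g := g) (E := E) (γ := γ) (t := t) (i - 2) (i - 1) (i + 2)
  have s3 := excess_add (g := g) (E := E) (γ := γ) (t := t) (i - 1) i (i + 2)
  have s4 := excess_add (g := g) (E := E) (γ := γ) (t := t) i (i + 1) (i + 2)
  have hsq : 1000 * (c.L₁ : ℝ) ≤ (c.L₁ : ℝ) ^ 2 := mul_le_sq (by linarith) (by linarith)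
  have q1 := sq_nonneg (eta g γ t j (i - 3))
  have q2 := sq_nonneg (eta g γ t j (i + 2))
  refine ⟨?_, ?_, ?_, ?_, ?_⟩ <;> linarith

lemma sq_sub_le_of_mem {x y L : ℝ} (hx : x ∈ Icc (-L) L) (hy : y ∈ Icc (-L) L) :
    (y - x) ^ 2 ≤ (2 * L) ^ 2 :=
  sq_le_sq' (by linarith [hx.2, hy.1]) (by linarith [hx.1, hy.2])

/-- The route through the openings of the five columns. -/
lemma ColumnsOK.exists_reach (hc : ColumnsOK g c E i j) (hp : c.Good g) (hg : g.Good) :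
    ∃ η ∈ Icc (-(c.L₀ / 40)) (c.L₀ / 40), ∃ η' ∈ Icc (-(c.L₀ / 40)) (c.L₀ / 40),
      Reach g E j (i - 3) (i + 2) η η' (c.L₀ ^ 2) := by
  obtain ⟨hL, hL'⟩ := hp.L₁_bounds
  have hL₀ := hp.L₀_ge
  obtain ⟨e₁, m₁, e₂, m₂, r₁⟩ := hc.outer_left.opening.exists_reach hg
  obtain ⟨e₃, m₃, e₄, m₄, r₃⟩ := hc.center.opening.exists_reach hg
  obtain ⟨e₅, m₅, e₆, m₆, r₅⟩ := hc.outer_right.opening.exists_reach hg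
  have habs : ∀ e ∈ Icc (-(c.L₀ / 40)) (c.L₀ / 40), |e| ≤ c.L₀ / 40 := fun e he => abs_le.2 he
  have hnear : ∀ e ∈ Icc (-(c.L₀ / 40)) (c.L₀ / 40), |(j + e) * g.Wr| ≤ g.M * g.Wn :=
    fun e he => hc.near e ((habs e he).trans (by linarith))
  have hH : ∀ e ∈ Icc (-(c.L₀ / 40)) (c.L₀ / 40), |(j + e) * g.Wr| ≤ g.H :=
    fun e he => (hnear e he).trans hg.le_H
  have r₂ := hc.aminus_left.reach hg (hnear _ m₂) (hnear _ m₃)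
  have r₄ := hc.aminus_right.reach hg (hnear _ m₄) (hnear _ m₅)
  rw [show i + 1 - 1 = i by ring] at r₄
  rw [show i + 2 - 1 = i + 1 by ring] at r₅
  rw [show i - 1 - 1 = i - 2 by ring] at r₂
  rw [show i - 2 - 1 = i - 3 by ring] at r₁
  have r := (((r₁.trans r₂ (by lia) (by lia) (hH _ m₂)).trans r₃ (by lia) (by lia)
    (hH _ m₃)).trans r₄ (by lia) (by lia) (hH _ m₄)).trans r₅ (by lia) (by lia) (hH _ m₅)
  refine ⟨e₁, m₁, e₆, m₆, r.mono hg ?_⟩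
  -- Each of the five steps moves by at most `L₀/20`, so the parabolic terms sum to at most `L₀ ^ 2
  -- / 160`; all the rest is linear in `L₀`.
  have q1 := sq_sub_le_of_mem m₁ m₂
  have q2 := sq_sub_le_of_mem m₂ m₃
  have q3 := sq_sub_le_of_mem m₃ m₄
  have q4 := sq_sub_le_of_mem m₄ m₅
  have q5 := sq_sub_le_of_mem m₅ m₆
  have b2 := habs _ m₂
  have b3 := habs _ m₃
  have b4 := habs _ m₄
  have b5 := habs _ m₅
  have hsq₀ : 10000 * c.L₀ ≤ c.L₀ ^ 2 := mul_le_sq (by linarith) hL₀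
  linarith

/-! ### The three central columns -/

/-- Since `|a| ≤ |b| + x`, the linear loss is at most `x + L₀/10`. -/
lemma aplus_lower {a b x e L₀ : ℝ} (hb : |b| ≤ L₀ / 20) (hx : |a - b| = x)
    (h : x ^ 2 / 2 - |a| - |b| - L₀ ≤ e) : x ^ 2 / 2 - x - 11 / 10 * L₀ ≤ e := by
  have := abs_sub_abs_le_abs_sub a b
  linarith

lemma sq_half_sub_mono {x y : ℝ} (hy : 1 ≤ y) (h : y ≤ x) : y ^ 2 / 2 - y ≤ x ^ 2 / 2 - x := by
  nlinarith

/-- A geodesic which is neither of Type 3 nor of Type 6 and which is close to the middle at the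
outer columns is of Type 1. -/
lemma ColumnsOK.inner_type (hc : ColumnsOK g c E i j) (hp : c.Good g) (hs : GeoSetup g E d γ t)
    (hi : 3 ≤ i) (hM : (i + 2) * g.p ≤ g.M) (hrel : Relevant g c γ t i j)
    (hl : |eta g γ t j (i - 2)| ≤ c.L₀ / 20) (hr : |eta g γ t j (i + 1)| ≤ c.L₀ / 20) :
    (∀ τ ∈ stay g t i, -(c.L₀ / 2) ≤ relHeight g γ j τ ∧ relHeight g γ j τ ≤ c.L₀ / 2) ∧
      -(4 * c.L₀) ≤ excess g E γ t (i - 2) (i + 1) := by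
  have hMk : ∀ k, k ≤ i + 2 → k * (g.p : ℤ) ≤ g.M := fun k hk =>
    (mul_le_mul_of_nonneg_right hk (by positivity)).trans hM
  obtain ⟨hL, hL'⟩ := hp.L₁_bounds
  have hL₀ := hp.L₀_ge
  have hg := hs.good
  have hcol := hs.inColumn (i := i) (by lia) (hMk i (by lia))
  obtain ⟨h0, halt⟩ := hc.center.alternatives hp hcol hrel.1 hrel.2
  have h1 := hc.aplus_right.le_excess hs (by lia) (hMk _ (by lia))
  have h3 := hc.aplus_left.le_excess hs (by lia) (hMk _ (by lia))
  rw [show i + 1 - 1 = i by ring, ← neg_sq, neg_sub] at h1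
  rw [show i - 1 - 1 = i - 2 by ring] at h3
  have hsq₀ : 10000 * c.L₀ ≤ c.L₀ ^ 2 := mul_le_sq (by linarith) hL₀
  have hsq₁ : 160000 * (c.L₁ : ℝ) ≤ (c.L₁ : ℝ) ^ 2 := mul_le_sq (by linarith) hL'
  set a := eta g γ t j (i - 1) with ha
  set b := eta g γ t j i with hb
  set u := eta g γ t j (i - 2) with hu
  set v := eta g γ t j (i + 1) with hv
  have h1' := aplus_lower (a := b) (b := v) (e := excess g E γ t i (i + 1)) hr rfl
    (by rw [sq_abs]; linarith)
  have h3' := aplus_lower (a := a) (b := u) (e := excess g E γ t (i - 2) (i - 1)) hl rfl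
    (by rw [sq_abs]; linarith)
  have ht1 := abs_sub_abs_le_abs_sub b v
  have ht3 := abs_sub_abs_le_abs_sub a u
  set x := |b - v|
  set y := |a - u|
  have x2 : -(12 / 10 * c.L₀) ≤ excess g E γ t i (i + 1) := by linarith [sq_nonneg (x - 1)]
  have y2 : -(12 / 10 * c.L₀) ≤ excess g E γ t (i - 2) (i - 1) := by
    linarith [sq_nonneg (y - 1)]
  have s1 := excess_add (g := g) (E := E) (γ := γ) (t := t) (i - 2) (i - 1) (i + 1)
  have s2 := excess_add (g := g) (E := E) (γ := γ) (t := t) (i - 1) i (i + 1)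
  -- The competitor uses the central opening. Two steps of height at most `3L₀/40` and one of at
  -- most `L₀/20` give the parabolic cost `(9 + 2)/1600 L₀ ^ 2`.
  have hup : excess g E γ t (i - 2) (i + 1) ≤ 11 / 1600 * c.L₀ ^ 2 + 4 * c.L₀ := by
    obtain ⟨e₃, m₃, e₄, m₄, r₃⟩ := hc.center.opening.exists_reach hg
    have habs : ∀ e ∈ Icc (-(c.L₀ / 40)) (c.L₀ / 40), |e| ≤ c.L₀ / 40 := fun e he => abs_le.2 he
    have hnear : ∀ e, |e| ≤ c.L₀ / 20 → |(j + e) * g.Wr| ≤ g.M * g.Wn :=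
      fun e he => hc.near e (he.trans (by linarith))
    have hnear' : ∀ e ∈ Icc (-(c.L₀ / 40)) (c.L₀ / 40), |(j + e) * g.Wr| ≤ g.M * g.Wn :=
      fun e he => hnear e ((habs e he).trans (by linarith))
    have r₂ := hc.aminus_left.reach hg (hnear _ hl) (hnear' _ m₃)
    have r₄ := hc.aminus_right.reach hg (hnear' _ m₄) (hnear _ hr)
    rw [show i + 1 - 1 = i by ring] at r₄
    rw [show i - 1 - 1 = i - 2 by ring] at r₂
    have r := (r₂.trans r₃ (by lia) (by lia) ((hnear' _ m₃).trans hg.le_H)).trans r₄ (by lia)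
      (by lia) ((hnear' _ m₄).trans hg.le_H)
    refine (hs.excess_le (by lia) (by lia) (hMk _ (by lia)) r).trans ?_
    have b3 := abs_le.1 (habs _ m₃)
    have b4 := abs_le.1 (habs _ m₄)
    have bl := abs_le.1 hl
    have br := abs_le.1 hr
    have q2 : (e₃ - u) ^ 2 ≤ (3 * c.L₀ / 40) ^ 2 :=
      sq_le_sq' (by linarith [b3.1, bl.2]) (by linarith [b3.2, bl.1])
    have q4 : (v - e₄) ^ 2 ≤ (3 * c.L₀ / 40) ^ 2 :=
      sq_le_sq' (by linarith [b4.2, br.1]) (by linarith [b4.1, br.2])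
    have q3 := sq_sub_le_of_mem m₃ m₄
    have c3 := habs _ m₃
    have c4 := habs _ m₄
    linarith
  have hL2 := c.L₁_le_L₂
  rcases halt with hmid | hB | ⟨hfa, hfb⟩
  · have hm := hcol.excess_ge_of_subset hc.center.middle hmid
    have hm' : -c.L₀ ≤ excess g E γ t (i - 1) i := by
      linarith [sq_nonneg (eta g γ t j i - eta g γ t j (i - 1))]
    refine ⟨?_, by linarith⟩
    by_contra hex
    by_cases hends : |a| ≤ c.L₀ / 4 ∧ |b| ≤ c.L₀ / 4
    · have := hcol.excess_ge_of_exit hc.center.exit (abs_le.1 hends.1) (abs_le.1 hends.2) hmid hex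
      linarith
    -- An end beyond `L₀/4` requires a step of at least `L₀/4 - L₀/20 = L₀/5` in a neighbouring
    -- column. Its cost, about `L₀ ^ 2 / 50`, exceeds that of the competitor.
    · have hcase : c.L₀ / 5 ≤ y ∨ c.L₀ / 5 ≤ x := by
        by_contra! hcon
        exact hends ⟨by linarith [hcon.1], by linarith [hcon.2]⟩
      rcases hcase with hy | hx
      · have := sq_half_sub_mono (by linarith) hy
        linarith
      · have := sq_half_sub_mono (by linarith) hx
        linarith
  · exfalso
    have k1 : (c.L₁ : ℝ) ^ 2 ≤ (c.L₂ : ℝ) ^ 2 := pow_le_pow_left₀ (by linarith) hL2 2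
    have k2 : (16 * c.L₀) ^ 2 ≤ (c.L₁ : ℝ) ^ 2 := pow_le_pow_left₀ (by linarith) hL 2
    linarith
  · exfalso
    -- Both neighbouring columns would have to climb at least `L₁/2`, at a cost of about `L₁ ^ 2 /
    -- 8` each.
    have k1 := sq_half_sub_mono (x := x) (y := (c.L₁ : ℝ) / 2) (by linarith) (by linarith)
    have k2 := sq_half_sub_mono (x := y) (y := (c.L₁ : ℝ) / 2) (by linarith) (by linarith)
    have k3 : -(2 * (c.L₁ : ℝ)) ≤ excess g E γ t (i - 1) i := by
      have := sq_nonneg (max (|a| - c.L₁ - 2) 0)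
      have := sq_nonneg (max (|b| - c.L₁ - 2) 0)
      linarith
    have k4 : (16 * c.L₀) ^ 2 ≤ (c.L₁ : ℝ) ^ 2 := pow_le_pow_left₀ (by linarith) hL 2
    linarith

/-- If a cheap passage near `-√α` is available, then the geodesic can not be of Type 1. -/
lemma ColumnsOK.excess_lt_of_cheap (hc : ColumnsOK g c E i j) (hp : c.Good g)
    (hs : GeoSetup g E d γ t) (hi : 3 ≤ i) (hM : (i + 2) * g.p ≤ g.M)
    (hl : |eta g γ t j (i - 2)| ≤ c.L₀ / 20) (hr : |eta g γ t j (i + 1)| ≤ c.L₀ / 20)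
    (hα : √c.α * c.L₀ ^ 2 ≤ c.α ^ (9 / 10 : ℝ)) (hα' : 0 ≤ c.α)
    (hch : evIminus g E i (j - √c.α) (j - √c.α + c.h) (-(c.α + c.α ^ (9 / 10 : ℝ)))) :
    excess g E γ t (i - 2) (i + 1) < -(4 * c.L₀) := by
  have hMk : ∀ k, k ≤ i + 2 → k * (g.p : ℤ) ≤ g.M := fun k hk =>
    (mul_le_mul_of_nonneg_right hk (by positivity)).trans hM
  obtain ⟨hL, hL'⟩ := hp.L₁_bounds
  have hL₀ := hp.L₀_ge
  have hg := hs.good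
  have hA := hp.α_ge
  have hA1 := hp.L₁_ge
  have hh0 := hp.h_ge
  have hh1 := hp.h_le
  have hch' : evIminus g E i (j + -√c.α) (j + (-√c.α + c.h)) (-(c.α + c.α ^ (9 / 10 : ℝ))) := by
    convert hch using 1 <;> ring
  obtain ⟨e₃, m₃, e₄, m₄, r₃⟩ := hch'.exists_reach hg
  have hAA : √c.α ^ 2 = c.α := Real.sq_sqrt hα'
  set A := √c.α
  have habs : ∀ e ∈ Icc (-A) (-A + c.h), |e| ≤ A := fun e he =>
    abs_le.2 ⟨he.1, by linarith [he.2]⟩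
  have hnear : ∀ e, |e| ≤ A → |(j + e) * g.Wr| ≤ g.M * g.Wn :=
    fun e he => hc.near e (he.trans (by linarith))
  have r₂ := hc.aminus_left.reach hg (hnear _ (hl.trans (by linarith))) (hnear _ (habs _ m₃))
  have r₄ := hc.aminus_right.reach hg (hnear _ (habs _ m₄)) (hnear _ (hr.trans (by linarith)))
  rw [show i + 1 - 1 = i by ring] at r₄
  rw [show i - 1 - 1 = i - 2 by ring] at r₂
  have r := (r₂.trans r₃ (by lia) (by lia) ((hnear _ (habs _ m₃)).trans hg.le_H)).trans r₄ (by lia)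
    (by lia) ((hnear _ (habs _ m₄)).trans hg.le_H)
  refine (hs.excess_le (by lia) (by lia) (hMk _ (by lia)) r).trans_lt ?_
  set u := eta g γ t j (i - 2)
  set v := eta g γ t j (i + 1)
  have b3 := abs_le.1 (habs _ m₃)
  have b4 := abs_le.1 (habs _ m₄)
  have bl := abs_le.1 hl
  have br := abs_le.1 hr
  have q2 : (e₃ - u) ^ 2 ≤ (A + c.L₀ / 20) ^ 2 :=
    sq_le_sq' (by linarith [b3.1, bl.2]) (by linarith [b3.2, bl.1])
  have q4 : (v - e₄) ^ 2 ≤ (A + c.L₀ / 20) ^ 2 :=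
    sq_le_sq' (by linarith [b4.2, br.1]) (by linarith [b4.1, br.2])
  have q3 : (e₄ - e₃) ^ 2 ≤ 2 ^ 2 :=
    sq_le_sq' (by linarith [m₃.2, m₄.1]) (by linarith [m₃.1, m₄.2])
  have c3 := habs _ m₃
  have c4 := habs _ m₄
  have hbig : 10000 * (A * c.L₀) ≤ A * c.L₀ ^ 2 := by
    have h1 := mul_le_mul_of_nonneg_left (mul_le_sq (by linarith) hL₀)
      (by linarith : (0 : ℝ) ≤ A)
    linarith
  have hbig' : 10000 * A ≤ A * c.L₀ := by
    rw [mul_comm]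
    exact mul_le_mul_of_nonneg_left hL₀ (by linarith)
  have hbig'' : 4 * c.L₀ ^ 2 ≤ A * c.L₀ := by
    rw [sq, ← mul_assoc]
    exact mul_le_mul_of_nonneg_right hA (by linarith)
  -- The two diagonal steps cost half of this each. The term `α` cancels against the value of the
  -- slot, and `α ^ (9/10) ≥ √α L₀ ^ 2` dominates all that remains.
  have hexp : (A + c.L₀ / 20) ^ 2 = c.α + A * c.L₀ / 10 + c.L₀ ^ 2 / 400 := by
    rw [← hAA]
    ring
  rw [hexp] at q2 q4
  linarith

end Five

/-! ### The slopes of the geodesic in the wings -/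

lemma rpow_hundredth_le {x : ℝ} (hx : 0 ≤ x) : x ^ (1 / 100 : ℝ) ≤ 1 + x := by
  rcases le_total x 1 with h | h
  · have := Real.rpow_le_one hx h (by norm_num : (0 : ℝ) ≤ 1 / 100)
    linarith
  · have := Real.rpow_le_self_of_one_le h (by norm_num : (1 / 100 : ℝ) ≤ 1)
    linarith

/-- Linear growth in the heights is affordable, thanks to the factor `1 / (2 ^ k * L ^ 2)`. -/
lemma zErr_le {L : ℝ} (hL : 1 ≤ L) (k : ℕ) (η η' : ℝ) :
    zErr L k η η' ≤ (2 + |η| + |η'|) / (2 ^ k * L ^ 2) + (2 ^ k * L) ^ (3 / 5 : ℝ) := by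
  unfold zErr
  have h : |η| ^ (1 / 100 : ℝ) + |η'| ^ (1 / 100 : ℝ) ≤ 2 + |η| + |η'| := by
    linarith [rpow_hundredth_le (abs_nonneg η), rpow_hundredth_le (abs_nonneg η')]
  exact add_le_add (div_le_div_of_nonneg_right h (by positivity)) le_rfl

/-- `D ^ (-1/5)` for `D = 2 ^ k L`. -/
def fifth (L : ℝ) (k : ℕ) : ℝ := (2 ^ k * L) ^ (-1 / 5 : ℝ)

section Fifth

variable {L : ℝ} {k : ℕ}

lemma fifth_pos (hL : 1 ≤ L) : 0 < fifth L k := by unfold fifth; positivity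

lemma fifth_pow (hL : 1 ≤ L) : 2 ^ k * L * fifth L k ^ 5 = 1 := by
  have h : (0 : ℝ) < 2 ^ k * L := by positivity
  unfold fifth
  generalize (2 : ℝ) ^ k * L = D at h ⊢
  rw [← Real.rpow_natCast, ← Real.rpow_mul h.le, show -1 / 5 * ((5 : ℕ) : ℝ) = -1 by norm_num,
    Real.rpow_neg_one, mul_inv_cancel₀ h.ne']

lemma rpow_three_fifths (hL : 1 ≤ L) :
    (2 ^ k * L) ^ (3 / 5 : ℝ) = 2 ^ k * L * fifth L k ^ 2 := by
  have h : (0 : ℝ) < 2 ^ k * L := by positivity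
  unfold fifth
  generalize (2 : ℝ) ^ k * L = D at h ⊢
  rw [← Real.rpow_natCast, ← Real.rpow_mul h.le, show (3 / 5 : ℝ) = 1 + -1 / 5 * ((2 : ℕ) : ℝ) by
    norm_num, Real.rpow_add h, Real.rpow_one]

lemma fifth_le_one (hL : 1 ≤ L) : fifth L k ≤ 1 := by
  have h : (1 : ℝ) ≤ 2 ^ k * L := one_le_mul_of_one_le_of_one_le (one_le_pow₀ (by norm_num)) hL
  exact Real.rpow_le_one_of_one_le_of_nonpos h (by norm_num)

/-- The ratio is `2 ^ (-1/5)`, and `(8/7) ^ 5 ≤ 2`. A ratio below `1` is what makes the changes of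
slope summable over the scales. -/
lemma fifth_succ_le (hL : 1 ≤ L) : fifth L (k + 1) ≤ 7 / 8 * fifth L k := by
  have h : (0 : ℝ) < 2 ^ k * L := by positivity
  have h2 : (2 : ℝ) ^ (-1 / 5 : ℝ) ≤ 7 / 8 := by
    rw [show (-1 / 5 : ℝ) = -(1 / 5) by norm_num, Real.rpow_neg (by norm_num)]
    have : (8 / 7 : ℝ) ≤ 2 ^ (1 / 5 : ℝ) := by
      have := Real.rpow_le_rpow (z := (1 / 5 : ℝ)) (by norm_num)
        (by norm_num : (8 / 7 : ℝ) ^ 5 ≤ 2) (by norm_num)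
      rwa [← Real.rpow_natCast, ← Real.rpow_mul (by norm_num),
        show ((5 : ℕ) : ℝ) * (1 / 5) = 1 by norm_num, Real.rpow_one] at this
    exact (inv_anti₀ (by norm_num) this).trans_eq (by norm_num)
  unfold fifth
  rw [pow_succ', mul_assoc, Real.mul_rpow (by norm_num) h.le]
  gcongr

lemma fifth_le (hL : 1 ≤ L) : fifth L k ≤ L ^ (-1 / 5 : ℝ) := by
  unfold fifth
  refine Real.rpow_le_rpow_of_nonpos (by positivity) ?_ (by norm_num)
  exact le_mul_of_one_le_left (by positivity) (one_le_pow₀ (by norm_num))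

end Fifth

/-- One step of the comparison of slopes at consecutive scales. -/
lemma slope_step {D L q A s x σ : ℝ} (hD : 1 ≤ D) (hL : 1 ≤ L) (hq : 0 < q) (hq1 : q ≤ 1)
    (hDq : D * q ^ 5 = 1) (hA : 1 ≤ A) (hx : 0 ≤ x) (hs : s ≤ A) (hσ : σ ≤ s + x)
    (h : D * x ^ 2 ≤ 4 * (D * q ^ 2) + 6 * A ^ 2 / (D * L) + (2 * σ + 4 * s) / L) :
    x ≤ 6 * A * q := by
  have hD0 : 0 < D := by linarith
  have hL0 : 0 < L := by linarith
  have h1 : 6 * A ^ 2 / (D * L) ≤ 6 * A ^ 2 := by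
    rw [div_le_iff₀ (by positivity)]
    have : 1 ≤ D * L := one_le_mul_of_one_le_of_one_le hD hL
    nlinarith [sq_nonneg A]
  have h2 : (2 * σ + 4 * s) / L ≤ 2 * x + 6 * A := by
    rw [div_le_iff₀ hL0]
    nlinarith
  have h3 : D * x ^ 2 ≤ 4 * (D * q ^ 2) + 6 * A ^ 2 + (2 * x + 6 * A) := by linarith
  -- Division by `D = q ^ (-5)`: the main error becomes `4 q ^ 2`, and the others carry the factor
  -- `q ^ 5`.
  have h4 : x ^ 2 ≤ 4 * q ^ 2 + (6 * A ^ 2 + 2 * x + 6 * A) * q ^ 5 := by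
    have h5 : D * x ^ 2 ≤ D * (4 * q ^ 2 + (6 * A ^ 2 + 2 * x + 6 * A) * q ^ 5) := by
      calc D * x ^ 2 ≤ 4 * (D * q ^ 2) + (6 * A ^ 2 + 2 * x + 6 * A) * 1 := by linarith
        _ = _ := by rw [← hDq]; ring
    exact le_of_mul_le_mul_left h5 hD0
  have hq2 : q ^ 5 ≤ q ^ 2 := pow_le_pow_of_le_one hq.le hq1 (by norm_num)
  have hq3 : q ^ 5 ≤ q := by
    calc q ^ 5 ≤ q ^ 1 := pow_le_pow_of_le_one hq.le hq1 (by norm_num)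
      _ = q := pow_one q
  have hA2 : A ≤ A ^ 2 := by nlinarith
  have h6 : x ^ 2 ≤ 16 * A ^ 2 * q ^ 2 + 2 * x * q := by
    have e1 : (6 * A ^ 2 + 6 * A) * q ^ 5 ≤ 12 * A ^ 2 * q ^ 2 := by
      have := mul_le_mul (by linarith : 6 * A ^ 2 + 6 * A ≤ 12 * A ^ 2) hq2 (by positivity)
        (by positivity)
      linarith
    have e2 : 2 * x * q ^ 5 ≤ 2 * x * q := by gcongr
    have e3 : 4 * q ^ 2 ≤ 4 * A ^ 2 * q ^ 2 := by nlinarith [sq_nonneg q]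
    linarith
  have hAq : q ≤ A * q := by nlinarith
  -- For `x > 6 A q` the right side of `h6` is less than `(16/36 + 2/6) x ^ 2 < x ^ 2`.
  by_contra! hcon
  nlinarith [mul_pos (by linarith : 0 < A) hq]

/-- The slope of the geodesic at the smallest scale of a wing, in terms of that at the largest. -/
lemma slope_bound {L h : ℝ} {K : ℕ} {ρ : ℕ → ℝ} (hL : 1 ≤ L)
    (hL49 : 49 * L ^ (-1 / 5 : ℝ) ≤ 1) (hK : 1 ≤ K)
    (htop : |(ρ K - h) / (2 ^ K * L)| ≤ L ^ (-1 / 5 : ℝ))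
    (hstep : ∀ k, 1 ≤ k → k < K →
      2 ^ k * L * ((ρ k - h) / (2 ^ k * L) - (ρ (k + 1) - h) / (2 ^ (k + 1) * L)) ^ 2 ≤
        zErr L k h (ρ k) + zErr L k (ρ k) (ρ (k + 1)) + zErr L (k + 1) h (ρ (k + 1))) :
    |(ρ 1 - h) / (2 ^ 1 * L)| ≤ 49 * (1 + √|h|) * L ^ (-1 / 5 : ℝ) := by
  -- The height `h` enters the errors linearly and the slopes enter quadratically, whence the square
  -- root.
  set A := 1 + √|h| with hA
  have hA1 : 1 ≤ A := by linarith [Real.sqrt_nonneg |h|]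
  have hA2 : 1 + |h| ≤ A ^ 2 := by
    have := Real.sq_sqrt (abs_nonneg h)
    linarith [Real.sqrt_nonneg |h|]
  set σ : ℕ → ℝ := fun k => (ρ k - h) / (2 ^ k * L) with hσ
  set q₀ := L ^ (-1 / 5 : ℝ) with hq₀
  have hq₀0 : 0 < q₀ := by positivity
  have hρ : ∀ k, |ρ k| ≤ |h| + 2 ^ k * L * |σ k| := by
    intro k
    have hD : (0 : ℝ) < 2 ^ k * L := by positivity
    have e : 2 ^ k * L * |σ k| = |ρ k - h| := by
      rw [hσ, abs_div, abs_of_pos hD]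
      field_simp
    rw [e]
    have := abs_add_le h (ρ k - h)
    rwa [add_sub_cancel] at this
  -- Downward induction from the scale `K`. The constant solves `48 * 7/8 + 6 = 48`: one step adds
  -- `6 A` times the current `fifth`, and the ratio is at most `7/8`.
  have key : ∀ m, ∀ k, k + m = K → 1 ≤ k → |σ k| ≤ 48 * A * fifth L k + |σ K| := by
    intro m
    induction m with
    | zero =>
      rintro k rfl _
      have := fifth_pos (k := k + 0) hL
      have : 0 ≤ 48 * A * fifth L k := by positivity
      simp only [add_zero]
      linarith
    | succ m ih =>
      intro k hkm hk
      have ih' := ih (k + 1) (by lia) (by lia)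
      have hD : (1 : ℝ) ≤ 2 ^ k * L :=
        one_le_mul_of_one_le_of_one_le (one_le_pow₀ (by norm_num)) hL
      have hst := hstep k hk (by lia)
      have hq := fifth_pos (k := k) hL
      have hsucc := fifth_succ_le (k := k) hL
      have hsle := fifth_le (k := k + 1) hL
      -- The crude bound `A` for the previous slope closes the error estimate. It follows from the
      -- induction hypothesis by `49 * L ^ (-1/5) ≤ 1`.
      have hs : |σ (k + 1)| ≤ A := by
        have : 48 * A * fifth L (k + 1) ≤ 48 * A * q₀ := by gcongr
        have : |σ K| ≤ A * q₀ := htop.trans (le_mul_of_one_le_left hq₀0.le hA1)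
        have : A * (49 * q₀) ≤ A * 1 := by gcongr
        linarith
      have hstep' : |σ k - σ (k + 1)| ≤ 6 * A * fifth L k := by
        refine slope_step (σ := |σ k|) (s := |σ (k + 1)|) hD hL hq (fifth_le_one hL)
          (fifth_pow hL) hA1 (abs_nonneg _) hs ?_ ?_
        · have := abs_add_le (σ (k + 1)) (σ k - σ (k + 1))
          rwa [add_sub_cancel] at this
        · rw [sq_abs]
          refine hst.trans ?_
          have z1 := zErr_le hL k h (ρ k)
          have z2 := zErr_le hL k (ρ k) (ρ (k + 1))
          have z3 := zErr_le hL (k + 1) h (ρ (k + 1))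
          have r1 := hρ k
          have r2 := hρ (k + 1)
          rw [rpow_three_fifths hL] at z1 z2 z3
          have hDL : (0 : ℝ) < 2 ^ k * L * L := by positivity
          have f3 : (2 : ℝ) ^ (k + 1) * L * fifth L (k + 1) ^ 2 ≤
              2 * (2 ^ k * L * fifth L k ^ 2) := by
            have : fifth L (k + 1) ^ 2 ≤ fifth L k ^ 2 :=
              pow_le_pow_left₀ (fifth_pos hL).le (by linarith) 2
            calc (2 : ℝ) ^ (k + 1) * L * fifth L (k + 1) ^ 2
                ≤ 2 ^ (k + 1) * L * fifth L k ^ 2 := by gcongr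
              _ = _ := by ring
          have f4 : (2 + |h| + |ρ (k + 1)|) / (2 ^ (k + 1) * L ^ 2) ≤
              (2 + |h| + |ρ (k + 1)|) / (2 ^ k * L ^ 2) := by
            gcongr
            · norm_num
            · lia
          have f5 : (2 + |h| + |ρ k|) / (2 ^ k * L ^ 2) +
              (2 + |ρ k| + |ρ (k + 1)|) / (2 ^ k * L ^ 2) +
              (2 + |h| + |ρ (k + 1)|) / (2 ^ k * L ^ 2) ≤
              6 * A ^ 2 / (2 ^ k * L * L) + (2 * |σ k| + 4 * |σ (k + 1)|) / L := by
            have e : 6 * A ^ 2 / (2 ^ k * L * L) + (2 * |σ k| + 4 * |σ (k + 1)|) / L =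
                (6 * A ^ 2 + 2 ^ k * L * (2 * |σ k| + 4 * |σ (k + 1)|)) / (2 ^ k * L ^ 2) := by
              field_simp
            rw [e, ← add_div, ← add_div]
            refine div_le_div_of_nonneg_right ?_ (by positivity)
            have e2 : (2 : ℝ) ^ (k + 1) * L * |σ (k + 1)| = 2 * (2 ^ k * L * |σ (k + 1)|) := by
              ring
            rw [e2] at r2
            linarith
          linarith
      have tri : |σ k| ≤ |σ (k + 1)| + |σ k - σ (k + 1)| := by
        have := abs_add_le (σ (k + 1)) (σ k - σ (k + 1))
        rwa [add_sub_cancel] at this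
      have : 48 * A * fifth L (k + 1) ≤ 48 * A * (7 / 8 * fifth L k) := by gcongr
      linarith
  have h1 := key (K - 1) 1 (by lia) le_rfl
  have h2 : 48 * A * fifth L 1 ≤ 48 * A * q₀ := by
    have := fifth_le (k := 1) hL
    gcongr
  have h3 : |σ K| ≤ A * q₀ := htop.trans (le_mul_of_one_le_left hq₀0.le hA1)
  change |σ 1| ≤ _
  linarith

/-! ### The wings -/

lemma zErr_comm (L : ℝ) (k : ℕ) (η η' : ℝ) : zErr L k η η' = zErr L k η' η := by
  unfold zErr
  rw [add_comm (|η| ^ (1 / 100 : ℝ))]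

/-- The cost of a broken line over two stretches of length `D`, in excess of the cost of its chord,
is exactly `D` times the square of the difference of the slopes over `D` and over `2D`. -/
lemma slope_gap_sq {D h x y z : ℝ} (hD : 0 < D)
    (hz : (x - h) ^ 2 / (2 * D) + (y - x) ^ 2 / (2 * D) - (y - h) ^ 2 / (2 * (2 * D)) ≤ z) :
    D * ((x - h) / D - (y - h) / (2 * D)) ^ 2 ≤ z := by
  refine le_of_eq_of_le ?_ hz
  field_simp
  ring

/-- The conditions on the passage times in the wings, up to the scale `2 ^ K L`. -/
structure WingsOK (g : Grid) (E : Env) (L : ℕ) (j : ℝ) (i : ℤ) (K : ℕ) : Prop where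
  left_far : ∀ k, 1 ≤ k → k ≤ K →
    ZBound g E L j (i - 3 - 2 ^ (k + 1) * L) (i - 3 - 2 ^ k * L) k
  left_near : ∀ k, 1 ≤ k → k ≤ K → ZBound g E L j (i - 3 - 2 ^ k * L) (i - 3) k
  right_near : ∀ k, 1 ≤ k → k ≤ K → ZBound g E L j (i + 2) (i + 2 + 2 ^ k * L) k
  right_far : ∀ k, 1 ≤ k → k ≤ K →
    ZBound g E L j (i + 2 + 2 ^ k * L) (i + 2 + 2 ^ (k + 1) * L) k

/-- The crossings of the lines in the wings are at moderate heights, and the slopes of the path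
over the whole wings are small. -/
structure WingPath (g : Grid) (γ : ℝ → Plane) (t : ℤ → ℝ) (L : ℕ) (j : ℝ) (i : ℤ) (K : ℕ) :
    Prop where
  near_left : |(j + eta g γ t j (i - 3)) * g.Wr| ≤ g.M * g.Wn
  near_right : |(j + eta g γ t j (i + 2)) * g.Wr| ≤ g.M * g.Wn
  left : ∀ k, 1 ≤ k → k ≤ K → |(j + eta g γ t j (i - 3 - 2 ^ k * L)) * g.Wr| ≤ g.M * g.Wn
  right : ∀ k, 1 ≤ k → k ≤ K → |(j + eta g γ t j (i + 2 + 2 ^ k * L)) * g.Wr| ≤ g.M * g.Wn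
  slope_left : |(eta g γ t j (i - 3 - 2 ^ K * L) - eta g γ t j (i - 3)) / (2 ^ K * (L : ℝ))| ≤
    (L : ℝ) ^ (-1 / 5 : ℝ)
  slope_right : |(eta g γ t j (i + 2 + 2 ^ K * L) - eta g γ t j (i + 2)) / (2 ^ K * (L : ℝ))| ≤
    (L : ℝ) ^ (-1 / 5 : ℝ)

section Wings

variable {g : Grid} {E : Env} {d : ℝ} {γ : ℝ → Plane} {t : ℤ → ℝ} {i : ℤ} {j : ℝ} {c : Consts}
  {L K : ℕ}

lemma two_pow_mul_le {k : ℕ} (hk : k ≤ K) : (2 : ℤ) ^ k * L ≤ 2 ^ K * L := by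
  gcongr
  norm_num

/-- At each scale `𝒵_k` bounds the two halves of a stretch from below and `𝒵_{k+1}` provides a
competitor for the whole. Optimality then makes the broken line no dearer than its chord, up to
three error terms, which is the step of `slope_bound`. -/
lemma WingsOK.slope_right (hw : WingsOK g E L j i K) (hγ : WingPath g γ t L j i K)
    (hs : GeoSetup g E d γ t) (hL : 1 ≤ L) (hL49 : 49 * (L : ℝ) ^ (-1 / 5 : ℝ) ≤ 1) (hK : 1 ≤ K)
    (hi : 0 ≤ i + 2) (hM : (i + 2 + 2 ^ K * L) * g.p ≤ g.M) :
    |(eta g γ t j (i + 2 + 2 ^ 1 * L) - eta g γ t j (i + 2)) / (2 ^ 1 * (L : ℝ))| ≤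
      49 * (1 + √|eta g γ t j (i + 2)|) * (L : ℝ) ^ (-1 / 5 : ℝ) := by
  refine slope_bound (K := K) (ρ := fun k => eta g γ t j (i + 2 + 2 ^ k * L))
    (by exact_mod_cast hL) hL49 hK hγ.slope_right fun k hk hkK => ?_
  have hpos : ∀ k : ℕ, (0 : ℤ) < 2 ^ k * L := fun k => by positivity
  have hMk : ∀ k, k ≤ K → (i + 2 + 2 ^ k * L) * (g.p : ℤ) ≤ g.M := fun k hk =>
    (mul_le_mul_of_nonneg_right (by linarith [two_pow_mul_le (L := L) hk])
      (by positivity)).trans hM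
  have hp := hpos k
  have hp' : (2 : ℤ) ^ (k + 1) * L = 2 * (2 ^ k * L) := by ring
  have h1 := (hw.right_near k hk hkK.le).le_excess hs hi (by lia) (hMk k hkK.le) hγ.near_right
    (hγ.right k hk hkK.le)
  have h2 := (hw.right_far k hk hkK.le).le_excess hs (by lia) (by lia) (hMk (k + 1) hkK)
    (hγ.right k hk hkK.le) (hγ.right (k + 1) (by lia) hkK)
  have h3 := hs.excess_le hi (by lia) (hMk (k + 1) hkK)
    ((hw.right_near (k + 1) (by lia) hkK).reach hs.good (by lia) hγ.near_right
      (hγ.right (k + 1) (by lia) hkK))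
  rw [← excess_add _ (i + 2 + 2 ^ k * L)] at h3
  push_cast at h1 h2 h3
  have hpR : (2 : ℝ) ^ (k + 1) * L = 2 * (2 ^ k * L) := by ring
  have hD : (0 : ℝ) < 2 ^ k * L := by exact_mod_cast hp
  simp only [hp', hpR] at h1 h2 h3 ⊢
  refine slope_gap_sq hD ?_
  rw [add_sub_cancel_left] at h1 h3
  rw [show (i : ℝ) + 2 + 2 * (2 ^ k * L) - (i + 2 + 2 ^ k * L) = 2 ^ k * L by ring] at h2
  linarith

/-- The mirror image: the direction of travel is reversed by the symmetry of the errors and of the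
squares. -/
lemma WingsOK.slope_left (hw : WingsOK g E L j i K) (hγ : WingPath g γ t L j i K)
    (hs : GeoSetup g E d γ t) (hL : 1 ≤ L) (hL49 : 49 * (L : ℝ) ^ (-1 / 5 : ℝ) ≤ 1) (hK : 1 ≤ K)
    (hi : 0 ≤ i - 3 - 2 ^ K * L) (hM : (i - 3) * g.p ≤ g.M) :
    |(eta g γ t j (i - 3 - 2 ^ 1 * L) - eta g γ t j (i - 3)) / (2 ^ 1 * (L : ℝ))| ≤
      49 * (1 + √|eta g γ t j (i - 3)|) * (L : ℝ) ^ (-1 / 5 : ℝ) := by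
  refine slope_bound (K := K) (ρ := fun k => eta g γ t j (i - 3 - 2 ^ k * L))
    (by exact_mod_cast hL) hL49 hK hγ.slope_left fun k hk hkK => ?_
  have hpos : ∀ k : ℕ, (0 : ℤ) < 2 ^ k * L := fun k => by positivity
  have h0 : ∀ k, k ≤ K → 0 ≤ i - 3 - 2 ^ k * (L : ℤ) := fun k hk => by
    linarith [two_pow_mul_le (L := L) hk]
  have hMk : (i - 3 - 2 ^ k * L) * (g.p : ℤ) ≤ g.M :=
    (mul_le_mul_of_nonneg_right (by linarith [hpos k]) (by positivity)).trans hM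
  have hp := hpos k
  have hp' : (2 : ℤ) ^ (k + 1) * L = 2 * (2 ^ k * L) := by ring
  have h1 := (hw.left_near k hk hkK.le).le_excess hs (h0 k hkK.le) (by lia) hM
    (hγ.left k hk hkK.le) hγ.near_left
  have h2 := (hw.left_far k hk hkK.le).le_excess hs (h0 (k + 1) hkK) (by lia) hMk
    (hγ.left (k + 1) (by lia) hkK) (hγ.left k hk hkK.le)
  have h3 := hs.excess_le (h0 (k + 1) hkK) (by lia) hM
    ((hw.left_near (k + 1) (by lia) hkK).reach hs.good (by lia)
      (hγ.left (k + 1) (by lia) hkK) hγ.near_left)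
  rw [← excess_add _ (i - 3 - 2 ^ k * L)] at h3
  rw [zErr_comm] at h1 h2 h3
  push_cast at h1 h2 h3
  have hpR : (2 : ℝ) ^ (k + 1) * L = 2 * (2 ^ k * L) := by ring
  have hD : (0 : ℝ) < 2 ^ k * L := by exact_mod_cast hp
  simp only [hp', hpR] at h1 h2 h3 ⊢
  refine slope_gap_sq hD ?_
  rw [sub_sub_cancel] at h1 h3
  rw [show (i : ℝ) - 3 - 2 ^ k * L - (i - 3 - 2 * (2 ^ k * L)) = 2 ^ k * L by ring] at h2
  rw [← neg_sq, neg_sub] at h1 h2 h3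
  linarith

end Wings

/-! ### The shortest wings together with the five central columns -/

/-- The cost of moving an end point of a short wing to the middle. -/
lemma detour_cost_aux {X Y e a b : ℝ} (hX : 1000 ≤ X) (hYX : 1000000 * X ^ 2 ≤ Y) (he : |e| ≤ X)
    (hs : |b - a| ≤ 98 * Y ^ 4 * (1 + √|a|)) :
    ((b - e) ^ 2 - (b - a) ^ 2) / (4 * Y ^ 5) + (2 + |e| + |b|) / (2 * (Y ^ 5) ^ 2) +
      (2 + |a| + |b|) / (2 * (Y ^ 5) ^ 2) ≤ a ^ 2 / 100 + 10 := by
  have hY6 : 1000000 ≤ Y := by nlinarith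
  have hYpos : 0 < Y := by linarith
  have hY1 : (1 : ℝ) ≤ Y := by linarith
  rw [← sq_abs a]
  obtain ⟨G, hG⟩ : ∃ G, G = |a| := ⟨_, rfl⟩
  obtain ⟨B, hB⟩ : ∃ B, B = |b| := ⟨_, rfl⟩
  have hG0 : 0 ≤ G := hG ▸ abs_nonneg a
  have hsq : √G ≤ 1 + G := by
    linarith [Real.sq_sqrt hG0, Real.sqrt_nonneg G, sq_nonneg (√G - 1)]
  rw [← hG] at hs ⊢
  rw [← hB]
  have hu : |b - a| ≤ 98 * Y ^ 4 * (2 + G) :=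
    hs.trans (mul_le_mul_of_nonneg_left (by linarith) (by positivity))
  have hae : |a - e| ≤ G + X := (abs_sub a e).trans (by linarith)
  have hbabs : B ≤ G + 98 * Y ^ 4 * (2 + G) := by
    have := abs_add_le a (b - a)
    rw [add_sub_cancel] at this
    linarith
  -- Only the product with `b - a` is dangerous. By the slope bound it is of order `Y ^ 4`, and
  -- division by `Y ^ 5` makes it small, because `Y` exceeds `10 ^ 6 X ^ 2`.
  have e1 : (b - e) ^ 2 - (b - a) ^ 2 = (a - e) ^ 2 + 2 * ((a - e) * (b - a)) := by ring
  have e2 : (a - e) ^ 2 + 2 * ((a - e) * (b - a)) ≤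
      (G + X) ^ 2 + 196 * Y ^ 4 * ((G + X) * (2 + G)) := by
    have h1 : (a - e) ^ 2 ≤ (G + X) ^ 2 := by
      rw [← sq_abs]
      exact pow_le_pow_left₀ (abs_nonneg _) hae 2
    have h2 : (a - e) * (b - a) ≤ (G + X) * (98 * Y ^ 4 * (2 + G)) := by
      refine (le_abs_self _).trans ?_
      rw [abs_mul]
      exact mul_le_mul hae hu (abs_nonneg _) (by positivity)
    linarith
  obtain ⟨Z, hZ⟩ : ∃ Z, Z = Y ^ 4 := ⟨_, rfl⟩
  have hZ5 : Y ^ 5 = Z * Y := by rw [hZ]; ring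
  have hZ1 : 1 ≤ Z := hZ ▸ one_le_pow₀ hY1
  have hZY : 1 ≤ Z * Y := one_le_mul_of_one_le_of_one_le hZ1 hY1
  rw [← hZ] at e2 hbabs
  rw [hZ5, e1]
  clear hs hu e1 hZ5 hZ
  have hGY : G ^ 2 * 1000000 ≤ G ^ 2 * Y := by gcongr
  have e3 : ((a - e) ^ 2 + 2 * ((a - e) * (b - a))) / (4 * (Z * Y)) ≤ G ^ 2 / 200 + 5 := by
    rw [div_le_iff₀ (by positivity)]
    refine e2.trans ?_
    have h0 : (G + X) ^ 2 ≤ 2 * G ^ 2 + 2 * X ^ 2 := by linarith [sq_nonneg (G - X)]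
    have h1 : (G + X) ^ 2 ≤ Z * (2 * G ^ 2 + 2 * X ^ 2) :=
      h0.trans (le_mul_of_one_le_left (by positivity) hZ1)
    have h2 : (G + X) * (2 + G) ≤ 2 * G ^ 2 + 2 * X ^ 2 := by
      nlinarith [sq_nonneg (G - X / 2), sq_nonneg (G - 2)]
    have h3 : Z * ((G + X) * (2 + G)) ≤ Z * (2 * G ^ 2 + 2 * X ^ 2) := by gcongr
    have h4 : 197 * (2 * G ^ 2 + 2 * X ^ 2) ≤ 4 * ((G ^ 2 / 200 + 5) * Y) := by
      linarith [sq_nonneg G, sq_nonneg X]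
    have h5 := mul_le_mul_of_nonneg_left h4 (by linarith : 0 ≤ Z)
    linarith
  have small : ∀ x : ℝ, x ≤ G + X → (2 + x + B) / (2 * (Z * Y) ^ 2) ≤ G ^ 2 / 400 + 2 := by
    intro x hx
    rw [div_le_iff₀ (by positivity)]
    have h1 : 2 + x + B ≤ Z * (98 * (2 + G) + 2 * G + X + 2) := by
      have : 2 + 2 * G + X ≤ Z * (2 + 2 * G + X) := le_mul_of_one_le_left (by linarith) hZ1
      linarith
    have h2 : 98 * (2 + G) + 2 * G + X + 2 ≤ (G ^ 2 / 400 + 2) * Y := by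
      have : X ≤ X ^ 2 := by nlinarith
      linarith [sq_nonneg (G - 1)]
    have h3 : Z * Y ≤ 2 * (Z * Y) ^ 2 := by nlinarith
    calc 2 + x + B ≤ Z * (98 * (2 + G) + 2 * G + X + 2) := h1
      _ ≤ Z * ((G ^ 2 / 400 + 2) * Y) := by gcongr
      _ = (G ^ 2 / 400 + 2) * (Z * Y) := by ring
      _ ≤ _ := by gcongr
  have s1 := small |e| (by linarith)
  have s2 := small G (by linarith)
  linarith

/-- With `X = L₁` and `Y = X ^ 20` the length `L₂` is `Y ^ 5`, so `L₂ ^ (-1/5) = 1/Y` and each of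
the two errors `(2 L₂) ^ (3/5)` is at most `2 Y ^ 3 = 2 X ^ 60`. The exponent `100` in `L₂ = L₁ ^
100` makes all fifths integral powers. -/
lemma detour_cost {X e a b : ℝ} (hX : 1000 ≤ X) (he : |e| ≤ X)
    (hs : |(b - a) / (2 ^ 1 * X ^ 100)| ≤ 49 * (1 + √|a|) * (X ^ 100) ^ (-1 / 5 : ℝ)) :
    (b - e) ^ 2 / (2 * (2 * X ^ 100)) - (b - a) ^ 2 / (2 * (2 * X ^ 100)) +
      zErr (X ^ 100) 1 e b + zErr (X ^ 100) 1 a b ≤ a ^ 2 / 100 + 4 * X ^ 60 + 10 := by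
  have hX0 : 0 < X := by linarith
  obtain ⟨Y, hY⟩ : ∃ Y, Y = X ^ 20 := ⟨_, rfl⟩
  have hYpos : 0 < Y := hY ▸ by positivity
  have hY5 : X ^ 100 = Y ^ 5 := by rw [hY, ← pow_mul]
  have hY3 : X ^ 60 = Y ^ 3 := by rw [hY, ← pow_mul]
  have hYX : 1000000 * X ^ 2 ≤ Y := by
    have h1 : (1000 : ℝ) ^ 2 * X ^ 2 ≤ X ^ 2 * X ^ 2 := by gcongr
    have h2 : X ^ 4 ≤ X ^ 20 := pow_le_pow_right₀ (by linarith) (by norm_num)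
    calc 1000000 * X ^ 2 = (1000 : ℝ) ^ 2 * X ^ 2 := by norm_num
      _ ≤ X ^ 2 * X ^ 2 := h1
      _ = X ^ 4 := by ring
      _ ≤ Y := h2.trans_eq hY.symm
  have hY1 : 1 ≤ Y := by nlinarith
  have hq : (X ^ 100) ^ (-1 / 5 : ℝ) = Y⁻¹ := by
    rw [hY5, ← Real.rpow_natCast, ← Real.rpow_mul hYpos.le,
      show ((5 : ℕ) : ℝ) * (-1 / 5) = -1 by norm_num, Real.rpow_neg_one]
  have h35 : (2 * Y ^ 5) ^ (3 / 5 : ℝ) ≤ 2 * Y ^ 3 := by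
    rw [Real.mul_rpow (by norm_num) (by positivity), ← Real.rpow_natCast Y 5,
      ← Real.rpow_mul hYpos.le, show ((5 : ℕ) : ℝ) * (3 / 5) = ((3 : ℕ) : ℝ) by norm_num,
      Real.rpow_natCast]
    gcongr
    exact Real.rpow_le_self_of_one_le (by norm_num) (by norm_num)
  rw [hq, hY5] at hs
  rw [hY5, hY3]
  have hu : |b - a| ≤ 98 * Y ^ 4 * (1 + √|a|) := by
    have hpos : 0 < 2 ^ 1 * Y ^ 5 := by positivity
    rw [abs_div, abs_of_pos hpos, div_le_iff₀ hpos] at hs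
    refine hs.trans_eq ?_
    field_simp
    norm_num
  have key := detour_cost_aux hX hYX he hu
  have z1 := zErr_le (one_le_pow₀ hY1 : 1 ≤ Y ^ 5) 1 e b
  have z2 := zErr_le (one_le_pow₀ hY1 : 1 ≤ Y ^ 5) 1 a b
  rw [pow_one] at z1 z2
  rw [← sub_div, show 2 * (2 * Y ^ 5) = 4 * Y ^ 5 by ring]
  linarith

section Local

variable {g : Grid} {E : Env} {d : ℝ} {γ : ℝ → Plane} {t : ℤ → ℝ} {i : ℤ} {j : ℝ} {c : Consts}
  {K : ℕ}

set_option maxHeartbeats 1000000 in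
/-- A geodesic which is neither of Type 3 nor of Type 6 is close to the middle at the outer
columns. -/
lemma WingsOK.abs_eta_le (hw : WingsOK g E c.L₂ j i K) (hγ : WingPath g γ t c.L₂ j i K)
    (hc : ColumnsOK g c E i j) (hp : c.Good g) (hs : GeoSetup g E d γ t) (hK : 1 ≤ K)
    (hi : 0 ≤ i - 3 - 2 ^ K * c.L₂) (hM : (i + 2 + 2 ^ K * c.L₂) * g.p ≤ g.M)
    (hrel : Relevant g c γ t i j) :
    |eta g γ t j (i - 2)| ≤ c.L₀ / 20 ∧ |eta g γ t j (i + 1)| ≤ c.L₀ / 20 := by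
  obtain ⟨hL, hL'⟩ := hp.L₁_bounds
  have hL₀ := hp.L₀_ge
  have hL₁1 : (1 : ℝ) ≤ c.L₁ := by linarith
  have hL₂ : (c.L₂ : ℝ) = (c.L₁ : ℝ) ^ 100 := by unfold Consts.L₂; push_cast; rfl
  have hL₂1 : 1 ≤ c.L₂ := by
    have : (1 : ℝ) ≤ c.L₂ := hL₁1.trans c.L₁_le_L₂
    exact_mod_cast this
  -- One more power of `L₁` absorbs any constant up to `160000`.
  have hpw : ∀ a b : ℕ, a + 1 ≤ b → 160000 * (c.L₁ : ℝ) ^ a ≤ (c.L₁ : ℝ) ^ b := fun a b hab =>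
    calc 160000 * (c.L₁ : ℝ) ^ a ≤ c.L₁ * (c.L₁ : ℝ) ^ a := by gcongr
      _ = (c.L₁ : ℝ) ^ (a + 1) := by ring
      _ ≤ _ := pow_le_pow_right₀ hL₁1 hab
  have hL49 : 49 * (c.L₂ : ℝ) ^ (-1 / 5 : ℝ) ≤ 1 := by
    have : (c.L₂ : ℝ) ^ (-1 / 5 : ℝ) = ((c.L₁ : ℝ) ^ 20)⁻¹ := by
      rw [hL₂, show (100 : ℕ) = 20 * 5 by norm_num, pow_mul, ← Real.rpow_natCast _ 5,
        ← Real.rpow_mul (by positivity), show ((5 : ℕ) : ℝ) * (-1 / 5) = -1 by norm_num,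
        Real.rpow_neg_one]
    rw [this, ← div_eq_mul_inv, div_le_one (by positivity)]
    linarith [hpw 0 20 (by norm_num), pow_zero (c.L₁ : ℝ)]
  have h2K : (2 : ℤ) ^ 1 * c.L₂ ≤ 2 ^ K * c.L₂ := two_pow_mul_le hK
  have hLz : (1 : ℤ) ≤ c.L₂ := by exact_mod_cast hL₂1
  have hMk : ∀ k, k ≤ i + 2 + 2 ^ K * c.L₂ → k * (g.p : ℤ) ≤ g.M := fun k hk =>
    (mul_le_mul_of_nonneg_right hk (by positivity)).trans hM
  have hnn : (0 : ℤ) ≤ 2 ^ K * c.L₂ := by positivity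
  have sl := hw.slope_left hγ hs hL₂1 hL49 hK hi (hMk _ (by lia))
  have sr := hw.slope_right hγ hs hL₂1 hL49 hK (by lia) hM
  obtain ⟨e, he, e', he', hreach⟩ := hc.exists_reach hp hs.good
  have habs : ∀ e ∈ Icc (-(c.L₀ / 40)) (c.L₀ / 40), |e| ≤ (c.L₁ : ℝ) := fun e he =>
    (abs_le.2 he).trans (by linarith)
  have n1 := hc.near e (habs e he)
  have n2 := hc.near e' (habs e' he')
  have l1 := (hw.left_near 1 le_rfl hK).le_excess hs (by lia) (by lia) (hMk _ (by lia))
    (hγ.left 1 le_rfl hK) hγ.near_left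
  have r1 := (hw.right_near 1 le_rfl hK).le_excess hs (by lia) (by lia) (hMk _ (by lia))
    hγ.near_right (hγ.right 1 le_rfl hK)
  have l2 := (hw.left_near 1 le_rfl hK).reach hs.good (by lia) (hγ.left 1 le_rfl hK) n1
  have r2 := (hw.right_near 1 le_rfl hK).reach hs.good (by lia) n2 (hγ.right 1 le_rfl hK)
  -- The competitor keeps the crossings at distance `2 L₂` from the five columns and goes through
  -- the openings in between.
  have up := hs.excess_le (by lia) (by lia) (hMk _ (by lia))
    ((l2.trans hreach (by lia) (by lia) (n1.trans hs.good.le_H)).trans r2 (by lia) (by lia)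
      (n2.trans hs.good.le_H))
  rw [← excess_add _ (i - 3), ← excess_add (i - 3) (i + 2)] at up
  obtain ⟨f1, f2, f3, f4, f5⟩ := hc.five_lower hp hs (by lia) (hMk _ (by lia)) hrel
  rw [hL₂] at sl sr
  have dl := detour_cost (by linarith) (habs e he) sl
  have dr := detour_cost (by linarith) (habs e' he') sr
  rw [zErr_comm] at l1
  rw [zErr_comm _ _ _ e] at up
  push_cast at l1 r1 up
  rw [sub_sub_cancel, hL₂, ← neg_sq, neg_sub] at l1
  rw [add_sub_cancel_left, hL₂] at r1
  rw [sub_sub_cancel, add_sub_cancel_left, hL₂, ← neg_sq (e - _), neg_sub] at up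
  simp only [pow_one] at dl dr
  have b1 := hpw 2 60 (by norm_num)
  have b2 := hpw 60 61 (by norm_num)
  have b3 := hpw 61 100 (by norm_num)
  have b4 := hpw 0 2 (by norm_num)
  have b5 : 256 * (c.L₁ : ℝ) ^ 60 * 300 ≤ (c.L₂ : ℝ) ^ 2 := by
    rw [hL₂, ← pow_mul]
    linarith [hpw 60 (100 * 2) (by norm_num), pow_pos (by linarith : (0 : ℝ) < c.L₁) 60]
  have b6 : c.L₀ ^ 2 ≤ (c.L₁ : ℝ) ^ 2 := pow_le_pow_left₀ (by linarith) (by linarith) 2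
  have hX60 : (0 : ℝ) < (c.L₁ : ℝ) ^ 60 := by positivity
  have hX61 : (0 : ℝ) < (c.L₁ : ℝ) ^ 61 := by positivity
  rw [pow_zero] at b4
  have hF : excess g E γ t (i - 3) (i + 2) ≤
      (eta g γ t j (i - 3) ^ 2 + eta g γ t j (i + 2) ^ 2) / 100 + 9 * (c.L₁ : ℝ) ^ 60 := by
    linarith
  -- The lower bound has `1/24` and the detour only `1/100`; the difference is `19/600`, and `9 *
  -- 600/19 < 300`.
  have hgh : eta g γ t j (i - 3) ^ 2 + eta g γ t j (i + 2) ^ 2 ≤ 300 * (c.L₁ : ℝ) ^ 60 := by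
    linarith
  -- The factor `16` leaves room for the crossing heights of `x = (i-2)r` and `x = (i+1)r`, which
  -- are bounded by the excess.
  have hsmall : ∀ x : ℝ, x ^ 2 ≤ 16 * 300 * (c.L₁ : ℝ) ^ 60 → |x| ≤ c.L₂ / 4 := fun x hx =>
    abs_le_of_sq_le_sq (by rw [div_pow]; linarith) (by positivity)
  have hout : 100 * (c.L₁ : ℝ) ≤ c.L₂ := by
    rw [hL₂]
    linarith [hpw 1 100 (by norm_num), pow_one (c.L₁ : ℝ)]
  have hF' : excess g E γ t (i - 3) (i + 2) ≤ 12 * (c.L₁ : ℝ) ^ 60 := by linarith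
  have hFL : excess g E γ t (i - 3) (i + 2) + 3 * (c.L₁ : ℝ) ^ 2 ≤ c.L₂ := by
    rw [hL₂]
    linarith
  have q1 := sq_nonneg (eta g γ t j (i - 3))
  have q2 := sq_nonneg (eta g γ t j (i + 2))
  clear l1 r1 up dl dr sl sr b4 b6 l2 r2
  constructor
  · have hcol := hs.inColumn (i := i - 2) (by lia) (hMk _ (by lia))
    refine hc.outer_left.abs_relHeight_le hp hcol hout ?_ (hsmall _ (by linarith)) ?_ _
      hcol.right_mem_stay
    · rw [show i - 2 - 1 = i - 3 by ring]
      exact hsmall _ (by linarith)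
    · rw [show i - 2 - 1 = i - 3 by ring]
      linarith
  · have hcol := hs.inColumn (i := i + 2) (by lia) (hMk _ (by lia))
    have := hc.outer_right.abs_relHeight_le hp hcol hout
      (by rw [show i + 2 - 1 = i + 1 by ring]; exact hsmall _ (by linarith))
      (hsmall _ (by linarith)) (by rw [show i + 2 - 1 = i + 1 by ring]; linarith) _
      hcol.left_mem_stay
    rwa [show i + 2 - 1 = i + 1 by ring] at this

end Local

/-! ### The path far away from the central columns -/

/-- The relations between the scales: `y` is `M ^ (1/100)` and `T` is the number of columns of
width `r`. -/
structure Scales (g : Grid) (c : Consts) (y : ℝ) (T : ℤ) : Prop where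
  M_eq : (g.M : ℝ) = y ^ 100
  y_ge : 1000 ≤ y
  L_le : (c.L₂ : ℝ) ≤ y
  T_mul : T * g.p = g.M
  p_le : (g.p : ℝ) ≤ y
  Wn_le : g.Wn ≤ g.Wr
  Wr_le : g.Wr ≤ y * g.Wn
  err_le : ∀ D : ℝ, 1 ≤ D → D * g.r ≤ g.M * g.n →
    Real.log g.M ^ (100 / c.θ₂) * g.Q (D * g.r) ≤ y ^ 52 * g.Qr

section Far

variable {g : Grid} {c : Consts} {E : Env} {d y : ℝ} {γ : ℝ → Plane} {t : ℤ → ℝ} {j : ℝ}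
  {i a b T : ℤ} {η η' : ℝ}

namespace Scales

lemma near (h : Scales g c y T) (hg : g.Good) (hη : |j + η| ≤ y ^ 99) :
    |(j + η) * g.Wr| ≤ g.M * g.Wn := by
  have hy : 0 < y := by linarith [h.y_ge]
  rw [abs_mul, abs_of_pos hg.Wr_pos, h.M_eq]
  calc |j + η| * g.Wr ≤ y ^ 99 * (y * g.Wn) :=
        mul_le_mul hη h.Wr_le hg.Wr_pos.le (by positivity)
    _ = _ := by ring

lemma le_T (h : Scales g c y T) (ha : a ≤ T) : a * (g.p : ℤ) ≤ g.M := by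
  rw [← h.T_mul]
  exact mul_le_mul_of_nonneg_right ha (by positivity)

lemma err_le_of_le (h : Scales g c y T) (hg : g.Good) (ha : 0 ≤ a) (hab : a < b) (hb : b ≤ T) :
    Real.log g.M ^ (100 / c.θ₂) * g.Q (((b : ℝ) - a) * g.r) ≤ y ^ 52 * g.Qr := by
  have hab' : (a : ℝ) + 1 ≤ b := by exact_mod_cast hab
  refine h.err_le _ (by linarith) ?_
  have h1 : (b : ℝ) * g.p ≤ g.M := by exact_mod_cast h.le_T hb
  have h2 : (0 : ℝ) ≤ a := by exact_mod_cast ha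
  have hn := hg.n_pos
  have hp : (0 : ℝ) < g.p := by exact_mod_cast g.p_pos
  unfold Grid.r
  rw [← mul_assoc]
  gcongr
  nlinarith

lemma reach (h : Scales g c y T) (hg : g.Good) (hl : evLines g c E a b) (ha : 0 ≤ a) (hab : a < b)
    (hb : b ≤ T) (hη : |j + η| ≤ y ^ 99) (hη' : |j + η'| ≤ y ^ 99) :
    Reach g E j a b η η' ((η' - η) ^ 2 / (2 * (b - a)) + y ^ 52) := by
  have h1 := (hl.1 _ _ (h.near hg hη) (h.near hg hη')).2
  exact reach_of_hatDist_le hg hab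
    (h1.trans (EReal.coe_le_coe_iff.2 (h.err_le_of_le hg ha hab hb)))

/-- At this stage the crossing heights of the geodesic are known only to be at most `H`, so the
second bound of `𝒲*` is needed; its growth in the heights is damped by `y ^ (-100)`. -/
lemma le_excess (h : Scales g c y T) (hs : GeoSetup g E d γ t) (hl : evLines g c E a b)
    (ha : 0 ≤ a) (hab : a < b) (hb : b ≤ T) :
    (eta g γ t j b - eta g γ t j a) ^ 2 / (2 * (b - a)) -
      (1 + (|j + eta g γ t j a| + |j + eta g γ t j b|) / y ^ 100) * y ^ 52 ≤
        excess g E γ t a b := by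
  have hy : 1000 ≤ y := h.y_ge
  have hg := hs.good
  have hW := hg.Wr_pos
  have hWn := hg.Wn_pos
  have hM := h.le_T hb
  have hM' := h.le_T (hab.le.trans hb)
  have h1 := hl.2 _ _ (hs.abs_eta_le (j := j) ha hM') (hs.abs_eta_le (j := j) (ha.trans hab.le) hM)
  set u := |j + eta g γ t j a| with hu
  set v := |j + eta g γ t j b| with hv
  have hu0 : 0 ≤ u := abs_nonneg _
  have hv0 : 0 ≤ v := abs_nonneg _
  have herr := h.err_le_of_le hg ha hab hb
  have hlog : 0 ≤ Real.log g.M := Real.log_natCast_nonneg _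
  have hmax : max 1 ((|(j + eta g γ t j a) * g.Wr| + |(j + eta g γ t j b) * g.Wr|) /
      ((g.M : ℝ) ^ 2 * g.Wn)) ≤ 1 + (u + v) / y ^ 100 := by
    have hnn : 0 ≤ (u + v) / y ^ 100 := by positivity
    refine max_le (by linarith) ?_
    rw [abs_mul, abs_mul, abs_of_pos hW, ← hu, ← hv, ← add_mul, h.M_eq, div_le_iff₀ (by positivity)]
    have e : (u + v) / y ^ 100 * ((y ^ 100) ^ 2 * g.Wn) = (u + v) * (y ^ 99 * (y * g.Wn)) := by
      field_simp
    have h2 : g.Wr ≤ y ^ 99 * (y * g.Wn) :=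
      h.Wr_le.trans (le_mul_of_one_le_left (by positivity) (one_le_pow₀ (by linarith)))
    calc (u + v) * g.Wr ≤ (u + v) * (y ^ 99 * (y * g.Wn)) := by gcongr
      _ = (u + v) / y ^ 100 * ((y ^ 100) ^ 2 * g.Wn) := e.symm
      _ ≤ _ := by
        gcongr
        linarith
  have h3 : ((-((1 + (u + v) / y ^ 100) * y ^ 52) * g.Qr : ℝ) : EReal) ≤
      hatDist g E (linePt g j a (eta g γ t j a)) (linePt g j b (eta g γ t j b)) := by
    refine le_trans (EReal.coe_le_coe_iff.2 ?_) h1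
    rw [neg_mul, neg_le_neg_iff, mul_assoc, mul_assoc]
    have hQ := hg.Qr_pos
    refine (mul_le_mul_of_nonneg_left herr (by positivity)).trans ?_
    gcongr
  have := hs.le_excess ha hab hM h3
  linarith

end Scales

lemma GeoSetup.eta_zero (hs : GeoSetup g E d γ t) : eta g γ t j 0 = -j := by
  unfold eta relHeight
  rw [zero_mul, hs.geo.time_zero, hs.geo.1, pt_one]
  ring

lemma GeoSetup.eta_last (hs : GeoSetup g E d γ t) (hT : T * g.p = g.M) : eta g γ t j T = -j := by
  unfold eta relHeight
  rw [hT, hs.geo.2.2.1.finish, hs.geo.2.1, pt_one]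
  ring

/-- The competitor climbs at most `2 y ^ 80` over at least `y ^ 98` columns, at a cost of at most `2
y ^ 62`, negligible against `y ^ 160`. The unknown heights occur on the right only with the factor
`y ^ (52 - 100)` and are absorbed by their squares. -/
lemma central_height_bound {a b e f N N' L₀ L₁ : ℝ} (hy : 1000 ≤ y) (hL₀ : 0 ≤ L₀) (hL₁ : L₁ ≤ y)
    (hL : L₀ ≤ L₁) (hj : |j| ≤ y ^ 80) (he : |e| ≤ L₁) (hf : |f| ≤ L₁) (hN : y ^ 98 ≤ N)
    (hN' : y ^ 98 ≤ N')
    (h : (a ^ 2 + b ^ 2) / 24 - 3 * L₁ ^ 2 ≤ L₀ ^ 2 + (j + e) ^ 2 / (2 * N) +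
      (j + f) ^ 2 / (2 * N') + (4 + (|j + a| + |j + b|) / y ^ 100) * y ^ 52) :
    |a| ≤ y ^ 80 ∧ |b| ≤ y ^ 80 := by
  have hy0 : 0 < y := by linarith
  have hpw : ∀ k l : ℕ, k + 1 ≤ l → 1000 * y ^ k ≤ y ^ l := fun k l hkl =>
    calc 1000 * y ^ k ≤ y * y ^ k := by gcongr
      _ = y ^ (k + 1) := by ring
      _ ≤ _ := pow_le_pow_right₀ (by linarith) hkl
  have hq : ∀ e N : ℝ, |e| ≤ L₁ → y ^ 98 ≤ N → (j + e) ^ 2 / (2 * N) ≤ 2 * y ^ 62 := by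
    intro e N he hN
    have hNpos : 0 < N := lt_of_lt_of_le (by positivity) hN
    have h1 : |j + e| ≤ 2 * y ^ 80 := by
      have := abs_add_le j e
      have := hpw 1 80 (by norm_num)
      rw [pow_one] at this
      linarith
    have h2 : (j + e) ^ 2 ≤ 4 * (y ^ 62 * y ^ 98) := by
      rw [← sq_abs]
      calc |j + e| ^ 2 ≤ (2 * y ^ 80) ^ 2 := pow_le_pow_left₀ (abs_nonneg _) h1 2
        _ = _ := by ring
    rw [div_le_iff₀ (by positivity)]
    have : y ^ 62 * y ^ 98 ≤ y ^ 62 * N := by gcongr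
    linarith
  have h1 := hq e N he hN
  have h2 := hq f N' hf hN'
  have h3 : (|j + a| + |j + b|) / y ^ 100 * y ^ 52 ≤ 2 * y ^ 80 + |a| + |b| := by
    rw [div_mul_eq_mul_div, div_le_iff₀ (by positivity)]
    have : y ^ 52 ≤ y ^ 100 := pow_le_pow_right₀ (by linarith) (by norm_num)
    have t1 := abs_add_le j a
    have t2 := abs_add_le j b
    exact mul_le_mul (by linarith) this (by positivity) (by positivity)
  have h4 : L₁ ^ 2 ≤ y ^ 2 := pow_le_pow_left₀ (by linarith) hL₁ 2
  have h5 : L₀ ^ 2 ≤ L₁ ^ 2 := pow_le_pow_left₀ hL₀ hL 2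
  have h6 : |a| ≤ a ^ 2 / 48 + 12 := by
    rw [← sq_abs a]
    linarith [sq_nonneg (|a| - 24)]
  have h7 : |b| ≤ b ^ 2 / 48 + 12 := by
    rw [← sq_abs b]
    linarith [sq_nonneg (|b| - 24)]
  have p1 := hpw 2 80 (by norm_num)
  have p2 := hpw 62 80 (by norm_num)
  have p3 := hpw 52 80 (by norm_num)
  have p4 := hpw 80 160 (by norm_num)
  have p5 := hpw 0 80 (by norm_num)
  rw [pow_zero] at p5
  rw [add_mul] at h
  have h8 : a ^ 2 + b ^ 2 ≤ (y ^ 80) ^ 2 := by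
    rw [← pow_mul, show 80 * 2 = 160 by norm_num]
    linarith
  exact ⟨abs_le_of_sq_le_sq (by linarith [sq_nonneg b]) (by positivity),
    abs_le_of_sq_le_sq (by linarith [sq_nonneg a]) (by positivity)⟩

/-- The geodesic crosses the lines next to the five central columns not too far from `j`. -/
lemma Scales.abs_eta_le (h : Scales g c y T) (hs : GeoSetup g E d γ t) (hc : ColumnsOK g c E i j)
    (hp : c.Good g) (hrel : Relevant g c γ t i j) (hj : |j| ≤ y ^ 80)
    (hl : evLines g c E 0 (i - 3)) (hr : evLines g c E (i + 2) T) (hi : y ^ 98 ≤ (i : ℝ) - 3)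
    (hT : y ^ 98 ≤ (T : ℝ) - (i + 2)) :
    |eta g γ t j (i - 3)| ≤ y ^ 80 ∧ |eta g γ t j (i + 2)| ≤ y ^ 80 := by
  have hy : 1000 ≤ y := h.y_ge
  have h98 : (0 : ℝ) < y ^ 98 := by positivity
  have hi3 : 0 < i - 3 := by
    have : (0 : ℝ) < ((i - 3 : ℤ) : ℝ) := by push_cast; linarith
    exact_mod_cast this
  have hiT : i + 2 < T := by
    have : ((i + 2 : ℤ) : ℝ) < (T : ℝ) := by push_cast; linarith
    exact_mod_cast this
  obtain ⟨hL, hL'⟩ := hp.L₁_bounds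
  have hL₀ := hp.L₀_ge
  have hL₁ : (c.L₁ : ℝ) ≤ y := c.L₁_le_L₂.trans h.L_le
  obtain ⟨e, he, f, hf, hreach⟩ := hc.exists_reach hp hs.good
  have habs : ∀ e ∈ Icc (-(c.L₀ / 40)) (c.L₀ / 40), |e| ≤ (c.L₁ : ℝ) := fun e he =>
    (abs_le.2 he).trans (by linarith)
  have hnear : ∀ e ∈ Icc (-(c.L₀ / 40)) (c.L₀ / 40), |j + e| ≤ y ^ 99 := fun e he => by
    have h1 := abs_add_le j e
    have h2 := habs e he
    have h3 : y ≤ y ^ 80 := le_self_pow₀ (by linarith) (by norm_num)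
    have h4 : 1000 * y ^ 80 ≤ y * y ^ 80 := by gcongr
    have h5 : y * y ^ 80 ≤ y ^ 99 := by
      rw [← pow_succ']
      exact pow_le_pow_right₀ (by linarith) (by norm_num)
    linarith [pow_nonneg (by linarith : 0 ≤ y) 80]
  have h0 : |j + -j| ≤ y ^ 99 := by
    rw [add_neg_cancel, abs_zero]
    positivity
  have l1 := h.le_excess (j := j) hs hl le_rfl hi3 (by lia)
  have r1 := h.le_excess (j := j) hs hr (by lia) hiT le_rfl
  have l2 := h.reach hs.good hl le_rfl hi3 (by lia) h0 (hnear e he)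
  have r2 := h.reach hs.good hr (by lia) hiT le_rfl (hnear f hf) h0
  have hH : ∀ e ∈ Icc (-(c.L₀ / 40)) (c.L₀ / 40), |(j + e) * g.Wr| ≤ g.H := fun e he =>
    (h.near hs.good (hnear e he)).trans hs.good.le_H
  have r := (l2.trans hreach hi3 (by lia) (hH e he)).trans r2 (by lia) hiT (hH f hf)
  -- The competitor goes straight from the origin to the openings and straight on to the end point;
  -- both ends have relative height `-j`.
  have up := hs.excess_le (a := 0) (b := T) (j := j) le_rfl (by lia) (h.le_T le_rfl)
    (by rw [hs.eta_zero, hs.eta_last h.T_mul]; exact r)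
  rw [← excess_add _ (i - 3), ← excess_add (i - 3) (i + 2)] at up
  have f1 := (hc.five_lower hp hs (by lia) (h.le_T hiT.le) hrel).1
  rw [hs.eta_zero] at l1
  rw [hs.eta_last h.T_mul] at r1
  push_cast at l1 r1 up
  rw [sub_zero, add_neg_cancel, abs_zero, zero_add] at l1
  rw [add_neg_cancel, abs_zero, add_zero] at r1
  rw [sub_zero, sub_neg_eq_add, add_comm e j, ← neg_sq (-j - f), neg_sub, sub_neg_eq_add,
    add_comm f j] at up
  have n1 : 0 ≤ (eta g γ t j (i - 3) - -j) ^ 2 / (2 * ((i : ℝ) - 3)) :=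
    div_nonneg (sq_nonneg _) (by linarith)
  have n2 : 0 ≤ (-j - eta g γ t j (i + 2)) ^ 2 / (2 * ((T : ℝ) - (i + 2))) :=
    div_nonneg (sq_nonneg _) (by linarith)
  refine central_height_bound (L₀ := c.L₀) hy (by linarith) hL₁ (by linarith) hj (habs e he)
    (habs f hf) hi hT ?_
  have e : (4 + (|j + eta g γ t j (i - 3)| + |j + eta g γ t j (i + 2)|) / y ^ 100) * y ^ 52 =
      2 * y ^ 52 + (1 + |j + eta g γ t j (i - 3)| / y ^ 100) * y ^ 52 +
      (1 + |j + eta g γ t j (i + 2)| / y ^ 100) * y ^ 52 := by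
    ring
  rw [e]
  linarith

/-- Here `s` is the displacement over the first `D` of `N` columns, from absolute height `u`. As `D
≤ N`, one gets `s ^ 2 ≤ u ^ 2` up to `2 D` times the error, which is of order `y ^ 151` and thus
negligible against `y ^ 160`. -/
lemma wing_height_bound {s u D N : ℝ} (hy : 1000 ≤ y) (hD : 0 < D) (hDN : D ≤ N) (hDy : D ≤ y ^ 99)
    (hu : |u| ≤ 2 * y ^ 80)
    (h : s ^ 2 / (2 * D) ≤ u ^ 2 / (2 * N) + (3 + 2 * (|u + s| + |u|) / y ^ 100) * y ^ 52) :
    |s| ≤ 3 * y ^ 80 := by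
  have hy0 : 0 < y := by linarith
  have hN : 0 < N := by linarith
  have hpw : ∀ k l : ℕ, k + 1 ≤ l → 1000 * y ^ k ≤ y ^ l := fun k l hkl =>
    calc 1000 * y ^ k ≤ y * y ^ k := by gcongr
      _ = y ^ (k + 1) := by ring
      _ ≤ _ := pow_le_pow_right₀ (by linarith) hkl
  have h1 : u ^ 2 / (2 * N) * (2 * D) ≤ 4 * y ^ 160 := by
    have : u ^ 2 ≤ 4 * y ^ 160 := by
      rw [← sq_abs]
      calc |u| ^ 2 ≤ (2 * y ^ 80) ^ 2 := pow_le_pow_left₀ (abs_nonneg _) hu 2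
        _ = _ := by ring
    refine le_trans ?_ this
    rw [div_mul_eq_mul_div, div_le_iff₀ (by positivity)]
    gcongr
  have h2 : (3 + 2 * (|u + s| + |u|) / y ^ 100) ≤ 4 + 2 * |s| / y ^ 100 := by
    have t := abs_add_le u s
    have : 2 * (|u + s| + |u|) / y ^ 100 ≤ (y ^ 100 + 2 * |s|) / y ^ 100 := by
      gcongr
      linarith [hpw 80 100 (by norm_num), pow_pos hy0 80]
    rw [add_div, div_self (by positivity)] at this
    linarith
  have h3 : s ^ 2 ≤ 4 * y ^ 160 + (4 + 2 * |s| / y ^ 100) * y ^ 52 * (2 * y ^ 99) := by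
    rw [div_le_iff₀ (by positivity), add_mul] at h
    refine h.trans (add_le_add h1 ?_)
    gcongr
  have h4 : (4 + 2 * |s| / y ^ 100) * y ^ 52 * (2 * y ^ 99) = 8 * y ^ 151 + 4 * |s| * y ^ 51 := by
    field_simp
    ring
  rw [h4, ← sq_abs] at h3
  by_contra! hcon
  have p1 := hpw 151 160 (by norm_num)
  have p2 := hpw 51 80 (by norm_num)
  have e1 : 4 * |s| * y ^ 51 ≤ |s| * |s| := by
    nlinarith [abs_nonneg s, pow_pos hy0 80]
  have e2 : (3 * y ^ 80) * (3 * y ^ 80) < |s| * |s| := by gcongr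
  have e3 : (3 * y ^ 80) * (3 * y ^ 80) = 9 * y ^ 160 := by ring
  have e4 : 4 * |s| * y ^ 51 ≤ 1 / 10 * (|s| * |s|) := by
    nlinarith [abs_nonneg s, pow_pos hy0 80]
  have := pow_pos hy0 160
  linarith

/-- The path from `x = ar` to its end is compared with a straight passage; the parabolic cost after
the first `D` columns is discarded. -/
lemma Scales.abs_sub_le_right (h : Scales g c y T) (hs : GeoSetup g E d γ t) {D : ℤ}
    (ha : 0 ≤ a) (hD : 0 < D) (hDT : a + D < T) (hDy : (D : ℝ) ≤ y ^ 99)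
    (l1 : evLines g c E a (a + D)) (l2 : evLines g c E (a + D) T) (l3 : evLines g c E a T)
    (hu : |j + eta g γ t j a| ≤ 2 * y ^ 80) :
    |eta g γ t j (a + D) - eta g γ t j a| ≤ 3 * y ^ 80 := by
  have hy : 1000 ≤ y := h.y_ge
  have hDr : (0 : ℝ) < D := by exact_mod_cast hD
  have hDTr : (a : ℝ) + D < T := by exact_mod_cast hDT
  have b1 := h.le_excess (j := j) hs l1 ha (by lia) hDT.le
  have b2 := h.le_excess (j := j) hs l2 (by lia) hDT le_rfl
  have h99 : |j + eta g γ t j a| ≤ y ^ 99 := by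
    have h1 : 1000 * y ^ 80 ≤ y * y ^ 80 := by gcongr
    have h2 : y * y ^ 80 ≤ y ^ 99 := by
      rw [← pow_succ']
      exact pow_le_pow_right₀ (by linarith) (by norm_num)
    linarith [pow_nonneg (by linarith : 0 ≤ y) 80]
  have h0 : |j + -j| ≤ y ^ 99 := by
    rw [add_neg_cancel, abs_zero]
    positivity
  have b3 := hs.excess_le (a := a) (b := T) (j := j) ha (by lia) (h.le_T le_rfl)
    (by rw [hs.eta_last h.T_mul]; exact h.reach hs.good l3 ha (by lia) le_rfl h99 h0)
  rw [← excess_add _ (a + D)] at b3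
  rw [hs.eta_last h.T_mul] at b2
  push_cast at b1 b2 b3
  rw [add_neg_cancel, abs_zero, add_zero] at b2
  rw [add_sub_cancel_left] at b1
  rw [← neg_sq, neg_sub, sub_neg_eq_add, add_comm _ j] at b3
  have n2 : 0 ≤ (-j - eta g γ t j (a + D)) ^ 2 / (2 * ((T : ℝ) - (a + D))) :=
    div_nonneg (sq_nonneg _) (by linarith)
  refine wing_height_bound hy hDr (by linarith : (D : ℝ) ≤ T - a) hDy hu ?_
  rw [show j + eta g γ t j a + (eta g γ t j (a + D) - eta g γ t j a) = j + eta g γ t j (a + D) by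
    ring]
  have e : (3 + 2 * (|j + eta g γ t j (a + D)| + |j + eta g γ t j a|) / y ^ 100) * y ^ 52 =
      y ^ 52 + (1 + (|j + eta g γ t j a| + |j + eta g γ t j (a + D)|) / y ^ 100) * y ^ 52 +
      (1 + |j + eta g γ t j (a + D)| / y ^ 100) * y ^ 52 +
      |j + eta g γ t j a| / y ^ 100 * y ^ 52 := by
    ring
  have n3 : 0 ≤ |j + eta g γ t j a| / y ^ 100 * y ^ 52 := by positivity
  linarith

lemma Scales.abs_sub_le_left (h : Scales g c y T) (hs : GeoSetup g E d γ t) {D : ℤ}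
    (ha : a ≤ T) (hD : 0 < D) (hDa : D < a) (hDy : (D : ℝ) ≤ y ^ 99)
    (l1 : evLines g c E (a - D) a) (l2 : evLines g c E 0 (a - D)) (l3 : evLines g c E 0 a)
    (hu : |j + eta g γ t j a| ≤ 2 * y ^ 80) :
    |eta g γ t j (a - D) - eta g γ t j a| ≤ 3 * y ^ 80 := by
  have hy : 1000 ≤ y := h.y_ge
  have hDr : (0 : ℝ) < D := by exact_mod_cast hD
  have hDTr : (D : ℝ) < a := by exact_mod_cast hDa
  have b1 := h.le_excess (j := j) hs l1 (by lia) (by lia) ha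
  have b2 := h.le_excess (j := j) hs l2 le_rfl (by lia) (by lia)
  have h99 : |j + eta g γ t j a| ≤ y ^ 99 := by
    have h1 : 1000 * y ^ 80 ≤ y * y ^ 80 := by gcongr
    have h2 : y * y ^ 80 ≤ y ^ 99 := by
      rw [← pow_succ']
      exact pow_le_pow_right₀ (by linarith) (by norm_num)
    linarith [pow_nonneg (by linarith : 0 ≤ y) 80]
  have h0 : |j + -j| ≤ y ^ 99 := by
    rw [add_neg_cancel, abs_zero]
    positivity
  have b3 := hs.excess_le (a := 0) (b := a) (j := j) le_rfl (by lia) (h.le_T ha)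
    (by rw [hs.eta_zero]; exact h.reach hs.good l3 le_rfl (by lia) ha h0 h99)
  rw [← excess_add _ (a - D)] at b3
  rw [hs.eta_zero] at b2
  push_cast at b1 b2 b3
  rw [add_neg_cancel, abs_zero, zero_add] at b2
  rw [sub_sub_cancel, ← neg_sq, neg_sub] at b1
  rw [sub_neg_eq_add, add_comm _ j, sub_zero] at b3
  have n2 : 0 ≤ (eta g γ t j (a - D) - -j) ^ 2 / (2 * ((a : ℝ) - D - 0)) :=
    div_nonneg (sq_nonneg _) (by linarith)
  refine wing_height_bound hy hDr hDTr.le hDy hu ?_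
  rw [show j + eta g γ t j a + (eta g γ t j (a - D) - eta g γ t j a) = j + eta g γ t j (a - D) by
    ring]
  have e : (3 + 2 * (|j + eta g γ t j (a - D)| + |j + eta g γ t j a|) / y ^ 100) * y ^ 52 =
      y ^ 52 + (1 + (|j + eta g γ t j (a - D)| + |j + eta g γ t j a|) / y ^ 100) * y ^ 52 +
      (1 + |j + eta g γ t j (a - D)| / y ^ 100) * y ^ 52 +
      |j + eta g γ t j a| / y ^ 100 * y ^ 52 := by
    ring
  have n3 : 0 ≤ |j + eta g γ t j a| / y ^ 100 * y ^ 52 := by positivity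
  linarith

end Far

/-! ### Assembly of the far, wing and local estimates -/

/-- The conditions of `𝒲^*_i`, for one environment. -/
structure LinesOK (g : Grid) (c : Consts) (E : Env) (i : ℤ) : Prop where
  left : ∀ i' i'' : ℤ, 0 ≤ i' → i' < i'' → i'' ≤ i - 3 → evLines g c E i' i''
  right : ∀ i' i'' : ℤ, i + 2 ≤ i' → i' < i'' → i'' * g.p ≤ g.M → evLines g c E i' i''

section Assembly

variable {g : Grid} {c : Consts} {E : Env} {d y : ℝ} {γ : ℝ → Plane} {t : ℤ → ℝ} {j : ℝ}
  {i T : ℤ} {K : ℕ}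

/-- As `p ≤ y`, the wing has at least `y ^ 98 / 4` columns, so the slope is at most `12 y ^ (-18)`,
well below `1/y ≤ 1/L`. -/
lemma slope_top {L s D p : ℝ} (hy : 1000 ≤ y) (hL : 1 ≤ L) (hLy : L ≤ y) (hp : 0 < p)
    (hpy : p ≤ y) (hD : y ^ 99 / 4 ≤ D * p) (hs : |s| ≤ 3 * y ^ 80) :
    |s / D| ≤ L ^ (-1 / 5 : ℝ) := by
  have hy0 : 0 < y := by linarith
  have hD0 : 0 < D := by
    by_contra! hcon
    have : D * p ≤ 0 := mul_nonpos_of_nonpos_of_nonneg hcon hp.le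
    linarith [pow_pos hy0 99]
  have hD' : y ^ 98 / 4 ≤ D := by
    have h1 : D * p ≤ D * y := by gcongr
    have h2 : y ^ 99 = y ^ 98 * y := by ring
    rw [h2] at hD
    refine le_of_mul_le_mul_right ?_ hy0
    linarith
  have h1 : y⁻¹ ≤ L ^ (-1 / 5 : ℝ) := by
    calc y⁻¹ ≤ L⁻¹ := inv_anti₀ (by linarith) hLy
      _ = L ^ (-1 : ℝ) := (Real.rpow_neg_one L).symm
      _ ≤ _ := Real.rpow_le_rpow_of_exponent_le hL (by norm_num)
  refine le_trans ?_ h1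
  rw [abs_div, abs_of_pos hD0, div_le_iff₀ hD0]
  have h3 : 12 * y ^ 81 ≤ y ^ 98 := by
    calc 12 * y ^ 81 ≤ y * y ^ 81 := by gcongr; linarith
      _ = y ^ 82 := by ring
      _ ≤ y ^ 98 := pow_le_pow_right₀ (by linarith) (by norm_num)
  have h4 : 3 * y ^ 80 ≤ y⁻¹ * (y ^ 98 / 4) := by
    rw [inv_mul_eq_div, le_div_iff₀ hy0]
    linarith
  exact hs.trans (h4.trans (by gcongr))

/-- The displacements at all scales up to `K` are at most `3 y ^ 80`, so all crossings have heights
at which `𝒵` applies. The lower bound on `2 ^ K` makes the slope over the whole wing small. -/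
lemma Scales.wingPath (h : Scales g c y T) (hs : GeoSetup g E d γ t) (hl : LinesOK g c E i)
    (hj : |j| ≤ y ^ 80) (hL : 1 ≤ c.L₂) (hK : (2 : ℝ) ^ K * c.L₂ * g.p ≤ y ^ 99 / 2)
    (hK' : y ^ 99 / 4 ≤ (2 : ℝ) ^ K * c.L₂ * g.p) (hi : y ^ 99 ≤ ((i : ℝ) - 3) * g.p)
    (hT : y ^ 99 ≤ ((T : ℝ) - (i + 2)) * g.p) (h1 : |eta g γ t j (i - 3)| ≤ y ^ 80)
    (h2 : |eta g γ t j (i + 2)| ≤ y ^ 80) :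
    WingPath g γ t c.L₂ j i K ∧ 0 < i - 3 - 2 ^ K * c.L₂ ∧ i + 2 + 2 ^ K * c.L₂ < T := by
  have hy : 1000 ≤ y := h.y_ge
  have hy0 : 0 < y := by linarith
  have h99 : 0 < y ^ 99 := by positivity
  have h80 : 0 < y ^ 80 := by positivity
  have hp : (0 : ℝ) < g.p := by exact_mod_cast g.p_pos
  have hp1 : (1 : ℝ) ≤ g.p := by exact_mod_cast g.p_pos
  have hLr : (1 : ℝ) ≤ c.L₂ := by exact_mod_cast hL
  have hKi : 0 < i - 3 - 2 ^ K * (c.L₂ : ℤ) := by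
    have : (0 : ℝ) < ((i - 3 - 2 ^ K * c.L₂ : ℤ) : ℝ) * g.p := by
      push_cast
      linarith
    exact_mod_cast pos_of_mul_pos_left this hp.le
  have hKT : i + 2 + 2 ^ K * (c.L₂ : ℤ) < T := by
    have : (0 : ℝ) < ((T - (i + 2 + 2 ^ K * c.L₂) : ℤ) : ℝ) * g.p := by
      push_cast
      linarith
    have : 0 < T - (i + 2 + 2 ^ K * (c.L₂ : ℤ)) := by
      exact_mod_cast pos_of_mul_pos_left this hp.le
    linarith
  have hDy : ∀ k, k ≤ K → ((2 ^ k * (c.L₂ : ℤ) : ℤ) : ℝ) ≤ y ^ 99 := fun k hk => by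
    have a1 : ((2 ^ k * (c.L₂ : ℤ) : ℤ) : ℝ) ≤ ((2 ^ K * (c.L₂ : ℤ) : ℤ) : ℝ) := by
      exact_mod_cast two_pow_mul_le (L := c.L₂) hk
    have a2 : (2 : ℝ) ^ K * c.L₂ ≤ (2 : ℝ) ^ K * c.L₂ * g.p := le_mul_of_one_le_right
      (by positivity) hp1
    push_cast at a1 ⊢
    linarith
  have hD0 : ∀ k : ℕ, (0 : ℤ) < 2 ^ k * c.L₂ := fun k => by positivity
  have u1 : |j + eta g γ t j (i - 3)| ≤ 2 * y ^ 80 := (abs_add_le _ _).trans (by linarith)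
  have u2 : |j + eta g γ t j (i + 2)| ≤ 2 * y ^ 80 := (abs_add_le _ _).trans (by linarith)
  have hTp : T * (g.p : ℤ) ≤ g.M := h.le_T le_rfl
  have hleft : ∀ k, k ≤ K →
      |eta g γ t j (i - 3 - 2 ^ k * c.L₂) - eta g γ t j (i - 3)| ≤ 3 * y ^ 80 := fun k hk => by
    have b1 := two_pow_mul_le (L := c.L₂) hk
    have b2 := hD0 k
    have b3 := hD0 K
    exact h.abs_sub_le_left hs (by lia) b2 (by lia) (hDy k hk)
      (hl.left _ _ (by lia) (by lia) le_rfl) (hl.left _ _ le_rfl (by lia) (by lia))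
      (hl.left _ _ le_rfl (by lia) le_rfl) u1
  have hright : ∀ k, k ≤ K →
      |eta g γ t j (i + 2 + 2 ^ k * c.L₂) - eta g γ t j (i + 2)| ≤ 3 * y ^ 80 := fun k hk => by
    have b1 := two_pow_mul_le (L := c.L₂) hk
    have b2 := hD0 k
    have b3 := hD0 K
    exact h.abs_sub_le_right hs (by lia) b2 (by lia) (hDy k hk)
      (hl.right _ _ le_rfl (by lia) (h.le_T (by lia))) (hl.right _ _ (by lia) (by lia) hTp)
      (hl.right _ _ le_rfl (by lia) hTp) u2
  have h9980 : 1000 * y ^ 80 ≤ y ^ 99 := by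
    calc 1000 * y ^ 80 ≤ y * y ^ 80 := by gcongr
      _ = y ^ 81 := by ring
      _ ≤ y ^ 99 := pow_le_pow_right₀ (by linarith) (by norm_num)
  have hfar : ∀ a b : ℝ, |b - a| ≤ 3 * y ^ 80 → |j + a| ≤ 2 * y ^ 80 →
      |(j + b) * g.Wr| ≤ g.M * g.Wn := fun a b hb ha => by
    refine h.near hs.good ?_
    have := abs_add_le (j + a) (b - a)
    rw [show j + a + (b - a) = j + b by ring] at this
    linarith
  refine ⟨⟨h.near hs.good (by linarith), h.near hs.good (by linarith),
    fun k _ hk => hfar _ _ (hleft k hk) u1, fun k _ hk => hfar _ _ (hright k hk) u2,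
    slope_top hy hLr h.L_le hp h.p_le hK' (hleft K le_rfl),
    slope_top hy hLr h.L_le hp h.p_le hK' (hright K le_rfl)⟩, hKi, hKT⟩

/-- The largest scale of the wings. -/
lemma Scales.exists_top (h : Scales g c y T) (hL : 1 ≤ c.L₂) :
    ∃ K : ℕ, 1 ≤ K ∧ (2 : ℝ) ^ K * c.L₂ * g.p ≤ y ^ 99 / 2 ∧
      y ^ 99 / 4 ≤ (2 : ℝ) ^ K * c.L₂ * g.p := by
  have hy : 1000 ≤ y := h.y_ge
  have hy0 : 0 < y := by linarith
  have hLr : (1 : ℝ) ≤ c.L₂ := by exact_mod_cast hL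
  have hp1 : (1 : ℝ) ≤ g.p := by exact_mod_cast g.p_pos
  have hLp : (1 : ℝ) ≤ c.L₂ * g.p := one_le_mul_of_one_le_of_one_le hLr hp1
  have hLp' : (c.L₂ : ℝ) * g.p ≤ y ^ 2 := by
    rw [sq]
    exact mul_le_mul h.L_le h.p_le (by positivity) hy0.le
  have h99 : 1000 * y ^ 2 ≤ y ^ 99 := by
    calc 1000 * y ^ 2 ≤ y * y ^ 2 := by gcongr
      _ = y ^ 3 := by ring
      _ ≤ y ^ 99 := pow_le_pow_right₀ (by linarith) (by norm_num)
  obtain ⟨K, hK, hK'⟩ := exists_nat_pow_near (x := y ^ 99 / 2 / (c.L₂ * g.p)) (y := (2 : ℝ))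
    (by rw [one_le_div (by positivity)]; linarith [sq_nonneg y]) (by norm_num)
  rw [le_div_iff₀ (by positivity), ← mul_assoc] at hK
  rw [div_lt_iff₀ (by positivity), ← mul_assoc, pow_succ (2 : ℝ) K] at hK'
  refine ⟨K, ?_, hK, by linarith⟩
  by_contra! hK0
  have : K = 0 := by lia
  subst this
  norm_num at hK'
  linarith [sq_nonneg y]

/-- A geodesic which is neither of Type 3 nor of Type 6 is close to the middle at the outer
columns. -/
lemma Scales.abs_eta_le_of_relevant (h : Scales g c y T) (hs : GeoSetup g E d γ t)
    (hc : ColumnsOK g c E i j) (hp : c.Good g) (hl : LinesOK g c E i) (hj : |j| ≤ y ^ 80)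
    (hw : ∀ K : ℕ, (2 : ℝ) ^ K * c.L₂ * g.p ≤ y ^ 99 / 2 → WingsOK g E c.L₂ j i K)
    (hi : y ^ 99 ≤ ((i : ℝ) - 3) * g.p) (hT : y ^ 99 ≤ ((T : ℝ) - (i + 2)) * g.p)
    (hrel : Relevant g c γ t i j) :
    |eta g γ t j (i - 2)| ≤ c.L₀ / 20 ∧ |eta g γ t j (i + 1)| ≤ c.L₀ / 20 := by
  have hy : 1000 ≤ y := h.y_ge
  have hy0 : 0 < y := by linarith
  have hp0 : (0 : ℝ) < g.p := by exact_mod_cast g.p_pos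
  have hL : 1 ≤ c.L₂ := by
    have : (1 : ℝ) ≤ c.L₂ := by linarith [hp.L₁_bounds.2, c.L₁_le_L₂]
    exact_mod_cast this
  have hdiv : ∀ x : ℝ, y ^ 99 ≤ x * g.p → y ^ 98 ≤ x := fun x hx => by
    have hx0 : 0 < x := pos_of_mul_pos_left (lt_of_lt_of_le (by positivity) hx) hp0.le
    have h1 : x * g.p ≤ x * y := mul_le_mul_of_nonneg_left h.p_le hx0.le
    refine le_of_mul_le_mul_right ?_ hy0
    linarith [pow_succ y 98]
  have hi' := hdiv _ hi
  have hT' := hdiv _ hT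
  have h98 : (0 : ℝ) < y ^ 98 := by positivity
  have hi3 : 0 < i - 3 := by
    have : (0 : ℝ) < ((i - 3 : ℤ) : ℝ) := by push_cast; linarith
    exact_mod_cast this
  have hiT : i + 2 < T := by
    have : ((i + 2 : ℤ) : ℝ) < (T : ℝ) := by push_cast; linarith
    exact_mod_cast this
  obtain ⟨h1, h2⟩ := h.abs_eta_le hs hc hp hrel hj (hl.left _ _ le_rfl hi3 le_rfl)
    (hl.right _ _ le_rfl hiT (h.le_T le_rfl)) hi' hT'
  obtain ⟨K, hK1, hK, hK'⟩ := h.exists_top hL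
  obtain ⟨hγ, hKi, hKT⟩ := h.wingPath hs hl hj hL hK hK' hi hT h1 h2
  exact (hw K hK).abs_eta_le hγ hc hp hs hK1 hKi.le (h.le_T hKT.le) hrel

lemma wingsOK_of_evZs {Ψ Ψ' : Env} (hg : g.Good)
    (hz : ∀ k, 1 ≤ k → k ≤ K → evZs g c Ψ Ψ' i j k) :
    WingsOK g Ψ c.L₂ j i K ∧ WingsOK g Ψ' c.L₂ j i K := by
  have key : ∀ k, 1 ≤ k → k ≤ K →
      (ZBound g Ψ c.L₂ j (i - 3 - 2 ^ (k + 1) * c.L₂) (i - 3 - 2 ^ k * c.L₂) k ∧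
        ZBound g Ψ' c.L₂ j (i - 3 - 2 ^ (k + 1) * c.L₂) (i - 3 - 2 ^ k * c.L₂) k) ∧
      (ZBound g Ψ c.L₂ j (i - 3 - 2 ^ k * c.L₂) (i - 3) k ∧
        ZBound g Ψ' c.L₂ j (i - 3 - 2 ^ k * c.L₂) (i - 3) k) ∧
      (ZBound g Ψ c.L₂ j (i + 2) (i + 2 + 2 ^ k * c.L₂) k ∧
        ZBound g Ψ' c.L₂ j (i + 2) (i + 2 + 2 ^ k * c.L₂) k) ∧
      (ZBound g Ψ c.L₂ j (i + 2 + 2 ^ k * c.L₂) (i + 2 + 2 ^ (k + 1) * c.L₂) k ∧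
        ZBound g Ψ' c.L₂ j (i + 2 + 2 ^ k * c.L₂) (i + 2 + 2 ^ (k + 1) * c.L₂) k) := by
    intro k h1 hk
    obtain ⟨z1, z2, z3, z4⟩ := hz k h1 hk
    rw [show i - 2 ^ (k + 1) * (c.L₂ : ℤ) - 3 = i - 3 - 2 ^ (k + 1) * c.L₂ by ring] at z1
    rw [show i - 2 ^ k * (c.L₂ : ℤ) - 3 = i - 3 - 2 ^ k * c.L₂ by ring] at z2
    rw [show i + 2 ^ k * (c.L₂ : ℤ) + 2 = i + 2 + 2 ^ k * c.L₂ by ring] at z4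
    exact ⟨z1.zBound hg (by ring), z2.zBound hg (by ring), z3.zBound hg rfl,
      z4.zBound hg (by ring)⟩
  exact ⟨⟨fun k h1 hk => (key k h1 hk).1.1, fun k h1 hk => (key k h1 hk).2.1.1,
      fun k h1 hk => (key k h1 hk).2.2.1.1, fun k h1 hk => (key k h1 hk).2.2.2.1⟩,
    ⟨fun k h1 hk => (key k h1 hk).1.2, fun k h1 hk => (key k h1 hk).2.1.2,
      fun k h1 hk => (key k h1 hk).2.2.1.2, fun k h1 hk => (key k h1 hk).2.2.2.2⟩⟩

end Assembly

/-! ### Types and blocks -/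

section Types

variable {g : Grid} {c : Consts} {E : Env} {d : ℝ} {γ : ℝ → Plane} {t : ℤ → ℝ} {i : ℤ} {j : ℝ}

lemma InColumn.isType1 (h : InColumn g E d γ t i)
    (hs : ∀ τ ∈ stay g t i, -(c.L₀ / 2) ≤ relHeight g γ j τ ∧ relHeight g γ j τ ≤ c.L₀ / 2) :
    IsType1 g c i j (segment g i γ t) := by
  unfold IsType1
  rw [sub_eq_add_neg]
  exact h.trace_subset_iff.2 hs

lemma InColumn.isType3_iff (h : InColumn g E d γ t i) :
    IsType3 g c i j (segment g i γ t) ↔ ∀ τ ∈ stay g t i,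
      -√c.α - 5 / 3 * c.w ≤ relHeight g γ j τ ∧
        relHeight g γ j τ ≤ -√c.α + c.h + 5 / 3 * c.w := by
  unfold IsType3
  rw [show j - √c.α - 5 / 3 * c.w = j + (-√c.α - 5 / 3 * c.w) by ring,
    show j - √c.α + c.h + 5 / 3 * c.w = j + (-√c.α + c.h + 5 / 3 * c.w) by ring]
  exact h.trace_subset_iff

/-- Types 1, 2, 4 and 5 each require a point of the path within `L₁ + 2 / W_r` of the middle. -/
lemma InColumn.isType6_of_forall (h : InColumn g E d γ t i) (hp : c.Good g)
    (h3 : ¬ IsType3 g c i j (segment g i γ t))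
    (hs : ∀ τ ∈ stay g t i, c.L₁ + 2 / g.Wr < |relHeight g γ j τ|) :
    IsType6 g c i j (segment g i γ t) := by
  have hδ : 0 < 2 / g.Wr := div_pos two_pos h.good.Wr_pos
  obtain ⟨hL, hL'⟩ := hp.L₁_bounds
  have hL₀ := hp.L₀_ge
  have hw := hp.w_pos
  have out : ∀ τ ∈ stay g t i, ∀ lo hi : ℝ, -(c.L₁ + 2 / g.Wr) ≤ lo → hi ≤ c.L₁ + 2 / g.Wr →
      γ τ ∉ rect g i (j + lo) (j + hi) := by
    intro τ hτ lo hi hlo hhi hmem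
    have := (h.mem_rect hτ).1 hmem
    have := hs τ hτ
    have : |relHeight g γ j τ| ≤ c.L₁ + 2 / g.Wr := abs_le.2 ⟨by linarith, by linarith⟩
    linarith
  have hl := h.left_mem_stay
  have hseg : ∀ x ∈ segment g i γ t, ∃ τ ∈ stay g t i, γ τ = x := fun x hx => hx
  refine ⟨fun h1 => ?_, fun h2 => ?_, h3, fun h4 => ?_, fun h5 => ?_⟩
  · refine out _ hl (-(c.L₀ / 2)) (c.L₀ / 2) (by linarith) (by linarith) ?_
    rw [← sub_eq_add_neg]
    exact h1 ⟨_, hl, rfl⟩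
  · refine out _ hl (-(3 / 2 * c.L₀)) (3 / 2 * c.L₀) (by linarith) (by linarith) ?_
    rw [← sub_eq_add_neg]
    exact h2.2 ⟨_, hl, rfl⟩
  · obtain ⟨x, hx, hx'⟩ := h4.2.2.2
    obtain ⟨τ, hτ, rfl⟩ := hseg x hx
    refine out τ hτ (-c.L₁ + c.w) (c.L₁ - c.w) (by linarith) (by linarith) ?_
    convert hx' using 1
    ring_nf
  · obtain ⟨x, hx, hx'⟩ := h5.2.2.2.2
    obtain ⟨τ, hτ, rfl⟩ := hseg x hx
    refine out τ hτ (-(c.L₁ + 2 / g.Wr)) (c.L₁ + 2 / g.Wr) le_rfl le_rfl ?_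
    convert hx' using 1
    ring_nf

lemma InColumn.forall_of_isType6 (h : InColumn g E d γ t i)
    (h6 : IsType6 g c i j (segment g i γ t)) :
    ∀ τ ∈ stay g t i, c.L₁ + 2 / g.Wr < |relHeight g γ j τ| := by
  intro τ hτ
  by_contra! hcon
  obtain ⟨h1, h2, h3, h4, h5⟩ := h6
  refine h5 ⟨h1, h2, h3, h4, γ τ, ⟨τ, hτ, rfl⟩, ?_⟩
  have := (h.mem_rect hτ).2 (abs_le.1 hcon)
  convert this using 1
  ring_nf

lemma InColumn.relevant (h : InColumn g E d γ t i) (hp : c.Good g)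
    (h3 : ¬ IsType3 g c i j (segment g i γ t)) (h6 : ¬ IsType6 g c i j (segment g i γ t)) :
    Relevant g c γ t i j := by
  constructor
  · by_contra! hcon
    exact h3 (h.isType3_iff.2 hcon)
  · by_contra! hcon
    exact h6 (h.isType6_of_forall hp h3 hcon)

lemma abs_coord_sub_le (x y : Plane) (k : Fin 2) : |x k - y k| ≤ dist x y := by
  rw [dist_eq_norm]
  have := PiLp.norm_apply_le (x - y) k
  rwa [PiLp.sub_apply, Real.norm_eq_abs] at this

/-- Two geodesics which are far apart in a column at scale `r` do not visit the same block. -/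
lemma not_visits_both {E' : Env} {d' : ℝ} {γ' : ℝ → Plane} {t' : ℤ → ℝ}
    (h : InColumn g E d γ t i) (h' : InColumn g E' d' γ' t' i) (hW : g.Wn ≤ g.Wr)
    (hδ : 2 / g.Wr ≤ 1)
    (hfar : ∀ τ ∈ stay g t i, ∀ τ' ∈ stay g t' i,
      2 < |relHeight g γ j τ - relHeight g γ' j τ'|) {i' k : ℤ}
    (h1 : (i - 1) * g.p + 1 ≤ i') (h2 : i' ≤ i * g.p) :
    ¬ (Visits g i' k γ t ∧ Visits g i' k γ' t') := by
  rintro ⟨⟨x, ⟨τ, hτ, rfl⟩, u, hu, hxu⟩, ⟨x', ⟨τ', hτ', rfl⟩, u', hu', hxu'⟩⟩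
  have hWr := h.good.Wr_pos
  have hstay : ∀ {E₁ : Env} {d₁ : ℝ} {γ₁ : ℝ → Plane} {t₁ : ℤ → ℝ} {σ : ℝ},
      InColumn g E₁ d₁ γ₁ t₁ i → σ ∈ Icc (t₁ (i' - 1)) (t₁ i') → σ ∈ stay g t₁ i := by
    intro E₁ d₁ γ₁ t₁ σ hc hσ
    have hl := hc.left_nonneg
    have hr := hc.le
    exact ⟨(hc.geo.time_mono hl (by lia) (by lia)).trans hσ.1,
      hσ.2.trans (hc.geo.time_mono (by lia) h2 hr)⟩
  have hf := hfar τ (hstay h hτ) τ' (hstay h' hτ')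
  have e : relHeight g γ j τ - relHeight g γ' j τ' = (γ τ 1 - γ' τ' 1) / g.Wr := by
    unfold relHeight
    ring
  rw [e, abs_div, abs_of_pos hWr, lt_div_iff₀ hWr] at hf
  rw [div_le_one hWr] at hδ
  have a1 := abs_le.1 ((abs_coord_sub_le (γ τ) u 1).trans hxu)
  have a2 := abs_le.1 ((abs_coord_sub_le (γ' τ') u' 1).trans hxu')
  obtain ⟨-, -, b1, b2⟩ := hu
  obtain ⟨-, -, b3, b4⟩ := hu'
  -- The height `W_n` of the block and the two unit distances give at most `W_n + 2 ≤ 2 W_r`.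
  have : |γ τ 1 - γ' τ' 1| ≤ 2 * g.Wr := by
    rw [abs_le]
    constructor <;> linarith [a1.1, a1.2, a2.1, a2.2]
  linarith

end Types

/-! ### Comparison of the two geodesics -/

section Conclusion

variable {g : Grid} {c : Consts} {E E' : Env} {d y : ℝ} {γ γ' : ℝ → Plane} {t t' : ℤ → ℝ}
  {i T J : ℤ}

/-- All the conditions on one environment. -/
structure EnvOK (g : Grid) (c : Consts) (E : Env) (i : ℤ) (j y : ℝ) : Prop where
  columns : ColumnsOK g c E i j
  lines : LinesOK g c E i
  wings : ∀ K : ℕ, (2 : ℝ) ^ K * c.L₂ * g.p ≤ y ^ 99 / 2 → WingsOK g E c.L₂ j i K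

/-- Both environments satisfy the conditions that put a relevant geodesic in the middle with excess
at least `-4 L₀`; only the second offers the cheap slot, and this contradicts that lower bound. -/
theorem types_of_envOK (h : Scales g c y T) (hp : c.Good g) (hs : GeoSetup g E d γ t)
    (hs' : GeoSetup g E' d γ' t') (he : EnvOK g c E i J y) (he' : EnvOK g c E' i J y)
    (hJ : |(J : ℝ)| ≤ y ^ 80) (hJi : J = exitIndex g i γ t)
    (hi : y ^ 99 ≤ ((i : ℝ) - 3) * g.p) (hT : y ^ 99 ≤ ((T : ℝ) - (i + 2)) * g.p)
    (hα : √c.α * c.L₀ ^ 2 ≤ c.α ^ (9 / 10 : ℝ)) (hα' : 0 ≤ c.α)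
    (hch : evIminus g E' i (J - √c.α) (J - √c.α + c.h) (-(c.α + c.α ^ (9 / 10 : ℝ)))) :
    IsType1 g c i J (segment g i γ t) ∧
    (IsType3 g c i J (segment g i γ' t') ∨ IsType6 g c i J (segment g i γ' t')) ∧
    ∀ i' : ℤ, (i - 1) * g.p + 1 ≤ i' → i' ≤ i * g.p → ∀ k : ℤ,
      ¬ (Visits g i' k γ t ∧ Visits g i' k γ' t') := by
  have hy : 1000 ≤ y := h.y_ge
  have h99 : (0 : ℝ) < y ^ 99 := by positivity
  have hp0 : (0 : ℝ) < g.p := by exact_mod_cast g.p_pos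
  have hi3 : 3 ≤ i := by
    have : (0 : ℝ) < ((i - 3 : ℤ) : ℝ) := by
      push_cast
      exact pos_of_mul_pos_left (h99.trans_le hi) hp0.le
    have : 0 < i - 3 := by exact_mod_cast this
    lia
  have hiT : i + 2 ≤ T := by
    have : (0 : ℝ) < ((T - (i + 2) : ℤ) : ℝ) := by
      push_cast
      exact pos_of_mul_pos_left (h99.trans_le hT) hp0.le
    have : 0 < T - (i + 2) := by exact_mod_cast this
    lia
  have hM := h.le_T hiT
  have hcol := hs.inColumn (i := i) (by lia) (h.le_T (by lia))
  have hcol' := hs'.inColumn (i := i) (by lia) (h.le_T (by lia))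
  obtain ⟨hL, hL'⟩ := hp.L₁_bounds
  have hL₀ := hp.L₀_ge
  have hA := hp.α_ge
  have hw := hp.w_le
  have hh := hp.h_le
  have hδ : 0 < 2 / g.Wr := div_pos two_pos hs.good.Wr_pos
  -- The relative exit height is a fractional part, so it is above the slot and within `L₁` of the
  -- middle.
  have hrel : Relevant g c γ t i J := by
    have hm : relHeight g γ J (t (i * g.p)) = Int.fract (γ (t (i * g.p)) 1 / g.Wr) := by
      rw [hJi]
      rfl
    have f0 := Int.fract_nonneg (γ (t (i * g.p)) 1 / g.Wr)
    have f1 := Int.fract_lt_one (γ (t (i * g.p)) 1 / g.Wr)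
    exact ⟨⟨_, hcol.right_mem_stay, Or.inr (by rw [hm]; linarith)⟩,
      ⟨_, hcol.right_mem_stay, by rw [hm, abs_of_nonneg f0]; linarith⟩⟩
  obtain ⟨hl, hr⟩ := h.abs_eta_le_of_relevant hs he.columns hp he.lines hJ he.wings hi hT hrel
  have hin := (he.columns.inner_type hp hs hi3 hM hrel hl hr).1
  have htype : IsType3 g c i J (segment g i γ' t') ∨ IsType6 g c i J (segment g i γ' t') := by
    by_contra! hcon
    have hrel' := hcol'.relevant hp hcon.1 hcon.2
    obtain ⟨hl', hr'⟩ :=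
      h.abs_eta_le_of_relevant hs' he'.columns hp he'.lines hJ he'.wings hi hT hrel'
    have h1 := (he'.columns.inner_type hp hs' hi3 hM hrel' hl' hr').2
    have h2 := he'.columns.excess_lt_of_cheap hp hs' hi3 hM hl' hr' hα hα' hch
    linarith
  refine ⟨hcol.isType1 hin, htype, fun i' h1 h2 k => ?_⟩
  refine not_visits_both (j := J) hcol hcol' h.Wn_le (by linarith [hp.Wr_ge]) ?_ h1 h2
  intro τ hτ τ' hτ'
  have hτ1 := hin τ hτ
  -- Type 1 keeps `γ` within `L₀/2`, whereas the slot lies below `-4 L₀ + 2` and Type 6 keeps `γ'`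
  -- beyond `L₁ ≥ 16 L₀`.
  rcases htype with h3 | h6
  · have := hcol'.isType3_iff.1 h3 τ' hτ'
    refine lt_of_lt_of_le ?_ (le_abs_self _)
    linarith
  · have h6' := hcol'.forall_of_isType6 h6 τ' hτ'
    rcases lt_abs.1 h6' with h7 | h7
    · refine lt_of_lt_of_le ?_ (neg_le_abs _)
      linarith
    · refine lt_of_lt_of_le ?_ (le_abs_self _)
      linarith

end Conclusion

/-! ### The event `𝒫` and the choice of the parameters -/

lemma envOK_of_mem {Ω : Type*} [MeasurableSpace Ω] {P : Measure Ω} {S : Model P} {g : Grid}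
    {c : Consts} {Ψ Ψ' : Ω → Env} {i : ℤ} {j y : ℝ} {ω : Ω} (hg : g.Good)
    (hy : (g.M : ℝ) ^ (99 / 100 : ℝ) = y ^ 99)
    (hnear : ∀ η : ℝ, |η| ≤ c.L₁ → |(j + η) * g.Wr| ≤ g.M * g.Wn)
    (h : ω ∈ eventP S g c Ψ Ψ' i j) :
    EnvOK g c (Ψ ω) i j y ∧ EnvOK g c (Ψ' ω) i j y := by
  obtain ⟨⟨-, -, -, -, hC₁, hC₂, hloc⟩, hD₁, hD₂, hB, hstar, hglo⟩ := h
  have hz : ∀ K : ℕ, (2 : ℝ) ^ K * c.L₂ * g.p ≤ y ^ 99 / 2 →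
      ∀ k, 1 ≤ k → k ≤ K → evZs g c (Ψ ω) (Ψ' ω) i j k := by
    intro K hK k h1 hk
    -- The local and the global wing events together cover all scales; the size restriction in the
    -- global one is inherited from `K ≥ k`.
    rcases le_total k (g.m ^ 2) with hm | hm
    · exact hloc k h1 hm
    · refine hglo k hm ?_
      rw [hy]
      refine le_trans ?_ hK
      gcongr
      norm_num
  exact ⟨⟨⟨hB.centerOK.1, hD₁.outerOK.1, hD₂.outerOK.1, hC₁.1.1, hC₂.1.1, hC₁.1.2, hC₂.1.2, hnear⟩,
      ⟨hstar.1.1, hstar.1.2⟩, fun K hK => (wingsOK_of_evZs hg (hz K hK)).1⟩,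
    ⟨⟨hB.centerOK.2, hD₁.outerOK.2, hD₂.outerOK.2, hC₁.2.1, hC₂.2.1, hC₁.2.2, hC₂.2.2, hnear⟩,
      ⟨hstar.2.1, hstar.2.2⟩, fun K hK => (wingsOK_of_evZs hg (hz K hK)).2⟩⟩

/-! ### Arithmetic of the scales and of the parameters -/

/-- In terms of exponents of `2` this says that `Φ ^ ℓ ≤ M ^ (1/100)`. For `m = 0` the division is
degenerate, but the exponent of `Φ ^ ℓ` is then zero. -/
lemma Grid.exponent_le (g : Grid) (hℓ : (g.ℓ : ℝ) ≤ 1 / 100 * (⌊(2 ^ g.m / g.m ^ 5 : ℝ)⌋ : ℝ)) :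
    100 * (g.m ^ 5 * g.ℓ) ≤ 2 ^ g.m := by
  rcases Nat.eq_zero_or_pos g.m with h0 | h0
  · rw [h0]
    simp
  · have hm : (0 : ℝ) < (g.m : ℝ) ^ 5 := by positivity
    have h1 := Int.floor_le (2 ^ g.m / g.m ^ 5 : ℝ)
    have h2 : 100 * (g.ℓ : ℝ) ≤ 2 ^ g.m / g.m ^ 5 := by linarith
    rw [le_div_iff₀ hm] at h2
    have h3 : ((100 * (g.m ^ 5 * g.ℓ) : ℕ) : ℝ) ≤ ((2 ^ g.m : ℕ) : ℝ) := by
      push_cast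
      linarith
    exact_mod_cast h3

lemma Grid.p_eq (g : Grid) : g.p = 2 ^ (g.m ^ 5 * g.ℓ) := (pow_mul 2 (g.m ^ 5) g.ℓ).symm

lemma Grid.p_dvd (g : Grid) (h : 100 * (g.m ^ 5 * g.ℓ) ≤ 2 ^ g.m) : g.p ∣ g.M := by
  rw [g.p_eq]
  exact pow_dvd_pow 2 (by lia)

lemma Grid.p_le (g : Grid) (h : 100 * (g.m ^ 5 * g.ℓ) ≤ 2 ^ g.m) :
    (g.p : ℝ) ≤ (g.M : ℝ) ^ (1 / 100 : ℝ) := by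
  have h1 : (g.p : ℝ) ^ 100 ≤ g.M := by
    have : g.p ^ 100 ≤ g.M := by
      rw [g.p_eq, ← pow_mul]
      exact Nat.pow_le_pow_right (by norm_num) (by lia)
    exact_mod_cast this
  have h2 := Real.rpow_le_rpow (z := (1 / 100 : ℝ)) (by positivity) h1 (by norm_num)
  rwa [← Real.rpow_natCast, ← Real.rpow_mul (by positivity),
    show ((100 : ℕ) : ℝ) * (1 / 100) = 1 by norm_num, Real.rpow_one] at h2

lemma rpow_hundredth_pow {M : ℝ} (hM : 0 ≤ M) (k : ℕ) :
    (M ^ (1 / 100 : ℝ)) ^ k = M ^ ((k : ℝ) / 100) := by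
  rw [← Real.rpow_natCast, ← Real.rpow_mul hM]
  congr 1
  ring

lemma rpow_bound {D y : ℝ} (hD : 0 ≤ D) (hy : 0 ≤ y) (h : D ≤ y ^ 100) :
    D ^ (1 / 2 + 1 / 100 : ℝ) ≤ y ^ 51 := by
  have h1 := Real.rpow_le_rpow (z := (1 / 2 + 1 / 100 : ℝ)) hD h (by norm_num)
  rwa [← Real.rpow_natCast, ← Real.rpow_mul hy,
    show ((100 : ℕ) : ℝ) * (1 / 2 + 1 / 100) = ((51 : ℕ) : ℝ) by norm_num,
    Real.rpow_natCast] at h1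

/-- With growth exponent `1/2 + 1/100`, `Q` gains a factor of at most `y ^ 51` over `y ^ 100`
columns, and the power of the logarithm contributes at most `y`; together this is the `y ^ 52` of
`Scales`. The bound for `W_r` uses only `Q_r ≤ Φ ^ ℓ Q_n`. -/
lemma scales_of_growth {g : Grid} {c : Consts} (hg : g.Good)
    (hexp : 100 * (g.m ^ 5 * g.ℓ) ≤ 2 ^ g.m)
    (hgrow : ∀ n₁ n₂ : ℝ, g.n ≤ n₁ → n₁ < n₂ →
      g.Q n₁ ≤ g.Q n₂ ∧ g.Q n₂ ≤ (n₂ / n₁) ^ (1 / 2 + 1 / 100 : ℝ) * g.Q n₁)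
    (hy : 1000 ≤ (g.M : ℝ) ^ (1 / 100 : ℝ)) (hL : (c.L₂ : ℝ) ≤ (g.M : ℝ) ^ (1 / 100 : ℝ))
    (hlog : Real.log g.M ^ (100 / c.θ₂) ≤ (g.M : ℝ) ^ (1 / 100 : ℝ)) :
    ∃ T : ℤ, Scales g c ((g.M : ℝ) ^ (1 / 100 : ℝ)) T := by
  obtain ⟨T, hT⟩ := g.p_dvd hexp
  have hp1 : (1 : ℝ) ≤ g.p := by exact_mod_cast g.p_pos
  have hn := hg.n_pos
  have hQn := hg.Qn_pos
  have hQr := hg.Qr_pos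
  have hM0 : (0 : ℝ) ≤ g.M := by positivity
  have hMy : (g.M : ℝ) = ((g.M : ℝ) ^ (1 / 100 : ℝ)) ^ 100 := by
    rw [rpow_hundredth_pow hM0]
    norm_num
  have hpy := g.p_le hexp
  set y := (g.M : ℝ) ^ (1 / 100 : ℝ) with hydef
  have hnr : g.n ≤ g.r := by
    unfold Grid.r
    exact le_mul_of_one_le_left hn.le hp1
  have hQ : g.Q g.n ≤ g.Qr ∧ g.Qr ≤ g.p * g.Q g.n := by
    rcases hnr.eq_or_lt with h | h
    · unfold Grid.Qr
      rw [← h]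
      exact ⟨le_rfl, le_mul_of_one_le_left hQn.le hp1⟩
    · refine ⟨(hgrow _ _ le_rfl h).1, (hgrow _ _ le_rfl h).2.trans ?_⟩
      unfold Grid.r
      rw [mul_div_cancel_right₀ _ hn.ne']
      gcongr
      exact Real.rpow_le_self_of_one_le hp1 (by norm_num)
  refine ⟨T, hMy, hy, hL, ?_, hpy, ?_, ?_, ?_⟩
  · rw [hT]
    push_cast
    ring
  · exact Real.sqrt_le_sqrt (mul_le_mul hnr hQ.1 hQn.le hg.r_pos.le)
  · refine le_trans ?_ (mul_le_mul_of_nonneg_right hpy hg.Wn_pos.le)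
    refine abs_le_of_sq_le_sq' ?_ (mul_nonneg (by linarith) hg.Wn_pos.le) |>.2
    rw [mul_pow, hg.Wr_sq, hg.Wn_sq]
    unfold Grid.r
    calc g.p * g.n * g.Qr ≤ g.p * g.n * (g.p * g.Q g.n) := by gcongr; exact hQ.2
      _ = _ := by ring
  · intro D hD hDM
    have hl0 : 0 ≤ Real.log g.M := Real.log_natCast_nonneg _
    have hy0 : 0 ≤ y := by linarith
    have hDy : D ≤ y ^ 100 := by
      rw [← hMy]
      refine le_of_mul_le_mul_right (le_trans ?_ hDM) hn
      gcongr
    have h1 : g.Q (D * g.r) ≤ y ^ 51 * g.Qr := by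
      rcases hD.eq_or_lt with h | h
      · rw [← h, one_mul]
        exact le_mul_of_one_le_left hQr.le (one_le_pow₀ (by linarith))
      · have h2 := (hgrow g.r (D * g.r) hnr (by nlinarith [hg.r_pos])).2
        rw [mul_div_cancel_right₀ _ hg.r_pos.ne'] at h2
        refine h2.trans ?_
        unfold Grid.Qr at hQr ⊢
        gcongr
        exact rpow_bound (by linarith) hy0 hDy
    calc Real.log g.M ^ (100 / c.θ₂) * g.Q (D * g.r) ≤
          Real.log g.M ^ (100 / c.θ₂) * (y ^ 51 * g.Qr) := by gcongr
      _ ≤ y * (y ^ 51 * g.Qr) := by gcongr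
      _ = _ := by ring

lemma eventually_large (L θ : ℝ) : ∀ᶠ x : ℝ in atTop, 1000 ≤ x ^ (1 / 100 : ℝ) ∧
    L ≤ x ^ (1 / 100 : ℝ) ∧ Real.log x ^ (100 / θ) ≤ x ^ (1 / 100 : ℝ) := by
  have h1 := tendsto_rpow_atTop (by norm_num : (0 : ℝ) < 1 / 100)
  have h2 := (isLittleO_log_rpow_rpow_atTop (100 / θ)
    (by norm_num : (0 : ℝ) < 1 / 100)).bound zero_lt_one
  filter_upwards [h1.eventually_ge_atTop 1000, h1.eventually_ge_atTop L, h2,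
    eventually_ge_atTop 0] with x a b e f
  refine ⟨a, b, ?_⟩
  rw [one_mul, Real.norm_of_nonneg (Real.rpow_nonneg f _)] at e
  exact (le_abs_self _).trans e

/-- The second bound splits `9/10 = 1/2 + 2/5` and uses `α ^ (2/5) ≥ L₀ ^ 40`. -/
lemma consts_bounds {L₀ α : ℝ} (hL₀ : 10000 ≤ L₀) (hα : L₀ ^ 100 ≤ α) :
    4 * L₀ ≤ √α ∧ √α * L₀ ^ 2 ≤ α ^ (9 / 10 : ℝ) := by
  have h0 : 0 < L₀ := by linarith
  have hα0 : 0 < α := lt_of_lt_of_le (by positivity) hα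
  constructor
  · refine Real.le_sqrt_of_sq_le (le_trans ?_ hα)
    calc (4 * L₀) ^ 2 = 16 * L₀ ^ 2 := by ring
      _ ≤ L₀ * L₀ ^ 2 := by gcongr; linarith
      _ = L₀ ^ 3 := by ring
      _ ≤ _ := pow_le_pow_right₀ (by linarith) (by norm_num)
  · rw [Real.sqrt_eq_rpow, show (9 / 10 : ℝ) = 1 / 2 + 2 / 5 by norm_num, Real.rpow_add hα0]
    gcongr
    have h1 := Real.rpow_le_rpow (z := (2 / 5 : ℝ)) (by positivity) hα (by norm_num)
    refine le_trans ?_ h1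
    rw [← Real.rpow_natCast L₀ 100, ← Real.rpow_mul h0.le,
      show ((100 : ℕ) : ℝ) * (2 / 5) = ((40 : ℕ) : ℝ) by norm_num, Real.rpow_natCast]
    exact pow_le_pow_right₀ (by linarith) (by norm_num)

end FPP

end

/-! ### The choice of the thresholds -/

theorem lemmal {Ω : Type*} [MeasurableSpace Ω] (P : MeasureTheory.Measure Ω)
    [MeasureTheory.IsProbabilityMeasure P] (S : FPP.Model P) (Q : ℝ → ℝ)
    (hQ : S.IsFluctuationScale Q) (κ : ℝ) (hκ : ∃ N : ℕ, 2 ≤ N ∧ κ = 1 / N)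
    (θ₂ : ℝ) (hθ₂ : 0 < θ₂) :
    ∃ β₀ : ℝ, 0 < β₀ ∧ ∀ β : ℝ, 0 < β → β < β₀ →
    ∃ L₀min : ℝ, ∀ L₀ : ℝ, L₀min ≤ L₀ →
    ∀ δA w : ℝ, 0 < δA → 0 < w → w ≤ 1 / 4 →
    ∃ L₁min : ℕ, ∀ L₁ : ℕ, L₁min ≤ L₁ →
    ∃ M₀ : ℕ, ∀ m : ℕ, M₀ ≤ 2 ^ 2 ^ m →
    ∃ n₀ : ℝ, ∀ n : ℝ, n₀ ≤ n →
    ∀ ℓ : ℕ, (ℓ : ℝ) ≤ 1 / 100 * (⌊(2 ^ m / m ^ 5 : ℝ)⌋ : ℝ) →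
    ∀ α h : ℝ, L₀ ^ 100 ≤ α → α ≤ 2 * κ⁻¹ * L₀ ^ 100 → 1 ≤ h → h ≤ 3 / 2 →
    ∀ g : FPP.Grid, g = ⟨Q, β, n, m, ℓ⟩ →
    ∀ c : FPP.Consts, c = ⟨L₀, L₁, w, α, h, δA, θ₂⟩ →
    ∀ Ξ Ξ' : ℤ → FPP.Plane → Ω → ℝ,
      (∀ k, FPP.IsFieldOf P S.K (S.colNoise g false k) (Ξ k)) →
      (∀ k, FPP.IsFieldOf P S.K (S.resampledNoise g κ k) (Ξ' k)) →
    ∀ Ψ Ψ' : Ω → FPP.Env,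
      (∀ ω k x, Ψ ω k x = S.ψ (Ξ k x ω)) → (∀ ω k x, Ψ' ω k x = S.ψ (Ξ' k x ω)) →
    ∀ i : ℤ, 2 * (g.M : ℝ) ^ (99 / 100 : ℝ) * g.n ≤ i * g.r →
      i * g.r ≤ (g.M - 2 * (g.M : ℝ) ^ (99 / 100 : ℝ)) * g.n →
    ∀ (ω : Ω) (γ γ' : ℝ → FPP.Plane) (t t' : ℤ → ℝ),
      FPP.IsGeodesic g (Ψ ω) γ t → FPP.IsGeodesic g (Ψ' ω) γ' t' →
    ∀ J : ℤ, J = FPP.exitIndex g i γ t →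
      |(J : ℝ)| * g.Wr ≤ (g.M : ℝ) ^ (4 / 5 : ℝ) * g.Wn →
      ω ∈ FPP.eventP S g c Ψ Ψ' i J →
    FPP.IsType1 g c i J (FPP.segment g i γ t) ∧
    (FPP.IsType3 g c i J (FPP.segment g i γ' t') ∨
      FPP.IsType6 g c i J (FPP.segment g i γ' t')) ∧
    ∀ i' : ℤ, (i - 1) * g.p + 1 ≤ i' → i' ≤ i * g.p → ∀ j : ℤ,
      ¬ (FPP.Visits g i' j γ t ∧ FPP.Visits g i' j γ' t') := by
  obtain ⟨_, _, a, θ, -, -, ha, -, hmono, -, -, hQa, -, hgrow, -, -⟩ := hQ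
  obtain ⟨ng, hng, hgrow⟩ := hgrow (1 / 100) (by norm_num)
  obtain ⟨na, hna⟩ := eventually_atTop.1 hQa
  obtain ⟨Nκ, hNκ, rfl⟩ := hκ
  -- Any positive `β` would do: it enters only through `n ^ β ≥ M`, which gives `M W_n ≤ H`.
  refine ⟨1, one_pos, fun β hβ _ => ⟨10000, fun L₀ hL₀ δA w hδA hw hw' => ?_⟩⟩
  -- This makes `4 * √α ≤ L₁` uniformly over the allowed range of `α`, which is quantified later.
  refine ⟨⌈4 * √(2 * (1 / (Nκ : ℝ))⁻¹ * L₀ ^ 100)⌉₊, fun L₁ hL₁ => ?_⟩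
  obtain ⟨M₀, hM₀⟩ := eventually_atTop.1 (FPP.eventually_large ((L₁ ^ 100 : ℕ) : ℝ) θ₂)
  refine ⟨⌈M₀⌉₊, fun m hm => ?_⟩
  obtain ⟨nβ, hnβ⟩ := eventually_atTop.1
    ((tendsto_rpow_atTop hβ).eventually_ge_atTop ((2 ^ 2 ^ m : ℕ) : ℝ))
  -- In turn: `Q_n ≥ n ^ a ≥ 1`, regular growth of `Q`, `n ^ β ≥ M`, and `W_n ≥ 6 / w`, which gives
  -- `2 / W_r ≤ w / 3`.
  refine ⟨max (max 1 ng) (max (max na nβ) ((6 / w) ^ 2)), fun n hn => ?_⟩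
  intro ℓ hℓ α h hα hα' hh hh' g hg c hc Ξ Ξ' hΞ hΞ' Ψ Ψ' hΨ hΨ' i hi hi' ω γ γ' t t' hγ hγ' J hJ
    hJM hω
  simp only [max_le_iff] at hn
  obtain ⟨⟨hn1, hng'⟩, ⟨hna', hnβ'⟩, hnw⟩ := hn
  have hn0 : 0 < n := by linarith
  have hgn : g.n = n := by rw [hg]
  have hgQ : g.Q = Q := by rw [hg]
  have hgM : g.M = 2 ^ 2 ^ m := by rw [hg]; rfl
  have hgβ : g.β = β := by rw [hg]
  have hcL₀ : c.L₀ = L₀ := by rw [hc]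
  have hcL₁ : c.L₁ = L₁ := by rw [hc]
  have hcL₂ : c.L₂ = L₁ ^ 100 := by rw [hc]; rfl
  have hcα : c.α = α := by rw [hc]
  have hQn1 : 1 ≤ Q n := (Real.one_le_rpow hn1 ha.le).trans (hna n hna')
  have hp1 : (1 : ℝ) ≤ g.p := by exact_mod_cast g.p_pos
  have hnr : n ≤ g.r := by
    unfold FPP.Grid.r
    rw [hgn]
    exact le_mul_of_one_le_left hn0.le hp1
  have hQr : Q n ≤ g.Qr := by
    unfold FPP.Grid.Qr
    rw [hgQ]
    exact hmono hn0 (hn0.trans_le hnr) hnr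
  have good : g.Good := by
    refine ⟨by rwa [hgn], by rw [hgQ, hgn]; linarith, by linarith, ?_⟩
    unfold FPP.Grid.H
    rw [hgn, hgβ, hgM]
    exact mul_le_mul_of_nonneg_right (hnβ n hnβ') (Real.sqrt_nonneg _)
  have hexp := g.exponent_le (by rw [hg]; exact hℓ)
  obtain ⟨hy, hyL, hylog⟩ := hM₀ (g.M : ℝ) ((Nat.le_ceil M₀).trans (by
    rw [hgM]
    exact_mod_cast hm))
  obtain ⟨T, hT⟩ := FPP.scales_of_growth (c := c) good hexp (by
    intro n₁ n₂ h1 h2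
    rw [hgn] at h1
    rw [hgQ]
    exact ⟨hmono (hn0.trans_le h1) (hn0.trans (h1.trans_lt h2)) h2.le,
      (hgrow n₁ n₂ (hng'.trans h1) h2).2⟩) hy (by rwa [hcL₂]) (by rw [hc]; exact hylog)
  have hM0 : (0 : ℝ) ≤ g.M := by positivity
  have h80 := FPP.rpow_hundredth_pow hM0 80
  have h99 := FPP.rpow_hundredth_pow hM0 99
  norm_num at h80 h99
  rw [← h80] at hJM
  rw [← h99] at hi hi'
  norm_num at hy hyL hylog hT
  generalize hydef : (g.M : ℝ) ^ (1 / 100 : ℝ) = y at *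
  have hy0 : 0 < y := by linarith
  obtain ⟨hα4, hα9⟩ := FPP.consts_bounds hL₀ hα
  have hα0 : 0 ≤ α := le_trans (by positivity) hα
  have hWn : 6 / w ≤ g.Wn := by
    unfold FPP.Grid.Wn FPP.Grid.W
    rw [hgn, hgQ]
    exact Real.le_sqrt_of_sq_le (hnw.trans (le_mul_of_one_le_right hn0.le hQn1))
  have hcg : c.Good g := by
    have hWr : 6 / w ≤ g.Wr := hWn.trans hT.Wn_le
    rw [hc]
    refine ⟨hw, hw', hh, hh', hL₀, hα4, ?_, ?_⟩
    · refine le_trans ?_ ((Nat.le_ceil _).trans (Nat.cast_le.2 hL₁))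
      gcongr
    · rw [div_le_iff₀ hw] at hWr
      rw [div_le_iff₀ good.Wr_pos]
      show 2 ≤ w / 3 * g.Wr
      linarith
  have hJy : |(J : ℝ)| ≤ y ^ 80 := by
    refine le_of_mul_le_mul_right (le_trans ?_ hJM) good.Wn_pos
    gcongr
    exact hT.Wn_le
  have hnear : ∀ η : ℝ, |η| ≤ c.L₁ → |((J : ℝ) + η) * g.Wr| ≤ g.M * g.Wn := by
    intro η hη
    refine hT.near good ((abs_add_le _ _).trans ?_)
    have h1 : (c.L₁ : ℝ) ≤ y := c.L₁_le_L₂.trans hT.L_le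
    have h2 : y ≤ y ^ 80 := le_self_pow₀ (by linarith) (by norm_num)
    have h3 : 2 * y ^ 80 ≤ y ^ 99 := by
      calc 2 * y ^ 80 ≤ y * y ^ 80 := by gcongr; linarith
        _ = y ^ 81 := by ring
        _ ≤ y ^ 99 := pow_le_pow_right₀ (by linarith) (by norm_num)
    linarith
  obtain ⟨he, he'⟩ := FPP.envOK_of_mem good h99.symm hnear hω
  have hreg : FPP.Env.Regular (Ψ ω) S.d₂ := by
    refine ⟨fun k => ?_, fun k x => ?_, fun k x => ?_⟩
    · have : Ψ ω k = fun x => S.ψ (Ξ k x ω) := funext fun x => hΨ ω k x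
      rw [this]
      exact S.ψ_smooth.continuous.comp ((hΞ k).continuous ω)
    · rw [hΨ]
      exact S.d₁_pos.trans (S.ψ_mem _).1
    · rw [hΨ]
      exact (S.ψ_mem _).2
  have hreg' : FPP.Env.Regular (Ψ' ω) S.d₂ := by
    refine ⟨fun k => ?_, fun k x => ?_, fun k x => ?_⟩
    · have : Ψ' ω k = fun x => S.ψ (Ξ' k x ω) := funext fun x => hΨ' ω k x
      rw [this]
      exact S.ψ_smooth.continuous.comp ((hΞ' k).continuous ω)
    · rw [hΨ']
      exact S.d₁_pos.trans (S.ψ_mem _).1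
    · rw [hΨ']
      exact (S.ψ_mem _).2
  have hpy := hT.p_le
  -- Since `p ≤ y`, one of the two factors `M ^ (99/100)` in the range of `i` pays for passing from
  -- `i` to `i - 3` and `i + 2`.
  have hy99 : 3 * y ≤ y ^ 99 := by
    calc 3 * y ≤ y * y := by gcongr; linarith
      _ = y ^ 2 := by ring
      _ ≤ y ^ 99 := pow_le_pow_right₀ (by linarith) (by norm_num)
  have hip : 2 * y ^ 99 ≤ i * g.p := by
    refine le_of_mul_le_mul_right (hi.trans_eq ?_) good.n_pos
    unfold FPP.Grid.r
    ring
  have hip' : i * g.p ≤ g.M - 2 * y ^ 99 := by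
    refine le_of_mul_le_mul_right (le_of_eq_of_le ?_ hi') good.n_pos
    unfold FPP.Grid.r
    ring
  have hTM : (T : ℝ) * g.p = g.M := by exact_mod_cast hT.T_mul
  exact FPP.types_of_envOK hT hcg ⟨good, hγ, hreg⟩ ⟨good, hγ', hreg'⟩ he he' hJy hJ (by linarith)
    (by linarith) (by rwa [hcα, hcL₀]) (by rwa [hcα]) hω.2.2.2.1.2.2.2.1.2
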